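/- For $w\in L^2([0,2]\times\mathbb R)$ let $Z[w]$ denote the solution on $(0,2]\times\mathbb R$ of $$\partial_t Z=\tfrac12\partial_{xx}Z+wZ,\qquad Z(0,\cdot)=\delta_0,$$ that is, with $p(t,x)=(2\pi t)^{-1/2}e^{-x^2/(2t)}$, the unique function bounded in absolute value by a constant multiple of $p$ such that $Z(t,x)=p(t,x)+\int_0^t\int_{\mathbb R}p(t-s,x-y)\,w(s,y)\,Z(s,y)\,dy\,ds$ for all $(t,x)\in(0,2]\times\mathbb R$. For $\lambda>0$ let $w(\lambda;\cdot,\cdot)$ be a minimizer of $$\inf\big\{\tfrac12\|w\|_{L^2([0,2]\times\mathbb R)}^2:\ Z[w](2,0)=e^{-\lambda}\big\}.$$ Put $Z_\lambda[w](t,x):=Z\big[\lambda w(\cdot,\lambda^{-1/2}\,\cdot)\big](t,\lambda^{1/2}x)$, $w_\lambda(t,x):=\lambda^{-1}w(\lambda;t,\lambda^{1/2}x)$ and $h_\lambda(t,x):=\frac1\lambda\log Z_\lambda[w_\lambda](t,x)$. **Proposition 4.1.** For every $\delta>0$ there is a constant $c(\delta)\in(0,\infty)$ such that, for all $\lambda\ge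 1/c(\delta)$ (and every minimizer $w(\lambda;\cdot,\cdot)$), all $t\in[\delta,2]$ and all $x,x'\in[-\delta^{-1},\delta^{-1}]$, the values $Z_\lambda[w_\lambda](t,x)$ and $Z_\lambda[w_\lambda](t,x')$ are positive and $$|h_\lambda(t,x)-h_\lambda(t,x')|\le c(\delta)\,|x-x'|^{\frac2{13}-\delta}.$$ -/

import Mathlib

open MeasureTheory Set

noncomputable section

/-- The standard heat kernel `p(t, x) = exp(-x² / (2t)) / √(2πt)` of `∂ₜ - ½ ∂ₓₓ` (used for `t > 0`). -/
def heatKernel (t x : ℝ) : ℝ :=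
  (Real.sqrt (2 * Real.pi * t))⁻¹ * Real.exp (-(x ^ 2) / (2 * t))

/-- Lebesgue measure on `[0, T] × ℝ`, as a measure on the pairs (time, space). -/
def slabMeasure (T : ℝ) : Measure (ℝ × ℝ) :=
  ((volume : Measure ℝ).restrict (Icc 0 T)).prod volume

/-- `Z` is the (mild) solution on `(0, 2] × ℝ` of the heat equation with potential `w`,
`∂ₜ Z = ½ ∂ₓₓ Z + w Z`, started from `Z(0, ·) = δ₀`.

The equation is read in its Duhamel form, at every point of `(0, 2] × ℝ`.  The bound by a multiple
of the heat kernel is the class of functions in which, for `w` in `L²([0, 2] × ℝ)`, the solution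
exists and is unique. -/
structure IsSolution (w : ℝ × ℝ → ℝ) (Z : ℝ → ℝ → ℝ) : Prop where
  aestronglyMeasurable : AEStronglyMeasurable (fun q : ℝ × ℝ => Z q.1 q.2) (slabMeasure 2)
  bound : ∃ C : ℝ, ∀ t ∈ Ioc (0 : ℝ) 2, ∀ x : ℝ, |Z t x| ≤ C * heatKernel t x
  integrable : ∀ t ∈ Ioc (0 : ℝ) 2, ∀ x : ℝ,
    Integrable (fun q : ℝ × ℝ => heatKernel (t - q.1) (x - q.2) * w q * Z q.1 q.2) (slabMeasure t)
  duhamel : ∀ t ∈ Ioc (0 : ℝ) 2, ∀ x : ℝ,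
    Z t x = heatKernel t x +
      ∫ q : ℝ × ℝ, heatKernel (t - q.1) (x - q.2) * w q * Z q.1 q.2 ∂(slabMeasure t)

/-- The cost `½ ‖w‖₂²` of a potential on `[0, 2] × ℝ`. -/
def cost (w : ℝ × ℝ → ℝ) : ℝ := 1 / 2 * ∫ q : ℝ × ℝ, (w q) ^ 2 ∂(slabMeasure 2)

/-- The potentials `w ∈ L²([0, 2] × ℝ)` whose solution satisfies `Z[w](2, 0) = exp (-lam)`. -/
def admissible (lam : ℝ) : Set (ℝ × ℝ → ℝ) :=
  {w | MemLp w 2 (slabMeasure 2) ∧ ∃ Z : ℝ → ℝ → ℝ, IsSolution w Z ∧ Z 2 0 = Real.exp (-lam)}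

/-- `w` minimizes `½ ‖w‖₂²` among the potentials with `Z[w](2, 0) = exp (-lam)`. -/
def IsMinimizer (lam : ℝ) (w : ℝ × ℝ → ℝ) : Prop :=
  w ∈ admissible lam ∧ ∀ w' ∈ admissible lam, cost w ≤ cost w'

/-- `Z` is the scaled solution `Z_lam[w](t, x) = Z[lam w(·, lam^(-1/2) ·)](t, lam^(1/2) x)`. -/
def IsScaledSolution (lam : ℝ) (w : ℝ × ℝ → ℝ) (Z : ℝ → ℝ → ℝ) : Prop :=
  ∃ U : ℝ → ℝ → ℝ,
    IsSolution (fun q : ℝ × ℝ => lam * w (q.1, (Real.sqrt lam)⁻¹ * q.2)) U ∧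
      ∀ t x : ℝ, Z t x = U t (Real.sqrt lam * x)

/-- The scaled potential `w_lam(t, x) = lam⁻¹ w(t, lam^(1/2) x)`. -/
def scaledPotential (lam : ℝ) (w : ℝ × ℝ → ℝ) : ℝ × ℝ → ℝ :=
  fun q => lam⁻¹ * w (q.1, Real.sqrt lam * q.2)

/-- The scaled logarithm `lam⁻¹ log Z(t, x)`. -/
def logProfile (lam : ℝ) (Z : ℝ → ℝ → ℝ) (t x : ℝ) : ℝ := 1 / lam * Real.log (Z t x)

end

open MeasureTheory Set
open scoped ENNReal NNReal

noncomputable section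

/-! The scalings in the statement cancel: `Z_lam[w_lam](t, x)` is `Z[w](t, √lam * x)` for the
unscaled minimizer `w`. So the claim concerns oscillations of `log Z[w]` of order `lam` over
distances `√lam * |x - x'|`.

For `lam ≥ 2` there are two a priori facts. A minimizer is nonpositive a.e., since its negative
part, multiplied by a factor in `[0, 1]`, is a competitor of no larger cost (`IsMinimizer.nonpos`).
A constant negative potential on a box gives `‖w‖₂² ≤ 54 lam^(5/2)`
(`IsMinimizer.cost_le_of_two_le`). Thus `Z` solves a heat equation with killing rate `|w|`.

Compare `Z(t, ·)` with the free evolution of `Z(s, ·)` over the time `t - s = σ^5`. Killing gives `Z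
≤` free evolution. Conversely, killing costs at most a factor `exp (-66 lam σ)`
(`MildFrom.evol_mul_exp_le`). For this, Brownian bridges are shifted along `u Ψ`, where the profile
`Ψ` has height `R` and vanishes at both ends, and the amplitude `u` ranges over `[-1, 1]`. The shift
has energy of order `R²/(t - s)`. Spreading the paths bounds their density by `1/(2Ψ)`, so by
Young's inequality some amplitude meets killing of order at most `θ ‖w‖₂² + (t - s)/(R θ)`. With `R
= √lam σ³` and `θ = σ lam^(-3/2)` all terms are of order `lam σ` (`KilledFrom.fan`,
`KilledFrom.lower_bound`). No Feynman–Kac formula is needed: short-time Duhamel bounds are chained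
and Jensen's inequality merges them into one bridge average.

The free evolution of a function bounded by `M` satisfies a Harnack inequality
(`log_heat_sub_log_heat_le`): its logarithm varies by at most `ε (log M - log P f) + (x - x')²/(2τ)
(1 + 1/ε)`. With `Δ = |x - x'|`, `τ = σ^5` proportional to `Δ` and `ε = √Δ`, the total is of order
`lam Δ^(1/5)`, and `1/5` exceeds `2/13 - δ`.

Since the constant `c` also determines the range `lam ≥ 1/c`, values `lam < 2` have to be covered.
There the cost of minimizers is bounded (`exists_cost_le_of_lt_two`), and perturbation theory with
the same Harnack inequality gives exponent `1/4`; the powers of `lam` are absorbed by using `c * lam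
≥ 1`. -/

/-! ### Gaussian kernels and Brownian bridge densities -/

lemma heatKernel_of_nonpos {t : ℝ} (ht : t ≤ 0) (x : ℝ) : heatKernel t x = 0 := by
  unfold heatKernel
  rw [Real.sqrt_eq_zero_of_nonpos]
  · simp
  · have := Real.pi_pos
    nlinarith

lemma heatKernel_nonneg (t x : ℝ) : 0 ≤ heatKernel t x := by
  unfold heatKernel
  positivity

lemma heatKernel_pos {t : ℝ} (ht : 0 < t) (x : ℝ) : 0 < heatKernel t x := by
  unfold heatKernel
  positivity

lemma heatKernel_le (t x : ℝ) : heatKernel t x ≤ (Real.sqrt (2 * Real.pi * t))⁻¹ := by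
  rcases le_or_gt t 0 with ht | ht
  · rw [heatKernel_of_nonpos ht]; positivity
  · unfold heatKernel
    apply mul_le_of_le_one_right (by positivity)
    rw [Real.exp_le_one_iff]
    apply div_nonpos_of_nonpos_of_nonneg <;> nlinarith [sq_nonneg x]

lemma measurable_heatKernel : Measurable (fun q : ℝ × ℝ => heatKernel q.1 q.2) := by
  unfold heatKernel
  fun_prop

@[fun_prop]
lemma Measurable.heatKernel {α : Type*} [MeasurableSpace α] {f g : α → ℝ} (hf : Measurable f)
    (hg : Measurable g) : Measurable (fun a => heatKernel (f a) (g a)) :=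
  measurable_heatKernel.comp (hf.prodMk hg)

/-- The heat kernel with values in the extended nonnegative reals. -/
def hk (t x : ℝ) : ℝ≥0∞ := ENNReal.ofReal (heatKernel t x)

@[fun_prop]
lemma Measurable.hk {α : Type*} [MeasurableSpace α] {f g : α → ℝ} (hf : Measurable f)
    (hg : Measurable g) : Measurable (fun a => hk (f a) (g a)) :=
  (hf.heatKernel hg).ennreal_ofReal

lemma hk_of_nonpos {t : ℝ} (ht : t ≤ 0) (x : ℝ) : hk t x = 0 := by
  simp [hk, heatKernel_of_nonpos ht]

lemma hk_ne_top (t x : ℝ) : hk t x ≠ ∞ := ENNReal.ofReal_ne_top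

lemma hk_lt_top (t x : ℝ) : hk t x < ∞ := ENNReal.ofReal_lt_top

lemma hk_ne_zero {t : ℝ} (ht : 0 < t) (x : ℝ) : hk t x ≠ 0 := by
  simp [hk, heatKernel_pos ht]

lemma toReal_hk (t x : ℝ) : (hk t x).toReal = heatKernel t x :=
  ENNReal.toReal_ofReal (heatKernel_nonneg t x)

lemma heatKernel_eq_gaussianPDFReal {t : ℝ} (ht : 0 ≤ t) (c x : ℝ) :
    heatKernel t (x - c) = ProbabilityTheory.gaussianPDFReal c ⟨t, ht⟩ x := by
  simp only [heatKernel, ProbabilityTheory.gaussianPDFReal]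
  rfl

lemma hk_eq_gaussianPDF {t : ℝ} (ht : 0 ≤ t) (c x : ℝ) :
    hk t (x - c) = ProbabilityTheory.gaussianPDF c ⟨t, ht⟩ x := by
  simp [hk, ProbabilityTheory.gaussianPDF, heatKernel_eq_gaussianPDFReal ht]

lemma heatKernel_neg (t x : ℝ) : heatKernel t (-x) = heatKernel t x := by
  simp [heatKernel]

lemma hk_neg (t x : ℝ) : hk t (-x) = hk t x := by simp [hk, heatKernel_neg]

lemma hk_sub_comm (t x y : ℝ) : hk t (x - y) = hk t (y - x) := by
  rw [← hk_neg, neg_sub]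

lemma lintegral_hk {t : ℝ} (ht : 0 < t) (c : ℝ) : ∫⁻ x, hk t (x - c) = 1 := by
  simp_rw [hk_eq_gaussianPDF ht.le]
  exact ProbabilityTheory.lintegral_gaussianPDF_eq_one c (fun h => ht.ne' (congrArg Subtype.val h))

/-- Completing the square: the joint law of two independent increments is the law of their sum times
the conditional law of one of them. Chapman–Kolmogorov and all bridge formulas rest on this
identity. -/
lemma heatKernel_mul {a b : ℝ} (ha : 0 < a) (hb : 0 < b) (u v : ℝ) :
    heatKernel a u * heatKernel b v =
      heatKernel (a + b) (u + v) * heatKernel (a * b / (a + b)) (v - b / (a + b) * (u + v)) := by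
  have hab : 0 < a + b := by positivity
  unfold heatKernel
  rw [mul_mul_mul_comm, mul_mul_mul_comm (Real.sqrt (2 * Real.pi * (a + b)))⁻¹, ← Real.exp_add, ← Real.exp_add, ← mul_inv, ← mul_inv,
    ← Real.sqrt_mul (by positivity), ← Real.sqrt_mul (by positivity)]
  congr 2
  · congr 1
    field_simp
  · field_simp
    ring

lemma hk_mul {a b : ℝ} (ha : 0 < a) (hb : 0 < b) (u v : ℝ) :
    hk a u * hk b v = hk (a + b) (u + v) * hk (a * b / (a + b)) (v - b / (a + b) * (u + v)) := by
  simp only [hk]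
  rw [← ENNReal.ofReal_mul (heatKernel_nonneg _ _), ← ENNReal.ofReal_mul (heatKernel_nonneg _ _),
    heatKernel_mul ha hb]

/-- The product of two kernels that meet at `(r, z)`, in terms of the bridge density. -/
lemma hk_mul_bridge {s r t : ℝ} (hsr : s < r) (hrt : r < t) (x y z : ℝ) :
    hk (t - r) (x - z) * hk (r - s) (z - y) =
      hk (t - s) (x - y) * hk ((t - r) * (r - s) / (t - s))
        (z - (y + (r - s) / (t - s) * (x - y))) := by
  rw [hk_mul (sub_pos.2 hrt) (sub_pos.2 hsr)]
  congr 2 <;> ring_nf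

/-- Chapman–Kolmogorov. -/
lemma lintegral_hk_mul_hk {a b : ℝ} (ha : 0 < a) (hb : 0 < b) (x y : ℝ) :
    ∫⁻ z, hk a (x - z) * hk b (z - y) = hk (a + b) (x - y) := by
  have h : ∀ z, hk a (x - z) * hk b (z - y) = hk (a + b) (x - y) *
      hk (a * b / (a + b)) (z - (y + b / (a + b) * (x - y))) := by
    intro z
    rw [hk_mul ha hb]
    congr 2 <;> ring_nf
  simp_rw [h]
  rw [lintegral_const_mul' _ _ (hk_ne_top _ _), lintegral_hk (by positivity), mul_one]

lemma hk_le (t x : ℝ) : hk t x ≤ ENNReal.ofReal ((Real.sqrt (2 * Real.pi * t))⁻¹) :=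
  ENNReal.ofReal_le_ofReal (heatKernel_le t x)

lemma lintegral_hk_sq_le {t : ℝ} (ht : 0 < t) (c : ℝ) :
    ∫⁻ x, hk t (x - c) ^ 2 ≤ ENNReal.ofReal ((Real.sqrt (2 * Real.pi * t))⁻¹) := by
  calc ∫⁻ x, hk t (x - c) ^ 2
      ≤ ∫⁻ x, ENNReal.ofReal ((Real.sqrt (2 * Real.pi * t))⁻¹) * hk t (x - c) := by
        apply lintegral_mono
        intro x
        simp only [sq]
        gcongr
        exact hk_le _ _
    _ = _ := by
        rw [lintegral_const_mul' _ _ ENNReal.ofReal_ne_top, lintegral_hk ht, mul_one]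

/-- Young's inequality replaces Cauchy–Schwarz throughout; the free parameter `θ` survives to the
end and is optimised only there. -/
lemma ENNReal.mul_le_half_sq {θ : ℝ} (hθ : 0 < θ) (a b : ℝ≥0∞) :
    a * b ≤ ENNReal.ofReal (θ / 2) * a ^ 2 + ENNReal.ofReal (1 / (2 * θ)) * b ^ 2 := by
  by_cases ha : a = ∞
  · subst ha
    have : ENNReal.ofReal (θ / 2) ≠ 0 := by simp; positivity
    simp [ENNReal.mul_top this]
  by_cases hb : b = ∞
  · subst hb
    have : ENNReal.ofReal (1 / (2 * θ)) ≠ 0 := by simp; positivity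
    rw [show (∞ : ℝ≥0∞) ^ 2 = ∞ by simp, ENNReal.mul_top this]
    simp
  lift a to ℝ≥0 using ha
  lift b to ℝ≥0 using hb
  rw [← ENNReal.ofReal_coe_nnreal, ← ENNReal.ofReal_coe_nnreal, ← ENNReal.ofReal_mul (by positivity),
    ← ENNReal.ofReal_pow (by positivity), ← ENNReal.ofReal_pow (by positivity),
    ← ENNReal.ofReal_mul (by positivity), ← ENNReal.ofReal_mul (by positivity),
    ← ENNReal.ofReal_add (by positivity) (by positivity)]
  apply ENNReal.ofReal_le_ofReal
  have h : θ / 2 * (a : ℝ) ^ 2 + 1 / (2 * θ) * (b : ℝ) ^ 2 - a * b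
      = 1 / (2 * θ) * (θ * a - b) ^ 2 := by
    field_simp
    ring
  have : 0 ≤ 1 / (2 * θ) * (θ * a - b) ^ 2 := by positivity
  linarith

lemma lintegral_inv_sqrt {T : ℝ} (hT : 0 ≤ T) :
    ∫⁻ r in Ioo 0 T, ENNReal.ofReal ((Real.sqrt r)⁻¹) = ENNReal.ofReal (2 * Real.sqrt T) := by
  have hi : IntervalIntegrable (fun r : ℝ => r ^ (-(1 / 2) : ℝ)) volume 0 T :=
    intervalIntegral.intervalIntegrable_rpow' (by norm_num)
  have h1 : ∫⁻ r in Ioo 0 T, ENNReal.ofReal ((Real.sqrt r)⁻¹)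
      = ∫⁻ r in Ioc 0 T, ENNReal.ofReal (r ^ (-(1 / 2) : ℝ)) := by
    rw [restrict_Ioo_eq_restrict_Ioc]
    apply setLIntegral_congr_fun measurableSet_Ioc
    intro r hr
    simp only
    rw [Real.rpow_neg hr.1.le, ← Real.sqrt_eq_rpow]
  rw [h1, ← ofReal_integral_eq_lintegral_ofReal]
  · rw [← intervalIntegral.integral_of_le hT, integral_rpow (Or.inl (by norm_num))]
    congr 1
    rw [Real.sqrt_eq_rpow]
    norm_num
    ring
  · exact (intervalIntegrable_iff_integrableOn_Ioc_of_le hT).1 hi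
  · filter_upwards [ae_restrict_mem measurableSet_Ioc] with r hr
    exact Real.rpow_nonneg hr.1.le _

/-- A bound of `(2π v)^(-1/2)` for the variance `v` of the Brownian bridge from time `s` to
time `t`, at time `r`. -/
def bridgeSup (s t r : ℝ) : ℝ := 1 / 2 * ((Real.sqrt (r - s))⁻¹ + (Real.sqrt (t - r))⁻¹)

@[fun_prop]
lemma measurable_bridgeSup (s t : ℝ) : Measurable (bridgeSup s t) := by
  unfold bridgeSup; fun_prop

lemma inv_sqrt_bridge_le {s r t : ℝ} (hsr : s < r) (hrt : r < t) :
    (Real.sqrt (2 * Real.pi * ((t - r) * (r - s) / (t - s))))⁻¹ ≤ bridgeSup s t r := by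
  have h1 : 0 < r - s := sub_pos.2 hsr
  have h2 : 0 < t - r := sub_pos.2 hrt
  have h3 : 0 < t - s := by linarith
  have hpi := Real.pi_gt_three
  unfold bridgeSup
  set A := (Real.sqrt (r - s))⁻¹ with hA
  set B := (Real.sqrt (t - r))⁻¹ with hB
  have hA0 : 0 ≤ A := by positivity
  have hB0 : 0 ≤ B := by positivity
  have hA2 : A ^ 2 = (r - s)⁻¹ := by rw [hA, inv_pow, Real.sq_sqrt h1.le]
  have hB2 : B ^ 2 = (t - r)⁻¹ := by rw [hB, inv_pow, Real.sq_sqrt h2.le]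
  rw [← Real.sqrt_inv]
  apply Real.sqrt_le_iff.2 ⟨by positivity, ?_⟩
  have e : (2 * Real.pi * ((t - r) * (r - s) / (t - s)))⁻¹ = (2 * Real.pi)⁻¹ * (A ^ 2 + B ^ 2) := by
    rw [hA2, hB2]
    field_simp
    ring
  rw [e]
  -- The inverse variance of the bridge is `A² + B² ≤ (A + B)²`, and the square root of `1/4` is the
  -- factor `1/2` of `bridgeSup`.
  have : (2 * Real.pi)⁻¹ ≤ 1 / 4 := by
    rw [one_div]; apply inv_anti₀ <;> linarith
  nlinarith [mul_nonneg hA0 hB0, sq_nonneg A, sq_nonneg B]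

lemma lintegral_bridgeSup_le {s t0 t : ℝ} (h : s ≤ t0) (ht : t0 ≤ t) :
    ∫⁻ r in Ioo t0 t, ENNReal.ofReal (bridgeSup s t r) ≤ ENNReal.ofReal (2 * Real.sqrt (t - t0)) := by
  have hT : 0 ≤ t - t0 := sub_nonneg.2 ht
  have h1 : ∫⁻ r in Ioo t0 t, ENNReal.ofReal ((Real.sqrt (r - t0))⁻¹)
      = ENNReal.ofReal (2 * Real.sqrt (t - t0)) := by
    rw [← lintegral_inv_sqrt hT]
    have := (measurePreserving_sub_right volume t0).setLIntegral_comp_preimage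
      (s := Ioo 0 (t - t0)) measurableSet_Ioo
      (f := fun r => ENNReal.ofReal ((Real.sqrt r)⁻¹)) (by fun_prop)
    simpa using this
  have h2 : ∫⁻ r in Ioo t0 t, ENNReal.ofReal ((Real.sqrt (t - r))⁻¹)
      = ENNReal.ofReal (2 * Real.sqrt (t - t0)) := by
    rw [← lintegral_inv_sqrt hT]
    have := (Measure.measurePreserving_sub_left volume t).setLIntegral_comp_preimage
      (s := Ioo 0 (t - t0)) measurableSet_Ioo
      (f := fun r => ENNReal.ofReal ((Real.sqrt r)⁻¹)) (by fun_prop)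
    simpa using this
  calc ∫⁻ r in Ioo t0 t, ENNReal.ofReal (bridgeSup s t r)
      ≤ ∫⁻ r in Ioo t0 t, ENNReal.ofReal (1 / 2) * (ENNReal.ofReal ((Real.sqrt (r - t0))⁻¹) +
          ENNReal.ofReal ((Real.sqrt (t - r))⁻¹)) := by
        apply setLIntegral_mono (by fun_prop)
        intro r hr
        rw [← ENNReal.ofReal_add (by positivity) (by positivity), ← ENNReal.ofReal_mul (by norm_num)]
        apply ENNReal.ofReal_le_ofReal
        unfold bridgeSup
        gcongr
        · exact Real.sqrt_pos.2 (sub_pos.2 hr.1)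
    _ = ENNReal.ofReal (2 * Real.sqrt (t - t0)) := by
        rw [lintegral_const_mul _ (by fun_prop), lintegral_add_left (by fun_prop), h1, h2,
          ← ENNReal.ofReal_add (by positivity) (by positivity), ← ENNReal.ofReal_mul (by norm_num)]
        congr 1
        ring

/-! ### The Duhamel operator and its contraction over short times -/

/-- The Duhamel operator `F ↦ ∫_{t0}^t ∫ p(t - s, x - y) W(s, y) F(s, y) dy ds`. -/
def duh (W : ℝ × ℝ → ℝ≥0∞) (t0 : ℝ) (F : ℝ × ℝ → ℝ≥0∞) (t x : ℝ) : ℝ≥0∞ :=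
  ∫⁻ q in Ioi t0 ×ˢ univ, hk (t - q.1) (x - q.2) * W q * F q

lemma setLIntegral_Ioi_prod {t0 t : ℝ} (f : ℝ × ℝ → ℝ≥0∞) (hf : ∀ q : ℝ × ℝ, t ≤ q.1 → f q = 0) :
    ∫⁻ q in Ioi t0 ×ˢ univ, f q = ∫⁻ q in Ioo t0 t ×ˢ univ, f q := by
  rw [← lintegral_indicator (measurableSet_Ioi.prod MeasurableSet.univ),
    ← lintegral_indicator (measurableSet_Ioo.prod MeasurableSet.univ)]
  apply lintegral_congr
  intro q
  simp only [indicator, mem_prod, mem_Ioi, mem_Ioo, mem_univ, and_true]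
  by_cases hq : t ≤ q.1
  · simp [hf q hq]
  · simp [not_le.1 hq]

lemma setLIntegral_prod_univ {s : Set ℝ} {f : ℝ × ℝ → ℝ≥0∞} (hf : Measurable f) :
    ∫⁻ q in s ×ˢ univ, f q = ∫⁻ r in s, ∫⁻ z, f (r, z) := by
  rw [Measure.volume_eq_prod, setLIntegral_prod _ hf.aemeasurable]
  simp

/-- A bridge average of `W` over the times after `t0`, bounded by the `L²` norm of `W`. -/
lemma duh_hk_le {W : ℝ × ℝ → ℝ≥0∞} (hW : Measurable W) {S : ℝ} (hS : 0 ≤ S)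
    (hWS : ∫⁻ q, W q ^ 2 ≤ ENNReal.ofReal S) {θ : ℝ} (hθ : 0 < θ) {s t0 t : ℝ} (h : s ≤ t0)
    (ht : t0 < t) (x y : ℝ) :
    duh W t0 (fun q => hk (q.1 - s) (q.2 - y)) t x ≤
      ENNReal.ofReal (1 / 2 * (θ * S + 2 * Real.sqrt (t - t0) / θ)) * hk (t - s) (x - y) := by
  have key : ∀ r ∈ Ioo t0 t, ∫⁻ z, hk (t - r) (x - z) * W (r, z) * hk (r - s) (z - y) ≤
      hk (t - s) (x - y) * (ENNReal.ofReal (θ / 2) * (∫⁻ z, W (r, z) ^ 2) +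
        ENNReal.ofReal (1 / (2 * θ)) * ENNReal.ofReal (bridgeSup s t r)) := by
    intro r hr
    have hsr : s < r := h.trans_lt hr.1
    have hv : 0 < (t - r) * (r - s) / (t - s) := by
      have := hr.2
      have h1 : 0 < r - s := sub_pos.2 hsr
      have h2 : 0 < t - r := sub_pos.2 hr.2
      have h3 : 0 < t - s := by linarith
      positivity
    calc ∫⁻ z, hk (t - r) (x - z) * W (r, z) * hk (r - s) (z - y)
        = ∫⁻ z, hk (t - s) (x - y) * (W (r, z) * hk ((t - r) * (r - s) / (t - s))
            (z - (y + (r - s) / (t - s) * (x - y)))) := by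
          apply lintegral_congr
          intro z
          rw [mul_right_comm, hk_mul_bridge hsr hr.2]
          ring
      _ ≤ ∫⁻ z, hk (t - s) (x - y) * (ENNReal.ofReal (θ / 2) * W (r, z) ^ 2 +
            ENNReal.ofReal (1 / (2 * θ)) * hk ((t - r) * (r - s) / (t - s))
            (z - (y + (r - s) / (t - s) * (x - y))) ^ 2) := by
          apply lintegral_mono
          intro z
          dsimp only
          gcongr
          exact ENNReal.mul_le_half_sq hθ _ _
      _ ≤ _ := by
          rw [lintegral_const_mul' _ _ (hk_ne_top _ _), lintegral_add_left (by fun_prop),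
            lintegral_const_mul' _ _ ENNReal.ofReal_ne_top,
            lintegral_const_mul' _ _ ENNReal.ofReal_ne_top]
          gcongr
          exact (lintegral_hk_sq_le hv _).trans
            (ENNReal.ofReal_le_ofReal (inv_sqrt_bridge_le hsr hr.2))
  have hWS' : ∫⁻ r in Ioo t0 t, ∫⁻ z, W (r, z) ^ 2 ≤ ENNReal.ofReal S := by
    rw [← setLIntegral_prod_univ (f := fun q => W q ^ 2) (by fun_prop)]
    exact (setLIntegral_le_lintegral _ _).trans hWS
  have hm : Measurable (fun r => ∫⁻ z, W (r, z) ^ 2) :=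
    Measurable.lintegral_prod_right' (f := fun q : ℝ × ℝ => W q ^ 2) (by fun_prop)
  unfold duh
  rw [setLIntegral_Ioi_prod (t := t) _ (fun q hq => by rw [hk_of_nonpos (sub_nonpos.2 hq)]; simp),
    setLIntegral_prod_univ (by fun_prop)]
  calc _ ≤ ∫⁻ r in Ioo t0 t, hk (t - s) (x - y) *
          (ENNReal.ofReal (θ / 2) * (∫⁻ z, W (r, z) ^ 2) +
          ENNReal.ofReal (1 / (2 * θ)) * ENNReal.ofReal (bridgeSup s t r)) :=
        setLIntegral_mono (by fun_prop) key
    _ = hk (t - s) (x - y) * (ENNReal.ofReal (θ / 2) * (∫⁻ r in Ioo t0 t, ∫⁻ z, W (r, z) ^ 2) +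
          ENNReal.ofReal (1 / (2 * θ)) * ∫⁻ r in Ioo t0 t, ENNReal.ofReal (bridgeSup s t r)) := by
        rw [lintegral_const_mul' _ _ (hk_ne_top _ _), lintegral_add_left (by fun_prop),
            lintegral_const_mul' _ _ ENNReal.ofReal_ne_top,
            lintegral_const_mul' _ _ ENNReal.ofReal_ne_top]
    _ ≤ hk (t - s) (x - y) * (ENNReal.ofReal (θ / 2) * ENNReal.ofReal S +
          ENNReal.ofReal (1 / (2 * θ)) * ENNReal.ofReal (2 * Real.sqrt (t - t0))) := by
        gcongr
        exact lintegral_bridgeSup_le h ht.le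
    _ = _ := by
        rw [← ENNReal.ofReal_mul (by positivity), ← ENNReal.ofReal_mul (by positivity),
          ← ENNReal.ofReal_add (by positivity) (by positivity), mul_comm]
        congr 2
        field_simp

lemma duh_mono {W : ℝ × ℝ → ℝ≥0∞} {t0 t x : ℝ} {F G : ℝ × ℝ → ℝ≥0∞}
    (h : ∀ r ∈ Ioo t0 t, ∀ z, F (r, z) ≤ G (r, z)) : duh W t0 F t x ≤ duh W t0 G t x := by
  unfold duh
  apply setLIntegral_mono' (measurableSet_Ioi.prod MeasurableSet.univ)
  rintro ⟨r, z⟩ ⟨hr, -⟩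
  rcases lt_or_ge r t with hrt | hrt
  · have := h r ⟨hr, hrt⟩ z
    gcongr
  · simp [hk_of_nonpos (sub_nonpos.2 hrt)]

lemma duh_const_mul (W : ℝ × ℝ → ℝ≥0∞) (t0 t x : ℝ) (F : ℝ × ℝ → ℝ≥0∞) {c : ℝ≥0∞} (hc : c ≠ ∞) :
    duh W t0 (fun q => c * F q) t x = c * duh W t0 F t x := by
  unfold duh
  rw [← lintegral_const_mul' _ _ hc]
  congr 1
  ext q
  ring

lemma duh_add {W F : ℝ × ℝ → ℝ≥0∞} (hW : Measurable W) (hF : Measurable F) (t0 t x : ℝ)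
    (G : ℝ × ℝ → ℝ≥0∞) :
    duh W t0 (fun q => F q + G q) t x = duh W t0 F t x + duh W t0 G t x := by
  unfold duh
  rw [← lintegral_add_left (by fun_prop)]
  congr 1
  ext q
  ring

/-- The factor by which the Duhamel operator over a time `h` contracts, for a potential of squared
norm at most `S`, with a free parameter `θ`. -/
def gain (S θ h : ℝ) : ℝ := 1 / 2 * (θ * S + 2 * Real.sqrt h / θ)

lemma gain_nonneg {S θ : ℝ} (hS : 0 ≤ S) (hθ : 0 < θ) (h : ℝ) : 0 ≤ gain S θ h := by
  unfold gain; positivity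

lemma gain_mono (S : ℝ) {θ : ℝ} (hθ : 0 < θ) {h h' : ℝ} (hh : h ≤ h') : gain S θ h ≤ gain S θ h' := by
  unfold gain
  gcongr

/-- A measurable potential on the plane with squared `L²` norm at most `S`. -/
structure SqBound (w : ℝ × ℝ → ℝ) (S : ℝ) : Prop where
  meas : Measurable w
  nonneg : 0 ≤ S
  le : ∫⁻ q, ‖w q‖ₑ ^ 2 ≤ ENNReal.ofReal S

lemma duh_hk_le_gain {W : ℝ × ℝ → ℝ≥0∞} (hW : Measurable W) {S : ℝ} (hS : 0 ≤ S)
    (hWS : ∫⁻ q, W q ^ 2 ≤ ENNReal.ofReal S) {θ : ℝ} (hθ : 0 < θ) (s t0 t : ℝ) (x y : ℝ) :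
    duh W t0 (fun q => hk (q.1 - s) (q.2 - y)) t x ≤
      ENNReal.ofReal (gain S θ (t - t0)) * hk (t - s) (x - y) := by
  have aux : ∀ r, s ≤ r → t0 ≤ r → duh W t0 (fun q => hk (q.1 - s) (q.2 - y)) t x ≤
      duh W r (fun q => hk (q.1 - s) (q.2 - y)) t x →
      duh W t0 (fun q => hk (q.1 - s) (q.2 - y)) t x ≤
      ENNReal.ofReal (gain S θ (t - t0)) * hk (t - s) (x - y) := by
    intro r hsr htr hle
    refine hle.trans ?_
    rcases lt_or_ge r t with hrt | hrt
    · refine (duh_hk_le hW hS hWS hθ hsr hrt x y).trans ?_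
      gcongr
      exact gain_mono S hθ (by linarith)
    · unfold duh
      rw [setLIntegral_Ioi_prod (t := t) _
        (fun q hq => by rw [hk_of_nonpos (sub_nonpos.2 hq)]; simp)]
      simp [Ioo_eq_empty (not_lt.2 hrt)]
  rcases le_total s t0 with h | h
  · exact aux t0 h le_rfl le_rfl
  -- The kernel started at time `s` vanishes up to time `s`, so the times between `t0` and `s`
  -- contribute nothing.
  · refine aux s le_rfl h ?_
    unfold duh
    rw [← lintegral_indicator (measurableSet_Ioi.prod MeasurableSet.univ),
      ← lintegral_indicator (measurableSet_Ioi.prod MeasurableSet.univ)]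
    apply lintegral_mono
    intro q
    simp only [indicator, mem_prod, mem_Ioi, mem_univ, and_true]
    by_cases hq : s < q.1
    · simp [hq, h.trans_lt hq]
    · simp [hk_of_nonpos (sub_nonpos.2 (not_lt.1 hq))]

/-- The superposition of heat kernels started from the points of a measure on space-time. -/
def heatSup (ν : Measure (ℝ × ℝ)) (t x : ℝ) : ℝ≥0∞ := ∫⁻ q, hk (t - q.1) (x - q.2) ∂ν

@[fun_prop]
lemma measurable_heatSup (ν : Measure (ℝ × ℝ)) [SFinite ν] :
    Measurable (fun q : ℝ × ℝ => heatSup ν q.1 q.2) := by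
  unfold heatSup
  apply Measurable.lintegral_prod_right'
    (f := fun a : (ℝ × ℝ) × (ℝ × ℝ) => hk (a.1.1 - a.2.1) (a.1.2 - a.2.2))
  fun_prop

lemma duh_heatSup {W : ℝ × ℝ → ℝ≥0∞} (hW : Measurable W) (ν : Measure (ℝ × ℝ)) [SFinite ν]
    (t0 t x : ℝ) :
    duh W t0 (fun q => heatSup ν q.1 q.2) t x =
      ∫⁻ a, duh W t0 (fun q => hk (q.1 - a.1) (q.2 - a.2)) t x ∂ν := by
  unfold duh heatSup
  rw [lintegral_lintegral_swap]
  · apply lintegral_congr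
    intro q
    rw [lintegral_const_mul _ (by fun_prop)]
  · fun_prop

/-- The contraction factor does not depend on the starting point of a kernel, so the bound can be
integrated over the sources. This makes superpositions of kernels the natural class of comparison
functions. -/
lemma duh_heatSup_le {W : ℝ × ℝ → ℝ≥0∞} (hW : Measurable W) {S : ℝ} (hS : 0 ≤ S)
    (hWS : ∫⁻ q, W q ^ 2 ≤ ENNReal.ofReal S) {θ : ℝ} (hθ : 0 < θ) (ν : Measure (ℝ × ℝ)) [SFinite ν]
    (t0 t x : ℝ) :
    duh W t0 (fun q => heatSup ν q.1 q.2) t x ≤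
      ENNReal.ofReal (gain S θ (t - t0)) * heatSup ν t x := by
  rw [duh_heatSup hW]
  unfold heatSup
  rw [← lintegral_const_mul' _ _ ENNReal.ofReal_ne_top]
  exact lintegral_mono fun a => duh_hk_le_gain hW hS hWS hθ _ _ _ _ _

/-! ### Mild solutions with sources: short-time comparison and restarting -/

/-- `D` is a mild solution, from time `t0` up to time `2`, with potential `w` and sources `ν`. -/
structure MildFrom (t0 : ℝ) (w : ℝ × ℝ → ℝ) (ν : Measure (ℝ × ℝ)) (D : ℝ × ℝ → ℝ) : Prop where
  meas : Measurable D
  bound : ∃ C : ℝ, 0 ≤ C ∧ ∀ t ∈ Ioc t0 2, ∀ x : ℝ, |D (t, x)| ≤ C * heatKernel t x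
  finite : ∀ t ∈ Ioc t0 2, ∀ x : ℝ, heatSup ν t x ≠ ∞
  duhamel : ∀ t ∈ Ioc t0 2, ∀ x : ℝ, D (t, x) = (heatSup ν t x).toReal +
    ∫ q in Ioi t0 ×ˢ univ, heatKernel (t - q.1) (x - q.2) * w q * D q

lemma enorm_heatKernel (t x : ℝ) : ‖heatKernel t x‖ₑ = hk t x := by
  rw [← ofReal_norm, Real.norm_of_nonneg (heatKernel_nonneg _ _)]; rfl

lemma lintegral_enorm_duhamel (w D : ℝ × ℝ → ℝ) (t0 t x : ℝ) :
    ∫⁻ q in Ioi t0 ×ˢ univ, ‖heatKernel (t - q.1) (x - q.2) * w q * D q‖ₑ =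
      duh (fun q => ‖w q‖ₑ) t0 (fun q => ‖D q‖ₑ) t x := by
  simp [duh, enorm_mul, enorm_heatKernel]

lemma enorm_le_of_abs_le {D C : ℝ} {t x : ℝ} (hC : 0 ≤ C) (h : |D| ≤ C * heatKernel t x) :
    ‖D‖ₑ ≤ ENNReal.ofReal C * hk t x := by
  rw [hk, ← ENNReal.ofReal_mul hC, ← ofReal_norm]
  exact ENNReal.ofReal_le_ofReal h

lemma duh_lt_top_of_bound {w D : ℝ × ℝ → ℝ} {S : ℝ} (hw : SqBound w S) {t0 : ℝ} {C : ℝ} (hC : 0 ≤ C)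
    {t : ℝ} (hD : ∀ r ∈ Ioo t0 t, ∀ z : ℝ, |D (r, z)| ≤ C * heatKernel r z) (x : ℝ) :
    duh (fun q => ‖w q‖ₑ) t0 (fun q => ‖D q‖ₑ) t x < ∞ := by
  calc duh (fun q => ‖w q‖ₑ) t0 (fun q => ‖D q‖ₑ) t x
      ≤ duh (fun q => ‖w q‖ₑ) t0 (fun q => ENNReal.ofReal C * hk (q.1 - 0) (q.2 - 0)) t x := by
        apply duh_mono
        intro r hr z
        simpa using enorm_le_of_abs_le hC (hD r hr z)
    _ ≤ ENNReal.ofReal C * (ENNReal.ofReal (gain S 1 (t - t0)) * hk (t - 0) (x - 0)) := by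
        rw [duh_const_mul _ _ _ _ _ ENNReal.ofReal_ne_top]
        gcongr
        exact duh_hk_le_gain hw.meas.enorm hw.nonneg hw.le one_pos _ _ _ _ _
    _ < ∞ := ENNReal.mul_lt_top ENNReal.ofReal_lt_top
        (ENNReal.mul_lt_top ENNReal.ofReal_lt_top (hk_lt_top _ _))

lemma integrableOn_duhamel {w D : ℝ × ℝ → ℝ} {S : ℝ} (hw : SqBound w S) (hDm : Measurable D) {t0 : ℝ}
    {C : ℝ} (hC : 0 ≤ C) {t : ℝ}
    (hD : ∀ r ∈ Ioo t0 t, ∀ z : ℝ, |D (r, z)| ≤ C * heatKernel r z) (x : ℝ) :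
    IntegrableOn (fun q : ℝ × ℝ => heatKernel (t - q.1) (x - q.2) * w q * D q) (Ioi t0 ×ˢ univ) := by
  have := hw.meas
  refine ⟨by fun_prop, ?_⟩
  rw [HasFiniteIntegral, lintegral_enorm_duhamel]
  exact duh_lt_top_of_bound hw hC hD x

/-- Over a short time, a mild solution is close to the superposition of its sources. -/
lemma MildFrom.enorm_sub_le {t0 : ℝ} {w : ℝ × ℝ → ℝ} {ν : Measure (ℝ × ℝ)} [SFinite ν]
    {D : ℝ × ℝ → ℝ} (hD : MildFrom t0 w ν D) {S : ℝ} (hw : SqBound w S) {θ : ℝ} (hθ : 0 < θ) {t1 : ℝ}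
    (ht1 : t1 ≤ 2) (hε : gain S θ (t1 - t0) ≤ 1 / 2) {t : ℝ} (ht : t ∈ Ioc t0 t1) (x : ℝ) :
    |D (t, x) - (heatSup ν t x).toReal| ≤ 2 * gain S θ (t1 - t0) * (heatSup ν t x).toReal := by
  obtain ⟨C, hC, hb⟩ := hD.bound
  have hDm := hD.meas
  have hwm := hw.meas
  set ε := gain S θ (t1 - t0) with hεdef
  have hε0 : 0 ≤ ε := gain_nonneg hw.nonneg hθ _
  set W : ℝ × ℝ → ℝ≥0∞ := fun q => ‖w q‖ₑ with hW
  have hWm : Measurable W := hw.meas.enorm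
  have hdiff : ∀ t ∈ Ioc t0 t1, ∀ x, ‖D (t, x) - (heatSup ν t x).toReal‖ₑ ≤
      duh W t0 (fun q => ‖D q‖ₑ) t x := by
    intro t ht x
    rw [hD.duhamel t ⟨ht.1, ht.2.trans ht1⟩ x, add_sub_cancel_left, ← lintegral_enorm_duhamel]
    exact enorm_integral_le_lintegral_enorm _
  have hle : ∀ t ∈ Ioc t0 t1, ∀ x, ‖D (t, x)‖ₑ ≤ heatSup ν t x + duh W t0 (fun q => ‖D q‖ₑ) t x := by
    intro t ht x
    have hf := hD.finite t ⟨ht.1, ht.2.trans ht1⟩ x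
    calc ‖D (t, x)‖ₑ = ‖(heatSup ν t x).toReal + (D (t, x) - (heatSup ν t x).toReal)‖ₑ := by
          congr 1; ring
      _ ≤ ‖(heatSup ν t x).toReal‖ₑ + ‖D (t, x) - (heatSup ν t x).toReal‖ₑ := enorm_add_le _ _
      _ ≤ _ := by
          gcongr
          · rw [← ofReal_norm, Real.norm_of_nonneg ENNReal.toReal_nonneg,
              ENNReal.ofReal_toReal hf]
          · exact hdiff t ht x
  have hgain : ∀ t ∈ Ioc t0 t1, gain S θ (t - t0) ≤ ε := by
    intro t ht
    apply gain_mono _ hθ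
    linarith [ht.2]
  have hA : ∀ t ∈ Ioc t0 t1, ∀ x, duh W t0 (fun q => 2 * heatSup ν q.1 q.2) t x ≤
      2 * ENNReal.ofReal ε * heatSup ν t x := by
    intro t ht x
    rw [duh_const_mul _ _ _ _ _ (by norm_num), mul_assoc]
    gcongr
    refine (duh_heatSup_le hWm hw.nonneg hw.le hθ ν t0 t x).trans ?_
    gcongr
    exact hgain t ht
  -- The Duhamel inequality preserves the bound by twice the sources, since `1 + 2ε ≤ 2`, while the
  -- a priori bound by a multiple of the heat kernel shrinks by `ε` at each iteration and disappears
  -- in the limit.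
  have hiter : ∀ n : ℕ, ∀ t ∈ Ioc t0 t1, ∀ x, ‖D (t, x)‖ₑ ≤ 2 * heatSup ν t x +
      (ENNReal.ofReal ε) ^ n * ENNReal.ofReal C * hk (t - 0) (x - 0) := by
    intro n
    induction n with
    | zero =>
      intro t ht x
      have := enorm_le_of_abs_le hC (hb t ⟨ht.1, ht.2.trans ht1⟩ x)
      simp only [pow_zero, one_mul, sub_zero]
      exact this.trans le_add_self
    | succ n ih =>
      intro t ht x
      calc ‖D (t, x)‖ₑ ≤ heatSup ν t x + duh W t0 (fun q => ‖D q‖ₑ) t x := hle t ht x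
        _ ≤ heatSup ν t x + duh W t0 (fun q => 2 * heatSup ν q.1 q.2 +
            (ENNReal.ofReal ε) ^ n * ENNReal.ofReal C * hk (q.1 - 0) (q.2 - 0)) t x := by
            gcongr
            apply duh_mono
            intro r hr z
            exact ih r ⟨hr.1, hr.2.le.trans ht.2⟩ z
        _ ≤ heatSup ν t x + (2 * ENNReal.ofReal ε * heatSup ν t x +
            (ENNReal.ofReal ε) ^ n * ENNReal.ofReal C *
              (ENNReal.ofReal ε * hk (t - 0) (x - 0))) := by
            rw [duh_add hWm (by fun_prop), duh_const_mul (c := ENNReal.ofReal ε ^ n * _) _ _ _ _ _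
              (ENNReal.mul_ne_top (ENNReal.pow_ne_top ENNReal.ofReal_ne_top) ENNReal.ofReal_ne_top)]
            gcongr
            · exact hA t ht x
            · refine (duh_hk_le_gain hWm hw.nonneg hw.le hθ _ _ _ _ _).trans ?_
              gcongr
              exact hgain t ht
        _ ≤ heatSup ν t x + (1 * heatSup ν t x +
            (ENNReal.ofReal ε) ^ n * ENNReal.ofReal C *
              (ENNReal.ofReal ε * hk (t - 0) (x - 0))) := by
            gcongr
            rw [show (2 : ℝ≥0∞) = ENNReal.ofReal 2 by simp, ← ENNReal.ofReal_mul (by norm_num)]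
            rw [← ENNReal.ofReal_one]
            apply ENNReal.ofReal_le_ofReal
            linarith
        _ = _ := by ring
  have hlim : ∀ t ∈ Ioc t0 t1, ∀ x, ‖D (t, x)‖ₑ ≤ 2 * heatSup ν t x := by
    intro t ht x
    have h1 : Filter.Tendsto (fun n : ℕ => 2 * heatSup ν t x +
      (ENNReal.ofReal ε) ^ n * ENNReal.ofReal C * hk (t - 0) (x - 0)) Filter.atTop
        (nhds (2 * heatSup ν t x + 0 * ENNReal.ofReal C * hk (t - 0) (x - 0))) := by
      apply Filter.Tendsto.const_add
      apply ENNReal.Tendsto.mul_const _ (Or.inr (hk_ne_top _ _))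
      apply ENNReal.Tendsto.mul_const _ (Or.inr ENNReal.ofReal_ne_top)
      apply ENNReal.tendsto_pow_atTop_nhds_zero_of_lt_one
      rw [← ENNReal.ofReal_one]
      exact (ENNReal.ofReal_lt_ofReal_iff one_pos).2 (by linarith)
    rw [zero_mul, zero_mul, add_zero] at h1
    exact ge_of_tendsto' h1 fun n => hiter n t ht x
  have hfin : ‖D (t, x) - (heatSup ν t x).toReal‖ₑ ≤ 2 * ENNReal.ofReal ε * heatSup ν t x := by
    refine (hdiff t ht x).trans (le_trans ?_ (hA t ht x))
    apply duh_mono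
    intro r hr z
    exact hlim r ⟨hr.1, hr.2.le.trans ht.2⟩ z
  have hf := hD.finite t ⟨ht.1, ht.2.trans ht1⟩ x
  rw [← ENNReal.ofReal_toReal hf, ENNReal.toReal_ofReal ENNReal.toReal_nonneg,
    show (2 : ℝ≥0∞) = ENNReal.ofReal 2 by simp,
    ← ENNReal.ofReal_mul (by norm_num), ← ENNReal.ofReal_mul (by positivity),
    ← ofReal_norm] at hfin
  exact (ENNReal.ofReal_le_ofReal_iff (by positivity)).1 hfin

/-- Take `θ` so that `θ S ≤ ε`, then `h` so that the second term of `gain` is exactly `ε`; their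
mean is at most `ε`. -/
lemma exists_gain_le {S ε : ℝ} (hS : 0 ≤ S) (hε : 0 < ε) :
    ∃ θ h : ℝ, 0 < θ ∧ 0 < h ∧ gain S θ h ≤ ε := by
  refine ⟨ε / (S + 1), (ε ^ 2 / (2 * (S + 1))) ^ 2, by positivity, by positivity, ?_⟩
  unfold gain
  rw [Real.sqrt_sq (by positivity)]
  have : ε / (S + 1) * S ≤ ε := by
    rw [div_mul_eq_mul_div, div_le_iff₀ (by positivity)]
    nlinarith
  have h2 : 2 * (ε ^ 2 / (2 * (S + 1))) / (ε / (S + 1)) = ε := by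
    field_simp
  rw [h2]
  linarith

/-- The sources that restart a mild solution `D` at time `t1`. -/
def restartSource (t1 : ℝ) (ν : Measure (ℝ × ℝ)) (D : ℝ × ℝ → ℝ) : Measure (ℝ × ℝ) :=
  (volume.withDensity (fun z => ENNReal.ofReal (D (t1, z)))).map (fun z => (t1, z)) +
    ν.restrict (Ici t1 ×ˢ univ)

instance (t1 : ℝ) (ν : Measure (ℝ × ℝ)) [SFinite ν] (D : ℝ × ℝ → ℝ) :
    SFinite (restartSource t1 ν D) := by
  unfold restartSource; infer_instance

lemma heatSup_restartSource (t1 : ℝ) (ν : Measure (ℝ × ℝ)) {D : ℝ × ℝ → ℝ} (hD : Measurable D)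
    (t x : ℝ) :
    heatSup (restartSource t1 ν D) t x =
      (∫⁻ z, hk (t - t1) (x - z) * ENNReal.ofReal (D (t1, z))) +
        heatSup (ν.restrict (Ici t1 ×ˢ univ)) t x := by
  unfold restartSource heatSup
  rw [lintegral_add_measure, lintegral_map (by fun_prop) (by fun_prop),
    lintegral_withDensity_eq_lintegral_mul _ (by fun_prop) (by fun_prop)]
  simp [mul_comm]

/-- Sources before `t1` are propagated through the slice at `t1` by Chapman–Kolmogorov. Sources at
`t1` itself are invisible in that slice, because the kernel is zero at time zero, and are counted in
the second term. -/
lemma heatSup_split (ν : Measure (ℝ × ℝ)) [SFinite ν] {t1 t : ℝ} (ht : t1 < t) (x : ℝ) :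
    heatSup ν t x = (∫⁻ z, hk (t - t1) (x - z) * heatSup ν t1 z) +
      heatSup (ν.restrict (Ici t1 ×ˢ univ)) t x := by
  have h1 : heatSup ν t x = heatSup (ν.restrict (Iio t1 ×ˢ univ)) t x +
      heatSup (ν.restrict (Ici t1 ×ˢ univ)) t x := by
    unfold heatSup
    rw [← lintegral_add_compl _ (measurableSet_Iio.prod MeasurableSet.univ : MeasurableSet
      (Iio t1 ×ˢ (univ : Set ℝ)))]
    congr 3
    ext q
    simp
  rw [h1]
  congr 1
  unfold heatSup
  have h2 : ∀ z, hk (t - t1) (x - z) * ∫⁻ q, hk (t1 - q.1) (z - q.2) ∂ν =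
      ∫⁻ q, hk (t - t1) (x - z) * hk (t1 - q.1) (z - q.2) ∂ν := by
    intro z
    rw [lintegral_const_mul _ (by fun_prop)]
  simp_rw [h2]
  rw [lintegral_lintegral_swap (by fun_prop),
    ← lintegral_indicator (measurableSet_Iio.prod MeasurableSet.univ)]
  apply lintegral_congr
  intro q
  simp only [indicator, mem_prod, mem_Iio, mem_univ, and_true]
  split_ifs with hq
  · rw [lintegral_hk_mul_hk (by linarith) (by linarith)]
    congr 1
    ring
  · simp [hk_of_nonpos (sub_nonpos.2 (not_lt.1 hq))]

/-- Chapman–Kolmogorov for the Duhamel term. -/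
lemma integral_heatKernel_mul_duhamel {w D : ℝ × ℝ → ℝ} {S : ℝ} (hw : SqBound w S)
    (hDm : Measurable D) {t0 t1 t : ℝ} (ht1 : t1 < t) {C : ℝ} (hC : 0 ≤ C)
    (hD : ∀ r ∈ Ioc t0 t1, ∀ z : ℝ, |D (r, z)| ≤ C * heatKernel r z) (x : ℝ) :
    Integrable (fun z => heatKernel (t - t1) (x - z) *
      ∫ q in Ioi t0 ×ˢ univ, heatKernel (t1 - q.1) (z - q.2) * w q * D q) ∧
    ∫ z, heatKernel (t - t1) (x - z) *
      ∫ q in Ioi t0 ×ˢ univ, heatKernel (t1 - q.1) (z - q.2) * w q * D q =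
    ∫ q in Ioo t0 t1 ×ˢ univ, heatKernel (t - q.1) (x - q.2) * w q * D q := by
  have hwm := hw.meas
  set μ := (volume : Measure (ℝ × ℝ)).restrict (Ioi t0 ×ˢ univ) with hμ
  let F : ℝ × (ℝ × ℝ) → ℝ := fun a => heatKernel (t - t1) (x - a.1) *
    (heatKernel (t1 - a.2.1) (a.1 - a.2.2) * w a.2 * D a.2)
  have hFm : Measurable F := by fun_prop
  have hck : ∀ q : ℝ × ℝ, ∫⁻ z, hk (t - t1) (x - z) * hk (t1 - q.1) (z - q.2) =
      if q.1 < t1 then hk (t - q.1) (x - q.2) else 0 := by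
    intro q
    split_ifs with hq
    · rw [lintegral_hk_mul_hk (by linarith) (by linarith)]
      congr 1
      ring
    · simp [hk_of_nonpos (sub_nonpos.2 (not_lt.1 hq))]
  have hFi : Integrable F (volume.prod μ) := by
    refine ⟨hFm.aestronglyMeasurable, ?_⟩
    rw [HasFiniteIntegral, lintegral_prod_symm _ (by fun_prop)]
    have h1 : ∀ q : ℝ × ℝ, ∫⁻ z, ‖F (z, q)‖ₑ =
        (if q.1 < t1 then hk (t - q.1) (x - q.2) else 0) * (‖w q‖ₑ * ‖D q‖ₑ) := by
      intro q
      rw [← hck q, ← lintegral_mul_const _ (by fun_prop)]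
      apply lintegral_congr
      intro z
      simp only [F, enorm_mul, enorm_heatKernel]
      ring
    simp_rw [h1]
    -- `D` is truncated at `t1`, as it is controlled only up to that time.
    refine lt_of_le_of_lt ?_ (duh_lt_top_of_bound (t0 := t0) (t := t) hw hC
      (D := fun q => if q.1 < t1 then D q else 0) ?_ x)
    · unfold duh
      apply lintegral_mono
      intro q
      dsimp only
      split_ifs
      · rw [mul_assoc]
      · simp
    · intro r hr z
      simp only
      split_ifs with h
      · exact hD r ⟨hr.1, h.le⟩ z
      · simpa using mul_nonneg hC (heatKernel_nonneg _ _)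
  have e : ∀ z, heatKernel (t - t1) (x - z) *
      ∫ q, heatKernel (t1 - q.1) (z - q.2) * w q * D q ∂μ = ∫ q, F (z, q) ∂μ := by
    intro z
    rw [← integral_const_mul]
  simp_rw [e]
  refine ⟨hFi.integral_prod_left, ?_⟩
  rw [integral_integral_swap hFi]
  have h2 : ∀ q : ℝ × ℝ, ∫ z, F (z, q) =
      (Iio t1 ×ˢ univ).indicator (fun q => heatKernel (t - q.1) (x - q.2) * w q * D q) q := by
    intro q
    have h3 : ∫ z, F (z, q) = (∫ z, heatKernel (t - t1) (x - z) * heatKernel (t1 - q.1) (z - q.2)) *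
        (w q * D q) := by
      rw [← integral_mul_const]
      congr 1
      ext z
      simp only [F]
      ring
    rw [h3, integral_eq_lintegral_of_nonneg_ae]
    · have h4 : ∀ z, ENNReal.ofReal (heatKernel (t - t1) (x - z) * heatKernel (t1 - q.1) (z - q.2)) =
          hk (t - t1) (x - z) * hk (t1 - q.1) (z - q.2) := fun z =>
        ENNReal.ofReal_mul (heatKernel_nonneg _ _)
      simp_rw [h4, hck q]
      simp only [indicator, mem_prod, mem_Iio, mem_univ, and_true]
      split_ifs
      · rw [toReal_hk]; ring
      · simp
    · exact Filter.Eventually.of_forall fun z =>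
        mul_nonneg (heatKernel_nonneg _ _) (heatKernel_nonneg _ _)
    · fun_prop
  simp_rw [h2]
  rw [hμ, integral_indicator (measurableSet_Iio.prod MeasurableSet.univ),
    Measure.restrict_restrict (measurableSet_Iio.prod MeasurableSet.univ)]
  congr 2
  ext q
  simp [and_comm]

/-- The Duhamel formula at `t1` is propagated freely to `t`. By Chapman–Kolmogorov this reproduces
the contribution of all times before `t1`, so those times may be replaced by the slice at `t1`. The
slice must be nonnegative to be the density of a source measure. -/
lemma MildFrom.restart {t0 : ℝ} {w : ℝ × ℝ → ℝ} {ν : Measure (ℝ × ℝ)} [SFinite ν]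
    {D : ℝ × ℝ → ℝ} (hD : MildFrom t0 w ν D) {S : ℝ} (hw : SqBound w S) {t1 : ℝ} (h0 : 0 ≤ t0)
    (ht1 : t1 ∈ Ioc t0 2) (hpos : ∀ z, 0 ≤ D (t1, z)) :
    MildFrom t1 w (restartSource t1 ν D) D := by
  obtain ⟨C, hC, hb⟩ := hD.bound
  have hDm := hD.meas
  have hwm := hw.meas
  have hb1 : ∀ t ∈ Ioc t1 2, ∀ x : ℝ, |D (t, x)| ≤ C * heatKernel t x := fun t ht x =>
    hb t ⟨ht1.1.trans ht.1, ht.2⟩ x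
  have ht1' : 0 < t1 := h0.trans_lt ht1.1
  have hPfin : ∀ t, t1 < t → ∀ x, (∫⁻ z, hk (t - t1) (x - z) * ENNReal.ofReal (D (t1, z))) ≠ ∞ := by
    intro t ht x
    refine (lt_of_le_of_lt (b := ENNReal.ofReal C * hk t x) ?_
      (ENNReal.mul_lt_top ENNReal.ofReal_lt_top (hk_lt_top _ _))).ne
    calc _ ≤ ∫⁻ z, ENNReal.ofReal C * (hk (t - t1) (x - z) * hk t1 (z - 0)) := by
          apply lintegral_mono
          intro z
          simp only
          rw [mul_left_comm]
          gcongr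
          rw [sub_zero, hk, ← ENNReal.ofReal_mul hC]
          exact ENNReal.ofReal_le_ofReal ((le_abs_self _).trans (hb t1 ht1 z))
      _ = _ := by
          rw [lintegral_const_mul' _ _ ENNReal.ofReal_ne_top,
            lintegral_hk_mul_hk (by linarith) ht1']
          simp
  have hsplit : ∀ t ∈ Ioc t1 2, ∀ x, (∫⁻ z, hk (t - t1) (x - z) * heatSup ν t1 z) ≠ ∞ ∧
      heatSup (ν.restrict (Ici t1 ×ˢ univ)) t x ≠ ∞ := by
    intro t ht x
    have := hD.finite t ⟨ht1.1.trans ht.1, ht.2⟩ x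
    rw [heatSup_split ν ht.1] at this
    exact ENNReal.add_ne_top.1 this
  refine ⟨hDm, ⟨C, hC, hb1⟩, ?_, ?_⟩
  · intro t ht x
    rw [heatSup_restartSource _ _ hDm]
    exact ENNReal.add_ne_top.2 ⟨hPfin t ht.1 x, (hsplit t ht x).2⟩
  · intro t ht x
    obtain ⟨hI1, hI2⟩ := integral_heatKernel_mul_duhamel hw hDm (t0 := t0) ht.1 hC
      (fun r hr z => hb r ⟨hr.1, hr.2.trans ht1.2⟩ z) x
    have hA : Integrable (fun z => heatKernel (t - t1) (x - z) * (heatSup ν t1 z).toReal) := by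
      have : ∀ z, heatKernel (t - t1) (x - z) * (heatSup ν t1 z).toReal =
          (hk (t - t1) (x - z) * heatSup ν t1 z).toReal := by
        intro z
        rw [ENNReal.toReal_mul, toReal_hk]
      simp_rw [this]
      exact integrable_toReal_of_lintegral_ne_top (by fun_prop) (hsplit t ht x).1
    have hAi : ∫ z, heatKernel (t - t1) (x - z) * (heatSup ν t1 z).toReal =
        (∫⁻ z, hk (t - t1) (x - z) * heatSup ν t1 z).toReal := by
      rw [integral_eq_lintegral_of_nonneg_ae]
      · congr 1
        apply lintegral_congr
        intro z
        rw [ENNReal.ofReal_mul (heatKernel_nonneg _ _), ENNReal.ofReal_toReal (hD.finite t1 ht1 z),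
          hk]
      · exact Filter.Eventually.of_forall fun z =>
          mul_nonneg (heatKernel_nonneg _ _) ENNReal.toReal_nonneg
      · fun_prop
    have hP : (∫⁻ z, hk (t - t1) (x - z) * ENNReal.ofReal (D (t1, z))).toReal =
        (∫⁻ z, hk (t - t1) (x - z) * heatSup ν t1 z).toReal +
        ∫ q in Ioo t0 t1 ×ˢ univ, heatKernel (t - q.1) (x - q.2) * w q * D q := by
      rw [← hAi, ← hI2, ← integral_add hA hI1]
      have : ∀ z, heatKernel (t - t1) (x - z) * (heatSup ν t1 z).toReal +
          heatKernel (t - t1) (x - z) *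
          ∫ q in Ioi t0 ×ˢ univ, heatKernel (t1 - q.1) (z - q.2) * w q * D q =
          heatKernel (t - t1) (x - z) * D (t1, z) := by
        intro z
        rw [hD.duhamel t1 ht1 z, mul_add]
      simp_rw [this]
      rw [integral_eq_lintegral_of_nonneg_ae]
      · congr 1
        apply lintegral_congr
        intro z
        rw [ENNReal.ofReal_mul (heatKernel_nonneg _ _), hk]
      · exact Filter.Eventually.of_forall fun z => mul_nonneg (heatKernel_nonneg _ _) (hpos z)
      · fun_prop
    have hint : ∀ s ⊆ Ioi t0 ×ˢ univ, IntegrableOn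
        (fun q : ℝ × ℝ => heatKernel (t - q.1) (x - q.2) * w q * D q) s := by
      intro s hs
      exact (integrableOn_duhamel hw hDm hC
        (fun r hr z => hb r ⟨hr.1, hr.2.le.trans ht.2⟩ z) x).mono_set hs
    have hU : (Ioi t0 ×ˢ (univ : Set ℝ)) = (Ioc t0 t1 ×ˢ univ) ∪ (Ioi t1 ×ˢ univ) := by
      rw [← union_prod, Ioc_union_Ioi_eq_Ioi ht1.1.le]
    have hae : (Ioo t0 t1 ×ˢ (univ : Set ℝ)) =ᵐ[volume] (Ioc t0 t1 ×ˢ univ) := by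
      rw [Measure.volume_eq_prod]
      exact Measure.set_prod_ae_eq Ioo_ae_eq_Ioc (Filter.EventuallyEq.refl _ _)
    rw [hD.duhamel t ⟨ht1.1.trans ht.1, ht.2⟩ x, heatSup_split ν ht.1,
      heatSup_restartSource _ _ hDm, ENNReal.toReal_add (hsplit t ht x).1 (hsplit t ht x).2,
      ENNReal.toReal_add (hPfin t ht.1 x) (hsplit t ht x).2, hP, setIntegral_congr_set hae, hU,
      setIntegral_union]
    · ring
    · rw [Set.disjoint_left]
      rintro q ⟨h1, -⟩ ⟨h2, -⟩
      exact absurd h1.2 (not_le.2 h2)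
    · exact measurableSet_Ioi.prod MeasurableSet.univ
    · exact hint _ (prod_mono Ioc_subset_Ioi_self subset_rfl)
    · exact hint _ (prod_mono (Ioi_subset_Ioi ht1.1.le) subset_rfl)

/-! ### Positivity and comparison of solutions -/

/-- Induction over time in steps of a fixed length. -/
lemma time_induction {P : ℝ → Prop} {h : ℝ} (hh : 0 < h)
    (hstart : ∀ t ∈ Ioc (0 : ℝ) 2, t ≤ h → P t)
    (hstep : ∀ t1 ∈ Ioc (0 : ℝ) 2, P t1 → ∀ t ∈ Ioc t1 2, t ≤ t1 + h → P t) :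
    ∀ t ∈ Ioc (0 : ℝ) 2, P t := by
  have key : ∀ n : ℕ, ∀ t ∈ Ioc (0 : ℝ) 2, t ≤ (n + 1) * h → P t := by
    intro n
    induction n with
    | zero => intro t ht hth; exact hstart t ht (by simpa using hth)
    | succ n ih =>
      intro t ht hth
      rcases le_or_gt t h with h1 | h1
      · exact hstart t ht h1
      · push_cast at hth
        exact hstep (t - h) ⟨by linarith, by linarith [ht.2]⟩
          (ih _ ⟨by linarith, by linarith [ht.2]⟩ (by linarith)) t ⟨by linarith, ht.2⟩ (by linarith)
  intro t ht
  obtain ⟨n, hn⟩ := exists_nat_ge (2 / h)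
  rw [div_le_iff₀ hh] at hn
  exact key n t ht (by nlinarith [ht.2])

/-- Over a short time the solution differs from its nonnegative free part by at most half of it. A
nonnegative slice permits a restart, so the argument propagates over steps of a fixed length. -/
lemma MildFrom.nonneg {w : ℝ × ℝ → ℝ} {ν : Measure (ℝ × ℝ)} [SFinite ν]
    {D : ℝ × ℝ → ℝ} (hD : MildFrom 0 w ν D) {S : ℝ} (hw : SqBound w S) {t : ℝ}
    (ht : t ∈ Ioc (0 : ℝ) 2) (x : ℝ) : 0 ≤ D (t, x) := by
  obtain ⟨θ, h, hθ, hh, hg⟩ := exists_gain_le (ε := 1 / 4) hw.nonneg (by norm_num)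
  have key : ∀ t0 : ℝ, 0 ≤ t0 → ∀ ν : Measure (ℝ × ℝ), SFinite ν → MildFrom t0 w ν D →
      ∀ t ∈ Ioc t0 2, t ≤ t0 + h → ∀ x, 0 ≤ D (t, x) := by
    intro t0 h0 ν _ hD t ht hth x
    have hg' : gain S θ (t - t0) ≤ 1 / 4 := (gain_mono S hθ (by linarith)).trans hg
    have := hD.enorm_sub_le hw hθ ht.2 (by linarith) ⟨ht.1, le_rfl⟩ x
    have h2 : 2 * gain S θ (t - t0) * (heatSup ν t x).toReal ≤ 1 * (heatSup ν t x).toReal := by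
      gcongr
      linarith
    linarith [(abs_le.1 this).1]
  refine time_induction (P := fun t => ∀ x, 0 ≤ D (t, x)) hh ?_ ?_ t ht x
  · intro t ht hth
    exact key 0 le_rfl ν inferInstance hD t ht (by simpa using hth)
  · intro t1 ht1 hp t ht hth
    exact key t1 ht1.1.le _ inferInstance (hD.restart hw le_rfl ht1 hp) t ht hth

lemma heatSup_dirac (t x : ℝ) : heatSup (Measure.dirac (0, 0)) t x = hk t x := by
  unfold heatSup
  rw [lintegral_dirac' _ (by fun_prop)]
  simp

lemma toReal_lintegral_hk_mul {f : ℝ × ℝ → ℝ} (hf : Measurable f) {t0 t : ℝ}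
    (hpos : ∀ r ∈ Ioo t0 t, ∀ z, 0 ≤ f (r, z)) (x : ℝ) :
    (∫⁻ q in Ioi t0 ×ˢ univ, hk (t - q.1) (x - q.2) * ENNReal.ofReal (f q)).toReal =
      ∫ q in Ioi t0 ×ˢ univ, heatKernel (t - q.1) (x - q.2) * f q := by
  have hm : MeasurableSet (Ioi t0 ×ˢ (univ : Set ℝ)) := measurableSet_Ioi.prod MeasurableSet.univ
  rw [integral_eq_lintegral_of_nonneg_ae]
  · congr 1
    apply lintegral_congr
    intro q
    rw [ENNReal.ofReal_mul (heatKernel_nonneg _ _), hk]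
  · filter_upwards [ae_restrict_mem hm] with q hq
    rcases lt_or_ge q.1 t with h | h
    · exact mul_nonneg (heatKernel_nonneg _ _) (hpos q.1 ⟨hq.1, h⟩ q.2)
    · simp [heatKernel_of_nonpos (sub_nonpos.2 h)]
  · fun_prop

/-- A larger potential has a larger solution. -/
lemma MildFrom.mono {w w' : ℝ × ℝ → ℝ} {D D' : ℝ × ℝ → ℝ}
    (hD : MildFrom 0 w (Measure.dirac (0, 0)) D) (hD' : MildFrom 0 w' (Measure.dirac (0, 0)) D')
    {S S' : ℝ} (hw : SqBound w S) (hw' : SqBound w' S') (hle : ∀ q, w' q ≤ w q) {t : ℝ}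
    (ht : t ∈ Ioc (0 : ℝ) 2) (x : ℝ) : D' (t, x) ≤ D (t, x) := by
  have hDm := hD.meas
  have hDm' := hD'.meas
  have hwm := hw.meas
  have hwm' := hw'.meas
  obtain ⟨C, hC, hb⟩ := hD.bound
  obtain ⟨C', hC', hb'⟩ := hD'.bound
  -- The difference `D - D'` is a mild solution with potential `w` and the nonnegative source `(w -
  -- w') D'`, so positivity applies to it.
  set f : ℝ × ℝ → ℝ := fun q => (w q - w' q) * D' q with hf
  have hfm : Measurable f := by fun_prop
  set ν : Measure (ℝ × ℝ) :=
    ((volume : Measure (ℝ × ℝ)).restrict (Ioi 0 ×ˢ univ)).withDensity (fun q => ENNReal.ofReal (f q))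
    with hν
  have hsup : ∀ t x, heatSup ν t x =
      ∫⁻ q in Ioi 0 ×ˢ univ, hk (t - q.1) (x - q.2) * ENNReal.ofReal (f q) := by
    intro t x
    unfold heatSup
    rw [hν, lintegral_withDensity_eq_lintegral_mul _ (by fun_prop) (by fun_prop)]
    simp [mul_comm]
  have hI1 : ∀ t ∈ Ioc (0 : ℝ) 2, ∀ x, IntegrableOn
      (fun q : ℝ × ℝ => heatKernel (t - q.1) (x - q.2) * w q * D q) (Ioi 0 ×ˢ univ) := fun t ht x =>
    integrableOn_duhamel hw hDm hC (fun r hr z => hb r ⟨hr.1, hr.2.le.trans ht.2⟩ z) x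
  have hI2 : ∀ t ∈ Ioc (0 : ℝ) 2, ∀ x, IntegrableOn
      (fun q : ℝ × ℝ => heatKernel (t - q.1) (x - q.2) * w' q * D' q) (Ioi 0 ×ˢ univ) :=
    fun t ht x => integrableOn_duhamel hw' hDm' hC'
      (fun r hr z => hb' r ⟨hr.1, hr.2.le.trans ht.2⟩ z) x
  have hI3 : ∀ t ∈ Ioc (0 : ℝ) 2, ∀ x, IntegrableOn
      (fun q : ℝ × ℝ => heatKernel (t - q.1) (x - q.2) * w q * D' q) (Ioi 0 ×ˢ univ) :=
    fun t ht x => integrableOn_duhamel hw hDm' hC'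
      (fun r hr z => hb' r ⟨hr.1, hr.2.le.trans ht.2⟩ z) x
  have hfe : ∀ t x, (fun q : ℝ × ℝ => heatKernel (t - q.1) (x - q.2) * f q) = fun q =>
      heatKernel (t - q.1) (x - q.2) * w q * D' q - heatKernel (t - q.1) (x - q.2) * w' q * D' q := by
    intro t x
    ext q
    simp only [hf]
    ring
  have hIf : ∀ t ∈ Ioc (0 : ℝ) 2, ∀ x, IntegrableOn
      (fun q : ℝ × ℝ => heatKernel (t - q.1) (x - q.2) * f q) (Ioi 0 ×ˢ univ) := by
    intro t ht x
    rw [hfe]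
    exact (hI3 t ht x).sub (hI2 t ht x)
  have hmild : MildFrom 0 w ν (fun q => D q - D' q) := by
    refine ⟨by fun_prop, ⟨C + C', by positivity, ?_⟩, ?_, ?_⟩
    · intro t ht x
      rw [add_mul]
      exact (abs_sub _ _).trans (add_le_add (hb t ht x) (hb' t ht x))
    · intro t ht x
      rw [hsup]
      refine (lt_of_le_of_lt ?_ (hIf t ht x).2).ne
      apply lintegral_mono
      intro q
      simp only [enorm_mul, enorm_heatKernel]
      gcongr
      exact Real.ofReal_le_enorm _
    · intro t ht x
      have h0 : ∀ r ∈ Ioo 0 t, ∀ z, 0 ≤ f (r, z) := by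
        intro r hr z
        exact mul_nonneg (sub_nonneg.2 (hle _)) (hD'.nonneg hw' ⟨hr.1, hr.2.le.trans ht.2⟩ z)
      rw [hsup, toReal_lintegral_hk_mul hfm h0, hD.duhamel t ht x, hD'.duhamel t ht x]
      have hI4 : IntegrableOn (fun q : ℝ × ℝ => heatKernel (t - q.1) (x - q.2) * w q * (D q - D' q))
          (Ioi 0 ×ˢ univ) := by
        simp_rw [mul_sub]
        exact (hI1 t ht x).sub (hI3 t ht x)
      rw [← integral_add (hIf t ht x) hI4, add_sub_add_left_eq_sub,
        ← integral_sub (hI1 t ht x) (hI2 t ht x)]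
      congr 1
      ext q
      simp only [hf]
      ring
  have := hmild.nonneg hw ht x
  linarith

/-! ### Existence by the perturbation series -/

/-- An exponential weight in time makes the Duhamel operator a contraction on the whole of `(0, 2]`.
Times within `h` of `t` contribute a factor `1/4` because the gain is small; earlier times
contribute at most `1/4` because their weight is smaller by `exp (-β h)`. -/
lemma exists_weight {w : ℝ × ℝ → ℝ} {S : ℝ} (hw : SqBound w S) : ∃ β : ℝ, 0 ≤ β ∧
    ∀ t ∈ Ioc (0 : ℝ) 2, ∀ x, duh (fun q => ‖w q‖ₑ) 0
      (fun q => ENNReal.ofReal (Real.exp (β * q.1)) * hk q.1 q.2) t x ≤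
      ENNReal.ofReal (1 / 2) * (ENNReal.ofReal (Real.exp (β * t)) * hk t x) := by
  obtain ⟨θ, h, hθ, hh, hg⟩ := exists_gain_le (ε := 1 / 4) hw.nonneg (by norm_num)
  have hG := gain_nonneg hw.nonneg hθ 2
  set G := gain S θ 2
  have hW := hw.meas.enorm
  -- With this choice `exp (-β h) G = G exp (-4G) ≤ 1/4`.
  refine ⟨4 * G / h, by positivity, ?_⟩
  intro t ht x
  set β := 4 * G / h with hβ
  have hβ0 : 0 ≤ β := by positivity
  have hexp : Real.exp (-(β * h)) * G ≤ 1 / 4 := by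
    have e1 : β * h = 4 * G := by rw [hβ]; field_simp
    rw [e1, Real.exp_neg]
    have e2 : 4 * G ≤ Real.exp (4 * G) := by linarith [Real.add_one_le_exp (4 * G)]
    rw [inv_mul_le_iff₀ (Real.exp_pos _)]
    linarith
  calc duh (fun q => ‖w q‖ₑ) 0 (fun q => ENNReal.ofReal (Real.exp (β * q.1)) * hk q.1 q.2) t x
      ≤ duh (fun q => ‖w q‖ₑ) 0 (fun q => ENNReal.ofReal (Real.exp (β * t)) *
            (if t - h < q.1 then hk (q.1 - 0) (q.2 - 0) else 0) +
          ENNReal.ofReal (Real.exp (β * (t - h))) * hk (q.1 - 0) (q.2 - 0)) t x := by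
        apply duh_mono
        intro r hr z
        simp only [sub_zero]
        split_ifs with hc
        · refine le_trans ?_ le_self_add
          gcongr
          exact hr.2.le
        · simp only [mul_zero, zero_add]
          gcongr
          exact not_lt.1 hc
    _ = ENNReal.ofReal (Real.exp (β * t)) * duh (fun q => ‖w q‖ₑ) 0 (fun q =>
            (if t - h < q.1 then hk (q.1 - 0) (q.2 - 0) else 0)) t x +
          ENNReal.ofReal (Real.exp (β * (t - h))) *
            duh (fun q => ‖w q‖ₑ) 0 (fun q => hk (q.1 - 0) (q.2 - 0)) t x := by
        have hmeas : Measurable (fun q : ℝ × ℝ =>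
            (if t - h < q.1 then hk (q.1 - 0) (q.2 - 0) else 0)) :=
          Measurable.ite (measurableSet_lt measurable_const measurable_fst) (by fun_prop)
            measurable_const
        rw [duh_add hW (by fun_prop), duh_const_mul _ _ _ _ _ ENNReal.ofReal_ne_top,
          duh_const_mul _ _ _ _ _ ENNReal.ofReal_ne_top]
    _ ≤ ENNReal.ofReal (Real.exp (β * t)) * (ENNReal.ofReal (1 / 4) * hk (t - 0) (x - 0)) +
          ENNReal.ofReal (Real.exp (β * (t - h))) * (ENNReal.ofReal G * hk (t - 0) (x - 0)) := by
        gcongr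
        · calc _ ≤ duh (fun q => ‖w q‖ₑ) (t - h) (fun q => hk (q.1 - 0) (q.2 - 0)) t x := by
                unfold duh
                rw [← lintegral_indicator (measurableSet_Ioi.prod MeasurableSet.univ),
                  ← lintegral_indicator (measurableSet_Ioi.prod MeasurableSet.univ)]
                apply lintegral_mono
                intro q
                simp only [indicator, mem_prod, mem_Ioi, mem_univ, and_true]
                split_ifs <;> simp
            _ ≤ ENNReal.ofReal (gain S θ (t - (t - h))) * hk (t - 0) (x - 0) :=
                duh_hk_le_gain hW hw.nonneg hw.le hθ _ _ _ _ _
            _ ≤ _ := by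
                gcongr
                rwa [sub_sub_cancel]
        · refine (duh_hk_le_gain hW hw.nonneg hw.le hθ _ _ _ _ _).trans ?_
          gcongr
          exact gain_mono S hθ (by linarith [ht.2])
    _ = (ENNReal.ofReal (Real.exp (β * t)) * ENNReal.ofReal (1 / 4) +
          ENNReal.ofReal (Real.exp (β * (t - h))) * ENNReal.ofReal G) * hk t x := by
        simp only [sub_zero]
        ring
    _ ≤ _ := by
        rw [← mul_assoc]
        gcongr
        rw [← ENNReal.ofReal_mul (by positivity), ← ENNReal.ofReal_mul (by positivity),
          ← ENNReal.ofReal_add (by positivity) (by positivity), ← ENNReal.ofReal_mul (by positivity)]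
        apply ENNReal.ofReal_le_ofReal
        have e3 : Real.exp (β * (t - h)) = Real.exp (β * t) * Real.exp (-(β * h)) := by
          rw [← Real.exp_add]; ring_nf
        rw [e3]
        nlinarith [Real.exp_pos (β * t)]

/-- The terms of the perturbation series, set to zero outside the times in `(0, 2]`. -/
def picard (w : ℝ × ℝ → ℝ) : ℕ → ℝ × ℝ → ℝ
  | 0 => (Ioc (0 : ℝ) 2 ×ˢ univ).indicator (fun q => heatKernel q.1 q.2)
  | n + 1 => (Ioc (0 : ℝ) 2 ×ˢ univ).indicator (fun q => ∫ a in Ioi (0 : ℝ) ×ˢ (univ : Set ℝ),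
      heatKernel (q.1 - a.1) (q.2 - a.2) * w a * picard w n a)

lemma measurable_picard {w : ℝ × ℝ → ℝ} (hw : Measurable w) (n : ℕ) : Measurable (picard w n) := by
  have hm : MeasurableSet (Ioc (0 : ℝ) 2 ×ˢ (univ : Set ℝ)) :=
    measurableSet_Ioc.prod MeasurableSet.univ
  induction n with
  | zero => exact measurable_heatKernel.indicator hm
  | succ n ih =>
    refine Measurable.indicator ?_ hm
    have : Measurable (fun b : (ℝ × ℝ) × (ℝ × ℝ) =>
        heatKernel (b.1.1 - b.2.1) (b.1.2 - b.2.2) * w b.2 * picard w n b.2) := by fun_prop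
    exact (this.stronglyMeasurable.integral_prod_right'
      (ν := volume.restrict (Ioi (0 : ℝ) ×ˢ (univ : Set ℝ)))).measurable

/-- Solutions exist for square integrable potentials, and depend continuously on a factor. -/
lemma exists_mildFrom {w : ℝ × ℝ → ℝ} {S : ℝ} (hw : SqBound w S) :
    ∃ Z : ℝ → ℝ × ℝ → ℝ,
      (∀ a ∈ Icc (0 : ℝ) 1, MildFrom 0 (fun q => a * w q) (Measure.dirac (0, 0)) (Z a)) ∧
      ContinuousOn (fun a => Z a (2, 0)) (Icc 0 1) := by
  obtain ⟨β, hβ, hL⟩ := exists_weight hw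
  have hwm := hw.meas
  have hPm := measurable_picard hwm
  have hmset : MeasurableSet (Ioc (0 : ℝ) 2 ×ˢ (univ : Set ℝ)) :=
    measurableSet_Ioc.prod MeasurableSet.univ
  have hbound : ∀ n, ∀ q : ℝ × ℝ, ‖picard w n q‖ₑ ≤ ENNReal.ofReal ((1 / 2) ^ n) *
      (ENNReal.ofReal (Real.exp (β * q.1)) * hk q.1 q.2) := by
    intro n
    induction n with
    | zero =>
      intro q
      simp only [picard, indicator]
      split_ifs with h
      · rw [enorm_heatKernel]
        simp only [pow_zero, ENNReal.ofReal_one, one_mul]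
        refine le_mul_of_one_le_left' ?_
        rw [← ENNReal.ofReal_one]
        apply ENNReal.ofReal_le_ofReal
        exact Real.one_le_exp (mul_nonneg hβ h.1.1.le)
      · simp
    | succ n ih =>
      intro q
      rw [picard]
      simp only [indicator]
      split_ifs with h
      · refine (enorm_integral_le_lintegral_enorm _).trans ?_
        rw [lintegral_enorm_duhamel]
        calc _ ≤ duh (fun q => ‖w q‖ₑ) 0 (fun q => ENNReal.ofReal ((1 / 2) ^ n) *
              (ENNReal.ofReal (Real.exp (β * q.1)) * hk q.1 q.2)) q.1 q.2 :=
              duh_mono fun r hr z => ih (r, z)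
          _ ≤ _ := by
              rw [duh_const_mul _ _ _ _ _ ENNReal.ofReal_ne_top, pow_succ,
                ENNReal.ofReal_mul (by positivity), mul_assoc]
              gcongr
              exact hL q.1 h.1 q.2
      · simp
  have hbound' : ∀ n, ∀ q : ℝ × ℝ, |picard w n q| ≤
      (1 / 2) ^ n * (Real.exp (β * q.1) * heatKernel q.1 q.2) := by
    intro n q
    have := hbound n q
    rw [hk, ← ENNReal.ofReal_mul (by positivity), ← ENNReal.ofReal_mul (by positivity),
      ← ofReal_norm] at this
    exact (ENNReal.ofReal_le_ofReal_iff (by have := heatKernel_nonneg q.1 q.2; positivity)).1 this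
  have hterm : ∀ a ∈ Icc (0 : ℝ) 1, ∀ n, ∀ q : ℝ × ℝ, ‖a ^ n * picard w n q‖ ≤
      (1 / 2) ^ n * (Real.exp (β * q.1) * heatKernel q.1 q.2) := by
    intro a ha n q
    rw [norm_mul, norm_pow, Real.norm_of_nonneg ha.1]
    exact (mul_le_of_le_one_left (norm_nonneg _) (pow_le_one₀ ha.1 ha.2)).trans (hbound' n q)
  have hgeom : ∀ q : ℝ × ℝ, Summable (fun n : ℕ =>
      (1 / 2 : ℝ) ^ n * (Real.exp (β * q.1) * heatKernel q.1 q.2)) := fun q =>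
    (summable_geometric_of_lt_one (by norm_num) (by norm_num)).mul_right _
  have hsum : ∀ a ∈ Icc (0 : ℝ) 1, ∀ q : ℝ × ℝ, Summable (fun n => a ^ n * picard w n q) :=
    fun a ha q => Summable.of_norm_bounded (hgeom q) (fun n => hterm a ha n q)
  refine ⟨fun a q => ∑' n, a ^ n * picard w n q, ?_, ?_⟩
  · intro a ha
    have hZb : ∀ q : ℝ × ℝ, |∑' n, a ^ n * picard w n q| ≤
        2 * (Real.exp (β * q.1) * heatKernel q.1 q.2) := by
      intro q
      refine (tsum_of_norm_bounded (hgeom q).hasSum (fun n => hterm a ha n q)).trans_eq ?_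
      rw [tsum_mul_right, tsum_geometric_of_lt_one (by norm_num) (by norm_num)]
      norm_num
    refine ⟨?_, ⟨2 * Real.exp (β * 2), by positivity, ?_⟩, ?_, ?_⟩
    · refine measurable_of_tendsto_metrizable (f := fun (N : ℕ) (q : ℝ × ℝ) =>
        ∑ n ∈ Finset.range N, a ^ n * picard w n q) (fun N => by fun_prop) ?_
      rw [tendsto_pi_nhds]
      exact fun q => (hsum a ha q).hasSum.tendsto_sum_nat
    · intro t ht x
      refine (hZb (t, x)).trans ?_
      rw [mul_assoc]
      have := heatKernel_nonneg t x
      gcongr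
      exact ht.2
    · intro t ht x
      rw [heatSup_dirac]
      exact hk_ne_top _ _
    · intro t ht x
      rw [heatSup_dirac, toReal_hk]
      have hF : ∀ n, Integrable (fun q : ℝ × ℝ => heatKernel (t - q.1) (x - q.2) * w q * picard w n q)
          (volume.restrict (Ioi (0 : ℝ) ×ˢ (univ : Set ℝ))) := by
        intro n
        refine integrableOn_duhamel hw (hPm n) (C := Real.exp (β * t)) (by positivity) ?_ x
        intro r hr z
        refine (hbound' n (r, z)).trans ?_
        have := heatKernel_nonneg r z
        refine (mul_le_of_le_one_left (by positivity) (pow_le_one₀ (by norm_num) (by norm_num))).trans ?_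
        gcongr
        exact hr.2.le
      have hFb : ∀ n, ∫ q in Ioi (0 : ℝ) ×ˢ univ,
          ‖heatKernel (t - q.1) (x - q.2) * w q * picard w n q‖ ≤
          (1 / 2) ^ n * (Real.exp (β * t) * heatKernel t x) := by
        intro n
        rw [integral_norm_eq_lintegral_enorm (hF n).1, lintegral_enorm_duhamel]
        have h1 : duh (fun q => ‖w q‖ₑ) 0 (fun q => ‖picard w n q‖ₑ) t x ≤
            ENNReal.ofReal ((1 / 2) ^ n * (Real.exp (β * t) * heatKernel t x)) := by
          calc _ ≤ duh (fun q => ‖w q‖ₑ) 0 (fun q => ENNReal.ofReal ((1 / 2) ^ n) *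
              (ENNReal.ofReal (Real.exp (β * q.1)) * hk q.1 q.2)) t x :=
              duh_mono fun r hr z => hbound n (r, z)
            _ ≤ ENNReal.ofReal ((1 / 2) ^ n) * (1 * (ENNReal.ofReal (Real.exp (β * t)) * hk t x)) := by
              rw [duh_const_mul _ _ _ _ _ ENNReal.ofReal_ne_top]
              gcongr
              refine (hL t ht x).trans ?_
              gcongr
              rw [← ENNReal.ofReal_one]
              exact ENNReal.ofReal_le_ofReal (by norm_num)
            _ = _ := by
              rw [one_mul, hk, ENNReal.ofReal_mul (by positivity), ENNReal.ofReal_mul (by positivity)]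
        refine (ENNReal.toReal_mono ENNReal.ofReal_ne_top h1).trans_eq ?_
        rw [ENNReal.toReal_ofReal]
        have := heatKernel_nonneg t x
        positivity
      -- Integrating the series term by term turns the potential `a * w` acting on the whole sum
      -- into the sum of the terms with index at least one.
      have hHS := hasSum_integral_of_summable_integral_norm
        (μ := volume.restrict (Ioi (0 : ℝ) ×ˢ (univ : Set ℝ)))
        (F := fun n (q : ℝ × ℝ) => a ^ (n + 1) *
          (heatKernel (t - q.1) (x - q.2) * w q * picard w n q))
        (fun n => (hF n).const_mul _) (by
          refine Summable.of_nonneg_of_le (fun n => integral_nonneg fun _ => norm_nonneg _) ?_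
            (hgeom (t, x))
          intro n
          simp_rw [norm_mul (a ^ (n + 1))]
          rw [integral_const_mul, norm_pow, Real.norm_of_nonneg ha.1]
          refine (mul_le_of_le_one_left (integral_nonneg fun _ => norm_nonneg _)
            (pow_le_one₀ ha.1 ha.2)).trans (hFb n))
      have hint : ∀ q : ℝ × ℝ, ∑' n, a ^ (n + 1) *
          (heatKernel (t - q.1) (x - q.2) * w q * picard w n q) =
          heatKernel (t - q.1) (x - q.2) * (a * w q) * ∑' n, a ^ n * picard w n q := by
        intro q
        rw [← tsum_mul_left]
        congr 1
        ext n
        ring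
      simp_rw [hint] at hHS
      beta_reduce
      rw [(hsum a ha (t, x)).tsum_eq_zero_add]
      congr 1
      · simp [picard, ht.1, ht.2]
      · rw [← hHS.tsum_eq]
        congr 1
        ext n
        rw [integral_const_mul]
        congr 1
        simp [picard, ht.1, ht.2]
  · refine continuousOn_tsum (u := fun n => (1 / 2) ^ n * (Real.exp (β * 2) * heatKernel 2 0))
      (fun n => by fun_prop) (hgeom (2, 0)) ?_
    intro n a ha
    exact hterm a ha n (2, 0)

/-! ### From pointwise solutions on the slab to mild solutions and back -/

lemma slabMeasure_eq (T : ℝ) :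
    slabMeasure T = (volume : Measure (ℝ × ℝ)).restrict (Icc 0 T ×ˢ univ) := by
  rw [slabMeasure, Measure.volume_eq_prod, ← Measure.prod_restrict, Measure.restrict_univ]

lemma measurableSet_slab (T : ℝ) : MeasurableSet (Icc (0 : ℝ) T ×ˢ (univ : Set ℝ)) :=
  measurableSet_Icc.prod MeasurableSet.univ

lemma slabMeasure_mono {t T : ℝ} (h : t ≤ T) : slabMeasure t ≤ slabMeasure T := by
  rw [slabMeasure_eq, slabMeasure_eq]
  exact Measure.restrict_mono (prod_mono (Icc_subset_Icc_right h) subset_rfl) le_rfl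

lemma slab_ae_eq (t : ℝ) :
    (Icc (0 : ℝ) t ×ˢ (univ : Set ℝ)) =ᵐ[volume] (Ioo 0 t ×ˢ univ) := by
  rw [Measure.volume_eq_prod]
  exact Measure.set_prod_ae_eq Ioo_ae_eq_Icc.symm (Filter.EventuallyEq.refl _ _)

/-- Since the kernel vanishes at nonpositive times, one domain of integration serves every `t`. -/
lemma indicator_Ioi_heatKernel (t x : ℝ) (g : ℝ × ℝ → ℝ) :
    (Ioi (0 : ℝ) ×ˢ (univ : Set ℝ)).indicator
      (fun q => heatKernel (t - q.1) (x - q.2) * g q) =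
    (Ioo (0 : ℝ) t ×ˢ (univ : Set ℝ)).indicator
      (fun q => heatKernel (t - q.1) (x - q.2) * g q) := by
  ext q
  simp only [indicator, mem_prod, mem_Ioi, mem_Ioo, mem_univ, and_true]
  by_cases hq : t ≤ q.1
  · simp [heatKernel_of_nonpos (sub_nonpos.2 hq)]
  · simp [not_le.1 hq]

lemma integral_slab_eq {f g : ℝ × ℝ → ℝ} (hfg : f =ᵐ[slabMeasure 2] g) {t : ℝ} (ht : t ≤ 2) (x : ℝ) :
    ∫ q, heatKernel (t - q.1) (x - q.2) * f q ∂(slabMeasure t) =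
      ∫ q in Ioi (0 : ℝ) ×ˢ univ, heatKernel (t - q.1) (x - q.2) * g q := by
  have h1 : ∫ q, heatKernel (t - q.1) (x - q.2) * f q ∂(slabMeasure t) =
      ∫ q, heatKernel (t - q.1) (x - q.2) * g q ∂(slabMeasure t) := by
    apply integral_congr_ae
    filter_upwards [ae_mono (slabMeasure_mono ht) hfg] with q hq
    rw [hq]
  rw [h1, slabMeasure_eq, setIntegral_congr_set (slab_ae_eq t),
    ← integral_indicator (measurableSet_Ioo.prod MeasurableSet.univ),
    ← integral_indicator (measurableSet_Ioi.prod MeasurableSet.univ), indicator_Ioi_heatKernel]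

lemma integrable_slab {f g : ℝ × ℝ → ℝ} (hfg : f =ᵐ[slabMeasure 2] g) {t : ℝ} (ht : t ≤ 2) {x : ℝ}
    (h : IntegrableOn (fun q : ℝ × ℝ => heatKernel (t - q.1) (x - q.2) * g q)
      (Ioi (0 : ℝ) ×ˢ univ)) :
    Integrable (fun q : ℝ × ℝ => heatKernel (t - q.1) (x - q.2) * f q) (slabMeasure t) := by
  have h1 : Integrable (fun q : ℝ × ℝ => heatKernel (t - q.1) (x - q.2) * g q) (slabMeasure t) := by
    rw [slabMeasure_eq, Measure.restrict_congr_set (slab_ae_eq t)]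
    exact h.mono_set (prod_mono Ioo_subset_Ioi_self subset_rfl)
  refine h1.congr ?_
  filter_upwards [ae_mono (slabMeasure_mono ht) hfg] with q hq
  rw [hq]

lemma ae_slab_mem (T : ℝ) : ∀ᵐ q ∂(slabMeasure T), q ∈ Ioc (0 : ℝ) T ×ˢ (univ : Set ℝ) := by
  have h : (Ioc (0 : ℝ) T ×ˢ (univ : Set ℝ)) =ᵐ[volume] (Icc 0 T ×ˢ univ) := by
    rw [Measure.volume_eq_prod]
    exact Measure.set_prod_ae_eq Ioc_ae_eq_Icc (Filter.EventuallyEq.refl _ _)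
  rw [slabMeasure_eq, ← Measure.restrict_congr_set h]
  exact ae_restrict_mem (measurableSet_Ioc.prod MeasurableSet.univ)

/-- A representative of a potential that is measurable and vanishes outside the slab. -/
lemma exists_sqBound {w : ℝ × ℝ → ℝ} (hw : MemLp w 2 (slabMeasure 2)) :
    ∃ v, v =ᵐ[slabMeasure 2] w ∧ SqBound v (2 * cost w) ∧ ∀ q, q.1 ∉ Icc (0 : ℝ) 2 → v q = 0 := by
  have hm := measurableSet_slab 2
  set v0 := hw.1.mk w with hv0
  have hv0m : Measurable v0 := hw.1.stronglyMeasurable_mk.measurable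
  have hae : (Icc (0 : ℝ) 2 ×ˢ (univ : Set ℝ)).indicator v0 =ᵐ[slabMeasure 2] w := by
    have h1 : v0 =ᵐ[slabMeasure 2] w := hw.1.ae_eq_mk.symm
    have h2 : ∀ᵐ q ∂(slabMeasure 2), q ∈ Icc (0 : ℝ) 2 ×ˢ (univ : Set ℝ) := by
      rw [slabMeasure_eq]; exact ae_restrict_mem hm
    filter_upwards [h1, h2] with q hq hq2
    rw [indicator_of_mem hq2, hq]
  refine ⟨_, hae, ⟨hv0m.indicator hm, ?_, ?_⟩, ?_⟩
  · rw [cost]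
    have : 0 ≤ ∫ q, w q ^ 2 ∂(slabMeasure 2) := integral_nonneg fun _ => sq_nonneg _
    linarith
  · have h1 : ∫⁻ q, ‖(Icc (0 : ℝ) 2 ×ˢ (univ : Set ℝ)).indicator v0 q‖ₑ ^ 2 =
        ∫⁻ q, ‖(Icc (0 : ℝ) 2 ×ˢ (univ : Set ℝ)).indicator v0 q‖ₑ ^ 2 ∂(slabMeasure 2) := by
      rw [slabMeasure_eq, ← lintegral_indicator hm]
      congr 1
      ext q
      simp only [indicator]
      split_ifs <;> simp
    have h2 : ∫⁻ q, ‖(Icc (0 : ℝ) 2 ×ˢ (univ : Set ℝ)).indicator v0 q‖ₑ ^ 2 ∂(slabMeasure 2) =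
        ∫⁻ q, ENNReal.ofReal (w q ^ 2) ∂(slabMeasure 2) := by
      apply lintegral_congr_ae
      filter_upwards [hae] with q hq
      rw [hq, ← ofReal_norm, ← ENNReal.ofReal_pow (norm_nonneg _), Real.norm_eq_abs, sq_abs]
    rw [h1, h2, ← ofReal_integral_eq_lintegral_ofReal hw.integrable_sq
      (Filter.Eventually.of_forall fun _ => sq_nonneg _), cost]
    apply le_of_eq
    congr 1
    ring
  · intro q hq
    apply indicator_of_notMem
    exact fun h => hq h.1

/-- A solution in the sense of `IsSolution` is a mild solution for a measurable representative. -/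
lemma IsSolution.exists_mildFrom {w v : ℝ × ℝ → ℝ} {Z : ℝ → ℝ → ℝ} (hZ : IsSolution w Z)
    (hvm : Measurable v) (hv : v =ᵐ[slabMeasure 2] w) :
    ∃ D, MildFrom 0 v (Measure.dirac (0, 0)) D ∧ ∀ t ∈ Ioc (0 : ℝ) 2, ∀ x, Z t x = D (t, x) := by
  have hsol := hZ
  obtain ⟨hZm, ⟨C, hC⟩, -, hduh⟩ := hZ
  set u := hZm.mk _ with hu
  have hum : Measurable u := hZm.stronglyMeasurable_mk.measurable
  have hue : (fun q : ℝ × ℝ => Z q.1 q.2) =ᵐ[slabMeasure 2] u := hZm.ae_eq_mk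
  have hC0 : 0 ≤ C := by
    have h1 := (abs_nonneg _).trans (hC 2 ⟨by norm_num, le_rfl⟩ 0)
    have h2 := heatKernel_pos (by norm_num : (0 : ℝ) < 2) 0
    exact nonneg_of_mul_nonneg_left h1 h2
  -- `Z` is only a.e. measurable. The right-hand side of the Duhamel formula, written with a
  -- measurable representative `u`, is measurable and still equals `Z` at every point of `(0, 2] ×
  -- ℝ`.
  set D : ℝ × ℝ → ℝ := fun q => heatKernel q.1 q.2 + ∫ a in Ioi (0 : ℝ) ×ˢ (univ : Set ℝ),
    heatKernel (q.1 - a.1) (q.2 - a.2) * (v a * u a) with hD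
  have hDm : Measurable D := by
    refine measurable_heatKernel.add ?_
    have : Measurable (fun b : (ℝ × ℝ) × (ℝ × ℝ) =>
        heatKernel (b.1.1 - b.2.1) (b.1.2 - b.2.2) * (v b.2 * u b.2)) := by fun_prop
    exact (this.stronglyMeasurable.integral_prod_right'
      (ν := volume.restrict (Ioi (0 : ℝ) ×ˢ (univ : Set ℝ)))).measurable
  have hZD : ∀ t ∈ Ioc (0 : ℝ) 2, ∀ x, Z t x = D (t, x) := by
    intro t ht x
    rw [hduh t ht x]
    simp only [hD]
    congr 1
    rw [← integral_slab_eq (f := fun q => w q * Z q.1 q.2) _ ht.2]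
    · simp_rw [mul_assoc]
    · filter_upwards [hv, hue] with q h1 h2
      simp only [h1, ← h2]
  refine ⟨D, ⟨hDm, ⟨C, hC0, ?_⟩, ?_, ?_⟩, hZD⟩
  · intro t ht x
    rw [← hZD t ht x]
    exact hC t ht x
  · intro t ht x
    rw [heatSup_dirac]
    exact hk_ne_top _ _
  · intro t ht x
    rw [heatSup_dirac, toReal_hk, ← hZD t ht x, hduh t ht x]
    congr 1
    simp_rw [mul_assoc]
    rw [integral_slab_eq (f := fun q => w q * Z q.1 q.2) (g := fun q => v q * D q) _ ht.2]
    filter_upwards [hv, ae_slab_mem 2] with q h1 h2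
    rw [h1, hZD q.1 h2.1 q.2]

lemma MildFrom.isSolution {w v : ℝ × ℝ → ℝ} {D : ℝ × ℝ → ℝ} {S : ℝ} (hS : SqBound v S)
    (hD : MildFrom 0 v (Measure.dirac (0, 0)) D) (hv : v =ᵐ[slabMeasure 2] w) :
    IsSolution w (fun t x => D (t, x)) := by
  obtain ⟨hDm, ⟨C, hC, hb⟩, -, hduh⟩ := hD
  refine ⟨hDm.aestronglyMeasurable, ⟨C, hb⟩, ?_, ?_⟩
  · intro t ht x
    have := integrableOn_duhamel hS hDm hC (t0 := 0) (t := t)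
      (fun r hr z => hb r ⟨hr.1, hr.2.le.trans ht.2⟩ z) x
    simp_rw [mul_assoc] at this ⊢
    refine integrable_slab (f := fun q => w q * D q) ?_ ht.2 this
    filter_upwards [hv] with q h1
    rw [h1]
  · intro t ht x
    rw [hduh t ht x, heatSup_dirac, toReal_hk]
    congr 1
    simp_rw [mul_assoc]
    rw [integral_slab_eq (f := fun q => w q * D q) (g := fun q => v q * D q) _ ht.2]
    filter_upwards [hv] with q h1
    rw [h1]

/-! ### Nonpositive potentials and free evolution of slices -/

/-- The mild equation for a nonpositive potential, as an identity between nonnegative quantities. -/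
lemma MildFrom.ofReal_add_duh {t0 : ℝ} {w : ℝ × ℝ → ℝ} {ν : Measure (ℝ × ℝ)} {D : ℝ × ℝ → ℝ}
    (hD : MildFrom t0 w ν D) {S : ℝ} (hw : SqBound w S) (hneg : ∀ q, w q ≤ 0)
    (hpos : ∀ t ∈ Ioc t0 2, ∀ x, 0 ≤ D (t, x)) {t : ℝ} (ht : t ∈ Ioc t0 2) (x : ℝ) :
    ENNReal.ofReal (D (t, x)) +
      duh (fun q => ‖w q‖ₑ) t0 (fun q => ENNReal.ofReal (D q)) t x = heatSup ν t x := by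
  obtain ⟨C, hC, hb⟩ := hD.bound
  have hDm := hD.meas
  have hwm := hw.meas
  have h1 : duh (fun q => ‖w q‖ₑ) t0 (fun q => ENNReal.ofReal (D q)) t x =
      ∫⁻ q in Ioi t0 ×ˢ univ, hk (t - q.1) (x - q.2) * ENNReal.ofReal (-w q * D q) := by
    unfold duh
    apply lintegral_congr
    intro q
    beta_reduce
    rw [ENNReal.ofReal_mul (neg_nonneg.2 (hneg q)), mul_assoc, ← ofReal_norm,
      Real.norm_of_nonpos (hneg q)]
  have hle : duh (fun q => ‖w q‖ₑ) t0 (fun q => ENNReal.ofReal (D q)) t x ≤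
      duh (fun q => ‖w q‖ₑ) t0 (fun q => ‖D q‖ₑ) t x :=
    duh_mono fun r hr z => Real.ofReal_le_enorm _
  have hfin : duh (fun q => ‖w q‖ₑ) t0 (fun q => ENNReal.ofReal (D q)) t x ≠ ∞ :=
    (hle.trans_lt (duh_lt_top_of_bound hw hC
      (fun r hr z => hb r ⟨hr.1, hr.2.le.trans ht.2⟩ z) x)).ne
  have h2 : (duh (fun q => ‖w q‖ₑ) t0 (fun q => ENNReal.ofReal (D q)) t x).toReal =
      - ∫ q in Ioi t0 ×ˢ univ, heatKernel (t - q.1) (x - q.2) * w q * D q := by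
    rw [h1, toReal_lintegral_hk_mul (by fun_prop), ← integral_neg]
    · congr 1
      ext q
      ring
    · intro r hr z
      exact mul_nonneg (neg_nonneg.2 (hneg _)) (hpos r ⟨hr.1, hr.2.le.trans ht.2⟩ z)
  rw [← ENNReal.toReal_eq_toReal_iff' (ENNReal.add_ne_top.2 ⟨ENNReal.ofReal_ne_top, hfin⟩)
    (hD.finite t ht x), ENNReal.toReal_add ENNReal.ofReal_ne_top hfin, h2,
    ENNReal.toReal_ofReal (hpos t ht x), hD.duhamel t ht x]
  ring

/-- The free evolution, from time `s` to time `t`, of the slice of `D` at time `s`. -/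
def evol (D : ℝ × ℝ → ℝ) (s t x : ℝ) : ℝ≥0∞ :=
  ∫⁻ z, hk (t - s) (x - z) * ENNReal.ofReal (D (s, z))

lemma heatSup_restartSource_dirac {D : ℝ × ℝ → ℝ} (hD : Measurable D) {s : ℝ} (hs : 0 < s)
    (t x : ℝ) :
    heatSup (restartSource s (Measure.dirac (0, 0)) D) t x = evol D s t x := by
  rw [heatSup_restartSource _ _ hD, evol]
  have : (Measure.dirac ((0 : ℝ), (0 : ℝ))).restrict (Ici s ×ˢ univ) = 0 := by
    rw [Measure.restrict_eq_zero, Measure.dirac_apply' _ (measurableSet_Ici.prod MeasurableSet.univ)]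
    simp [hs]
  rw [this]
  simp [heatSup]

/-! ### Competitors for the minimization and the sign of minimizers -/

lemma SqBound.memLp {v : ℝ × ℝ → ℝ} {S : ℝ} (hv : SqBound v S) : MemLp v 2 (slabMeasure 2) := by
  refine ⟨hv.meas.aestronglyMeasurable, ?_⟩
  rw [eLpNorm_lt_top_iff_lintegral_rpow_enorm_lt_top (by norm_num) (by norm_num)]
  have h1 : ∫⁻ q, ‖v q‖ₑ ^ (2 : ℝ≥0∞).toReal ∂(slabMeasure 2) ≤ ∫⁻ q, ‖v q‖ₑ ^ 2 := by
    rw [slabMeasure_eq]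
    refine (setLIntegral_le_lintegral _ _).trans_eq ?_
    simp
  exact (h1.trans hv.le).trans_lt ENNReal.ofReal_lt_top

lemma SqBound.cost_le {v : ℝ × ℝ → ℝ} {S : ℝ} (hv : SqBound v S) : 2 * cost v ≤ S := by
  have h1 : ∫ q, v q ^ 2 ∂(slabMeasure 2) ≤ S := by
    rw [integral_eq_lintegral_of_nonneg_ae (Filter.Eventually.of_forall fun _ => sq_nonneg _)
      (hv.meas.pow_const 2).aestronglyMeasurable]
    apply ENNReal.toReal_le_of_le_ofReal hv.nonneg
    refine le_trans ?_ hv.le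
    rw [slabMeasure_eq]
    refine (setLIntegral_le_lintegral _ _).trans_eq ?_
    apply lintegral_congr
    intro q
    rw [← ofReal_norm, ← ENNReal.ofReal_pow (norm_nonneg _), Real.norm_eq_abs, sq_abs]
  rw [cost]
  linarith

lemma SqBound.mono {v v' : ℝ × ℝ → ℝ} {S : ℝ} (hv : SqBound v S) (hm : Measurable v')
    (h : ∀ q, |v' q| ≤ |v q|) : SqBound v' S := by
  refine ⟨hm, hv.nonneg, le_trans (lintegral_mono fun q => ?_) hv.le⟩
  gcongr
  rw [enorm_le_iff_norm_le]
  exact h q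

lemma SqBound.const_mul {v : ℝ × ℝ → ℝ} {S : ℝ} (hv : SqBound v S) {a : ℝ} (ha : a ∈ Icc (0 : ℝ) 1) :
    SqBound (fun q => a * v q) S := by
  have := hv.meas
  refine hv.mono (by fun_prop) fun q => ?_
  rw [abs_mul, abs_of_nonneg ha.1]
  exact mul_le_of_le_one_left (abs_nonneg _) ha.2

/-- By continuity, a multiple of a suitable potential is admissible. -/
lemma exists_admissible {v : ℝ × ℝ → ℝ} {S lam : ℝ} (hv : SqBound v S)
    (h : ∀ D, MildFrom 0 v (Measure.dirac (0, 0)) D →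
      Real.exp (-lam) ∈ uIcc (heatKernel 2 0) (D (2, 0))) :
    ∃ a ∈ Icc (0 : ℝ) 1, (fun q => a * v q) ∈ admissible lam := by
  obtain ⟨Z, hZ, hcont⟩ := exists_mildFrom hv
  have h0 : Z 0 (2, 0) = heatKernel 2 0 := by
    have := (hZ 0 ⟨le_rfl, zero_le_one⟩).duhamel 2 ⟨by norm_num, le_rfl⟩ 0
    simpa [heatSup_dirac, toReal_hk] using this
  have h1 := h (Z 1) (by simpa using hZ 1 ⟨zero_le_one, le_rfl⟩)
  have hI : Icc (0 : ℝ) 1 = uIcc 0 1 := (uIcc_of_le zero_le_one).symm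
  rw [hI] at hcont
  have hmem := intermediate_value_uIcc hcont
  simp only [h0] at hmem
  obtain ⟨a, ha, hae⟩ := hmem h1
  rw [← hI] at ha
  refine ⟨a, ha, (hv.const_mul ha).memLp, _, (hZ a ha).isSolution (hv.const_mul ha)
    (Filter.EventuallyEq.refl _ _), hae⟩

/-- A potential that overshoots the target `exp (-lam)`, in either direction from `p(2, 0)`, is as
good as an admissible one: scaling it down to hit the target does not increase the norm. -/
lemma IsMinimizer.cost_le {v w : ℝ × ℝ → ℝ} {S lam : ℝ} (hw : IsMinimizer lam w) (hv : SqBound v S)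
    (h : ∀ D, MildFrom 0 v (Measure.dirac (0, 0)) D →
      Real.exp (-lam) ∈ uIcc (heatKernel 2 0) (D (2, 0))) : 2 * cost w ≤ S := by
  obtain ⟨a, ha, hadm⟩ := exists_admissible hv h
  have := hw.2 _ hadm
  linarith [(hv.const_mul ha).cost_le]

lemma heatKernel_two_zero : heatKernel 2 0 = (Real.sqrt (4 * Real.pi))⁻¹ := by
  simp only [heatKernel]
  rw [show 2 * Real.pi * 2 = 4 * Real.pi by ring]
  simp

lemma heatKernel_two_zero_le : heatKernel 2 0 ≤ 1 / 3 := by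
  rw [heatKernel_two_zero, one_div]
  apply inv_anti₀ (by norm_num)
  apply Real.le_sqrt_of_sq_le
  linarith [Real.pi_gt_three]

lemma le_heatKernel_two_zero : 1 / 4 ≤ heatKernel 2 0 := by
  rw [heatKernel_two_zero, one_div]
  apply inv_anti₀ (Real.sqrt_pos.2 (by positivity))
  rw [Real.sqrt_le_iff]
  constructor
  · norm_num
  · linarith [Real.pi_le_four]

lemma exp_neg_two_le : Real.exp (-2) ≤ 1 / 4 := by
  have h : (2 : ℝ) ≤ Real.exp 1 := by linarith [Real.add_one_le_exp 1]
  have h2 : Real.exp 2 = Real.exp 1 * Real.exp 1 := by rw [← Real.exp_add]; norm_num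
  rw [Real.exp_neg, one_div]
  apply inv_anti₀ (by norm_num)
  nlinarith

/-- In the lower tail, minimizers are nonpositive. -/
lemma IsMinimizer.nonpos {w : ℝ × ℝ → ℝ} {lam : ℝ} (hw : IsMinimizer lam w)
    (hlam : Real.exp (-lam) ≤ heatKernel 2 0) : ∀ᵐ q ∂(slabMeasure 2), w q ≤ 0 := by
  obtain ⟨⟨hL2, Z, hZ, hZe⟩, hmin⟩ := hw
  obtain ⟨v, hvae, hv, -⟩ := exists_sqBound hL2
  have hvm := hv.meas
  obtain ⟨D, hD, hZD⟩ := hZ.exists_mildFrom hvm hvae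
  have hv' : SqBound (fun q => min (v q) 0) (2 * cost w) := by
    refine hv.mono (by fun_prop) fun q => ?_
    rcases le_total (v q) 0 with h | h
    · simp [min_eq_left h]
    · simp [min_eq_right h]
  -- Dropping the positive part lowers `Z(2, 0)` below the target, while the zero potential is at or
  -- above it. So some multiple of the negative part is admissible, and minimality leaves no room
  -- for a positive part.
  obtain ⟨a, ha, hadm⟩ := exists_admissible (lam := lam) hv' (by
    intro D' hD'
    have h1 := hD.mono hD' hv hv' (fun q => min_le_left _ _) (t := 2) ⟨by norm_num, le_rfl⟩ 0
    rw [← hZD 2 ⟨by norm_num, le_rfl⟩, hZe] at h1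
    rw [uIcc_comm]
    exact Icc_subset_uIcc ⟨h1, hlam⟩)
  have hcost := hmin _ hadm
  have hi1 : Integrable (fun q => v q ^ 2) (slabMeasure 2) := hv.memLp.integrable_sq
  have hi2 : Integrable (fun q => (min (v q) 0) ^ 2) (slabMeasure 2) := hv'.memLp.integrable_sq
  have hwv : ∫ q, w q ^ 2 ∂(slabMeasure 2) = ∫ q, v q ^ 2 ∂(slabMeasure 2) := by
    apply integral_congr_ae
    filter_upwards [hvae] with q hq
    rw [hq]
  have hle : ∫ q, v q ^ 2 ∂(slabMeasure 2) ≤ ∫ q, (min (v q) 0) ^ 2 ∂(slabMeasure 2) := by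
    have h2 : ∫ q, (a * min (v q) 0) ^ 2 ∂(slabMeasure 2) ≤
        ∫ q, (min (v q) 0) ^ 2 ∂(slabMeasure 2) := by
      simp_rw [mul_pow]
      rw [integral_const_mul]
      exact mul_le_of_le_one_left (integral_nonneg fun _ => sq_nonneg _) (pow_le_one₀ ha.1 ha.2)
    simp only [cost] at hcost
    linarith
  have hpt : ∀ q, 0 ≤ v q ^ 2 - (min (v q) 0) ^ 2 := by
    intro q
    rcases le_total (v q) 0 with h | h
    · simp [min_eq_left h]
    · simp only [min_eq_right h]; nlinarith
  have hz : ∫ q, (v q ^ 2 - (min (v q) 0) ^ 2) ∂(slabMeasure 2) = 0 := by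
    apply le_antisymm _ (integral_nonneg hpt)
    rw [integral_sub hi1 hi2]
    linarith
  have hz' := (integral_eq_zero_iff_of_nonneg hpt (hi1.sub hi2)).1 hz
  filter_upwards [hz', hvae] with q h1 h2
  rw [← h2]
  by_contra hc
  push Not at hc
  simp only [min_eq_right hc.le, Pi.zero_apply] at h1
  nlinarith

/-! ### Box potentials and bounds for the minimal cost -/

/-- The potential equal to `A` on `[0, 2] × [-R, R]`. -/
def boxPotential (A R : ℝ) : ℝ × ℝ → ℝ :=
  (Icc (0 : ℝ) 2 ×ˢ Icc (-R) R).indicator (fun _ => A)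

lemma sqBound_boxPotential (A : ℝ) {R : ℝ} (hR : 0 ≤ R) :
    SqBound (boxPotential A R) (4 * R * A ^ 2) := by
  have hm : MeasurableSet (Icc (0 : ℝ) 2 ×ˢ Icc (-R) R) := measurableSet_Icc.prod measurableSet_Icc
  refine ⟨measurable_const.indicator hm, by positivity, ?_⟩
  have h : ∀ q, ‖boxPotential A R q‖ₑ ^ 2 =
      (Icc (0 : ℝ) 2 ×ˢ Icc (-R) R).indicator (fun _ => ENNReal.ofReal (A ^ 2)) q := by
    intro q
    simp only [boxPotential, indicator]
    split_ifs
    · rw [← ofReal_norm, ← ENNReal.ofReal_pow (norm_nonneg _), Real.norm_eq_abs, sq_abs]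
    · simp
  simp_rw [h]
  rw [lintegral_indicator hm, setLIntegral_const, Measure.volume_eq_prod, Measure.prod_prod,
    Real.volume_Icc, Real.volume_Icc, ← ENNReal.ofReal_mul (by norm_num),
    ← ENNReal.ofReal_mul (by positivity)]
  apply ENNReal.ofReal_le_ofReal
  linarith

/-- Gaussian tail bound for the bridge from `(0, 0)` to `(2, 0)`. -/
lemma lintegral_bridge_tail_le {r : ℝ} (hr : r ∈ Ioo (0 : ℝ) 2) {R : ℝ} (hR : 0 ≤ R) :
    ∫⁻ z in (Icc (-R) R)ᶜ, hk (2 - r) (0 - z) * hk r z ≤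
      ENNReal.ofReal (1 / 2 * Real.exp (-(R ^ 2) / 2)) := by
  have hr1 : 0 < 2 - r := sub_pos.2 hr.2
  have hr0 := hr.1
  set v := (2 - r) * r / (2 - r + r) with hv
  have hv0 : 0 < v := by positivity
  have hv1 : v ≤ 1 / 2 := by
    rw [hv, div_le_iff₀ (by linarith)]
    nlinarith [sq_nonneg (r - 1)]
  -- Half of the Gaussian exponent pays for the tail, using `v ≤ 1/2`; the other half is kept as a
  -- Gaussian of variance `2v`, which integrates to one.
  have hpt : ∀ z ∈ (Icc (-R) R)ᶜ, hk (2 - r) (0 - z) * hk r z ≤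
      ENNReal.ofReal (1 / 2 * Real.exp (-(R ^ 2) / 2)) * hk (2 * v) (z - 0) := by
    intro z hz
    rw [hk_mul hr1 hr0]
    simp only [hk]
    rw [← ENNReal.ofReal_mul (heatKernel_nonneg _ _), ← ENNReal.ofReal_mul (by positivity)]
    apply ENNReal.ofReal_le_ofReal
    rw [show 2 - r + r = (2 : ℝ) by ring] at hv ⊢
    rw [show (0 : ℝ) - z + z = 0 by ring, ← hv, show z - r / 2 * 0 = z by ring, sub_zero]
    have hz2 : R ^ 2 ≤ z ^ 2 := by
      rw [sq_le_sq, abs_of_nonneg hR]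
      by_contra hc
      exact hz (abs_le.1 (not_le.1 hc).le)
    have h1 : heatKernel v z ≤ 3 / 2 * Real.exp (-(R ^ 2) / 2) * heatKernel (2 * v) z := by
      simp only [heatKernel]
      have e1 : (Real.sqrt (2 * Real.pi * v))⁻¹ ≤ 3 / 2 * (Real.sqrt (2 * Real.pi * (2 * v)))⁻¹ := by
        have hs : Real.sqrt (2 * Real.pi * (2 * v)) ≤ 3 / 2 * Real.sqrt (2 * Real.pi * v) := by
          rw [Real.sqrt_le_iff]
          refine ⟨by positivity, ?_⟩
          rw [mul_pow, Real.sq_sqrt (by positivity)]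
          have : 0 < Real.pi * v := by positivity
          nlinarith
        rw [← div_eq_mul_inv, le_div_iff₀ (Real.sqrt_pos.2 (by positivity)),
          inv_mul_le_iff₀ (Real.sqrt_pos.2 (by positivity))]
        linarith
      have e2 : Real.exp (-(z ^ 2) / (2 * v)) ≤
          Real.exp (-(R ^ 2) / 2) * Real.exp (-(z ^ 2) / (2 * (2 * v))) := by
        rw [← Real.exp_add, Real.exp_le_exp]
        have e3 : -(z ^ 2) / (2 * v) = -(z ^ 2) / (2 * (2 * v)) - z ^ 2 / (4 * v) := by
          field_simp
          ring
        have e4 : R ^ 2 / 2 ≤ z ^ 2 / (4 * v) := by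
          rw [div_le_div_iff₀ (by norm_num) (by positivity)]
          nlinarith [sq_nonneg z, sq_nonneg R]
        rw [e3]
        linarith
      calc _ ≤ 3 / 2 * (Real.sqrt (2 * Real.pi * (2 * v)))⁻¹ *
            (Real.exp (-(R ^ 2) / 2) * Real.exp (-(z ^ 2) / (2 * (2 * v)))) := by gcongr
        _ = _ := by ring
    have h2 := heatKernel_two_zero_le
    have h3 := heatKernel_nonneg (2 * v) z
    calc heatKernel 2 0 * heatKernel v z
        ≤ 1 / 3 * (3 / 2 * Real.exp (-(R ^ 2) / 2) * heatKernel (2 * v) z) := by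
          gcongr
          exact heatKernel_nonneg _ _
      _ = _ := by ring
  calc _ ≤ ∫⁻ z in (Icc (-R) R)ᶜ, ENNReal.ofReal (1 / 2 * Real.exp (-(R ^ 2) / 2)) *
          hk (2 * v) (z - 0) := setLIntegral_mono' measurableSet_Icc.compl hpt
    _ ≤ ∫⁻ z, ENNReal.ofReal (1 / 2 * Real.exp (-(R ^ 2) / 2)) * hk (2 * v) (z - 0) :=
        setLIntegral_le_lintegral _ _
    _ = _ := by
        rw [lintegral_const_mul' _ _ ENNReal.ofReal_ne_top, lintegral_hk (by positivity), mul_one]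

lemma MildFrom.ofReal_add_duh_evol {w : ℝ × ℝ → ℝ} {D : ℝ × ℝ → ℝ}
    (hD : MildFrom 0 w (Measure.dirac (0, 0)) D) {S : ℝ} (hw : SqBound w S) (hneg : ∀ q, w q ≤ 0)
    {s t : ℝ} (hs : 0 < s) (ht : t ∈ Ioc s 2) (x : ℝ) :
    ENNReal.ofReal (D (t, x)) +
      duh (fun q => ‖w q‖ₑ) s (fun q => ENNReal.ofReal (D q)) t x = evol D s t x := by
  have hpos : ∀ t ∈ Ioc (0 : ℝ) 2, ∀ x, 0 ≤ D (t, x) := fun t ht x => hD.nonneg hw ht x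
  have h1 : s ∈ Ioc (0 : ℝ) 2 := ⟨hs, ht.1.le.trans ht.2⟩
  rw [← heatSup_restartSource_dirac hD.meas hs]
  exact (hD.restart hw le_rfl h1 (hpos s h1)).ofReal_add_duh hw hneg
    (fun t ht x => hpos t ⟨hs.trans ht.1, ht.2⟩ x) ht x

lemma MildFrom.ofReal_le_hk {w : ℝ × ℝ → ℝ} {D : ℝ × ℝ → ℝ}
    (hD : MildFrom 0 w (Measure.dirac (0, 0)) D) {S : ℝ} (hw : SqBound w S) (hneg : ∀ q, w q ≤ 0)
    {t : ℝ} (ht : t ∈ Ioc (0 : ℝ) 2) (x : ℝ) : ENNReal.ofReal (D (t, x)) ≤ hk t x := by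
  have := hD.ofReal_add_duh hw hneg (fun t ht x => hD.nonneg hw ht x) ht x
  rw [heatSup_dirac] at this
  rw [← this]
  exact le_self_add

lemma evol_le_hk {D : ℝ × ℝ → ℝ} {s : ℝ} (hs : 0 < s)
    (hD : ∀ z, ENNReal.ofReal (D (s, z)) ≤ hk s z) {t : ℝ} (ht : s < t) (x : ℝ) :
    evol D s t x ≤ hk t x := by
  calc evol D s t x ≤ ∫⁻ z, hk (t - s) (x - z) * hk s (z - 0) := by
        apply lintegral_mono
        intro z
        simp only [sub_zero]
        gcongr
        exact hD z
    _ = hk t x := by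
        rw [lintegral_hk_mul_hk (sub_pos.2 ht) hs]
        simp

/-- Let `g(s)` be the value at `(2, 0)` when the killing stops at time `s`. Then `g` decreases at a
rate at least `n (g - η)`, where `η` bounds the contribution of bridges outside the box. Over a time
`1/n` this gives `2 g(s + 1/n) ≤ g(s) + η`, and `n` such steps fit into the time interval. -/
lemma boxPotential_decay {n : ℕ} (hn : 2 ≤ n) {R : ℝ} (hR : 0 ≤ R) {D : ℝ × ℝ → ℝ}
    (hD : MildFrom 0 (boxPotential (-n) R) (Measure.dirac (0, 0)) D) :
    D (2, 0) ≤ 1 / 2 * Real.exp (-(R ^ 2) / 2) + (1 / 2) ^ n * (1 / 3) := by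
  have hw := sqBound_boxPotential (-n) hR
  have hDm := hD.meas
  have hwm := hw.meas
  have hneg : ∀ q, boxPotential (-n) R q ≤ 0 := by
    intro q
    simp only [boxPotential, indicator]
    split_ifs <;> simp
  have hn0 : (0 : ℝ) < n := by positivity
  set W : ℝ × ℝ → ℝ≥0∞ := fun q => ‖boxPotential (-n) R q‖ₑ with hW
  have hWm : Measurable W := hwm.enorm
  set E : ℝ × ℝ → ℝ≥0∞ := fun q => ENNReal.ofReal (D q) with hE
  have hEm : Measurable E := by fun_prop
  set η := 1 / 2 * Real.exp (-(R ^ 2) / 2) with hη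
  have hη0 : 0 ≤ η := by positivity
  have hEp : ∀ r ∈ Ioo (0 : ℝ) 2, ∀ z, E (r, z) ≤ hk r z := fun r hr z =>
    hD.ofReal_le_hk hw hneg ⟨hr.1, hr.2.le⟩ z
  have hgp : ∀ s ∈ Ioo (0 : ℝ) 2, evol D s 2 0 ≤ hk 2 0 := fun s hs =>
    evol_le_hk hs.1 (hEp s hs) hs.2 0
  have hgfin : ∀ s ∈ Ioo (0 : ℝ) 2, evol D s 2 0 ≠ ∞ := fun s hs =>
    ((hgp s hs).trans_lt (hk_lt_top _ _)).ne
  have hid : ∀ s ∈ Ioo (0 : ℝ) 2, ENNReal.ofReal (D (2, 0)) + duh W s E 2 0 = evol D s 2 0 :=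
    fun s hs => hD.ofReal_add_duh_evol hw hneg hs.1 ⟨hs.2, le_rfl⟩ 0
  have hsplit : ∀ s ∈ Ioo (0 : ℝ) 2, ∀ s' ∈ Ioo s 2, evol D s 2 0 = evol D s' 2 0 +
      ∫⁻ q in Ioc s s' ×ˢ univ, hk (2 - q.1) (0 - q.2) * W q * E q := by
    intro s hs s' hs'
    rw [← hid s hs, ← hid s' ⟨hs.1.trans hs'.1, hs'.2⟩, add_assoc]
    congr 1
    unfold duh
    rw [add_comm, ← lintegral_union (measurableSet_Ioi.prod MeasurableSet.univ), ← union_prod,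
      Ioc_union_Ioi_eq_Ioi hs'.1.le]
    rw [Set.disjoint_left]
    rintro q ⟨h1, -⟩ ⟨h2, -⟩
    exact absurd h1.2 (not_le.2 h2)
  have hanti : ∀ s ∈ Ioo (0 : ℝ) 2, ∀ s' ∈ Ico s 2, evol D s' 2 0 ≤ evol D s 2 0 := by
    intro s hs s' hs'
    rcases hs'.1.eq_or_lt with h | h
    · rw [h]
    · rw [hsplit s hs s' ⟨h, hs'.2⟩]
      exact le_self_add
  -- Inside the box the mass is killed at rate `n`; outside, `E` is bounded by the free kernel and
  -- the bridge tail estimate applies.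
  have hslice : ∀ r ∈ Ioo (0 : ℝ) 2, (n : ℝ≥0∞) * evol D r 2 0 ≤
      (∫⁻ z, hk (2 - r) (0 - z) * W (r, z) * E (r, z)) + n * ENNReal.ofReal η := by
    intro r hr
    have h1 : (∫⁻ z, hk (2 - r) (0 - z) * W (r, z) * E (r, z)) =
        n * ∫⁻ z in Icc (-R) R, hk (2 - r) (0 - z) * E (r, z) := by
      rw [← lintegral_const_mul _ (by fun_prop), ← lintegral_indicator measurableSet_Icc]
      apply lintegral_congr
      intro z
      simp only [hW, boxPotential, indicator, mem_prod, hr.1.le, hr.2.le, mem_Icc, true_and, and_self]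
      split_ifs
      · rw [enorm_neg, Real.enorm_natCast]
        ring
      · simp
    rw [h1, ← mul_add]
    gcongr
    rw [evol, ← lintegral_add_compl _ measurableSet_Icc (A := Icc (-R) R)]
    gcongr
    refine le_trans (setLIntegral_mono (by fun_prop) fun z _ => ?_) (lintegral_bridge_tail_le hr hR)
    gcongr
    exact hEp r hr z
  have hhalf : ∀ s ∈ Ioo (0 : ℝ) 2, s + 1 / n < 2 →
      evol D (s + 1 / n) 2 0 + evol D (s + 1 / n) 2 0 ≤ evol D s 2 0 + ENNReal.ofReal η := by
    intro s hs hs2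
    have hlt : s < s + 1 / n := by linarith [one_div_pos.2 hn0]
    have hvol : (n : ℝ≥0∞) * volume (Ioc s (s + 1 / n)) = 1 := by
      rw [Real.volume_Ioc, add_sub_cancel_left, ← ENNReal.ofReal_natCast,
        ← ENNReal.ofReal_mul hn0.le, mul_one_div_cancel hn0.ne', ENNReal.ofReal_one]
    have h1 : evol D (s + 1 / n) 2 0 ≤
        (∫⁻ q in Ioc s (s + 1 / n) ×ˢ univ, hk (2 - q.1) (0 - q.2) * W q * E q) +
          ENNReal.ofReal η := by
      calc evol D (s + 1 / n) 2 0
          = ∫⁻ r in Ioc s (s + 1 / n), n * evol D (s + 1 / n) 2 0 := by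
            rw [setLIntegral_const, mul_right_comm, hvol, one_mul]
        _ ≤ ∫⁻ r in Ioc s (s + 1 / n), ((∫⁻ z, hk (2 - r) (0 - z) * W (r, z) * E (r, z)) +
              n * ENNReal.ofReal η) := by
            apply setLIntegral_mono'  measurableSet_Ioc
            intro r hr
            have hr' : r ∈ Ioo (0 : ℝ) 2 := ⟨hs.1.trans hr.1, hr.2.trans_lt hs2⟩
            refine le_trans ?_ (hslice r hr')
            gcongr
            exact hanti r hr' _ ⟨hr.2, hs2⟩
        _ = _ := by
            rw [lintegral_add_right _ measurable_const, setLIntegral_const, mul_right_comm, hvol,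
              one_mul, setLIntegral_prod_univ (by fun_prop)]
    rw [hsplit s hs _ ⟨hlt, hs2⟩, add_assoc]
    gcongr
  -- The times start at `1 - 1/n` and stop at `2 - 1/n`, so that all of them are strictly between
  -- `0` and `2`. The constant `η` is the fixed point of `g ↦ (g + η) / 2`.
  have hseq : ∀ j : ℕ, j ≤ n → (evol D (1 - 1 / n + j / n) 2 0).toReal ≤
      η + (1 / 2) ^ j * (1 / 3) := by
    have hs0 : ∀ j : ℕ, j ≤ n → 1 - 1 / (n : ℝ) + j / n ∈ Ioo (0 : ℝ) 2 := by
      intro j hj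
      have h2 : (2 : ℝ) ≤ n := by exact_mod_cast hn
      have hj' : (j : ℝ) ≤ n := by exact_mod_cast hj
      have h3 : 1 / (n : ℝ) ≤ 1 / 2 := by
        apply one_div_le_one_div_of_le <;> linarith
      have h4 : (j : ℝ) / n ≤ 1 := by rw [div_le_one hn0]; exact hj'
      have h5 : 0 ≤ (j : ℝ) / n := by positivity
      have h6 : 0 < 1 / (n : ℝ) := by positivity
      constructor <;> linarith
    intro j
    induction j with
    | zero =>
      intro hj
      have h1 := hs0 0 hj
      calc _ ≤ (hk 2 0).toReal := ENNReal.toReal_mono (hk_ne_top _ _) (hgp _ h1)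
        _ ≤ _ := by
          rw [toReal_hk]
          have := heatKernel_two_zero_le
          simp only [pow_zero, one_mul]
          linarith
    | succ j ih =>
      intro hj
      have ih' := ih (by omega)
      have h1 := hs0 j (by omega)
      have h2 := hs0 (j + 1) hj
      have e : 1 - 1 / (n : ℝ) + ((j + 1 : ℕ) : ℝ) / n = 1 - 1 / n + j / n + 1 / n := by
        push_cast; ring
      rw [e] at h2 ⊢
      have h3 := hhalf _ h1 h2.2
      have h4 := ENNReal.toReal_mono (ENNReal.add_ne_top.2 ⟨hgfin _ h1, ENNReal.ofReal_ne_top⟩) h3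
      rw [ENNReal.toReal_add (hgfin _ h2) (hgfin _ h2),
        ENNReal.toReal_add (hgfin _ h1) ENNReal.ofReal_ne_top, ENNReal.toReal_ofReal hη0] at h4
      rw [pow_succ]
      linarith
  have hfin := hseq n le_rfl
  have hs : 1 - 1 / (n : ℝ) + n / n ∈ Ioo (0 : ℝ) 2 := by
    have h2 : (2 : ℝ) ≤ n := by exact_mod_cast hn
    have h3 : 1 / (n : ℝ) ≤ 1 / 2 := by
      apply one_div_le_one_div_of_le <;> linarith
    have h6 : 0 < 1 / (n : ℝ) := by positivity
    rw [div_self hn0.ne']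
    constructor <;> linarith
  refine le_trans ?_ hfin
  have h1 : ENNReal.ofReal (D (2, 0)) ≤ evol D (1 - 1 / (n : ℝ) + n / n) 2 0 := by
    rw [← hid _ hs]
    exact le_self_add
  exact (ENNReal.ofReal_le_iff_le_toReal (hgfin _ hs)).1 h1

/-- Use the box with `R² = 2 lam` and `n = ⌈2 lam⌉`. Then `Z(2, 0) ≤ (1/2 + 1/3) exp (-lam)`, and
the squared norm `4 R n²` is at most `4 * (3/2) √lam * 9 lam²`. -/
lemma IsMinimizer.cost_le_of_two_le {w : ℝ × ℝ → ℝ} {lam : ℝ} (hw : IsMinimizer lam w)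
    (hlam : 2 ≤ lam) : 2 * cost w ≤ 54 * lam ^ 2 * Real.sqrt lam := by
  set n := ⌈2 * lam⌉₊ with hn
  have h1 : 2 * lam ≤ n := Nat.le_ceil _
  have h2 : (n : ℝ) < 2 * lam + 1 := Nat.ceil_lt_add_one (by linarith)
  have hn2 : 2 ≤ n := by
    have : (2 : ℝ) ≤ n := by linarith
    exact_mod_cast this
  have h3 : 2 * cost w ≤ 4 * Real.sqrt (2 * lam) * (-(n : ℝ)) ^ 2 := by
    refine hw.cost_le (sqBound_boxPotential _ (Real.sqrt_nonneg _)) ?_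
    intro D hD
    have h := boxPotential_decay hn2 (Real.sqrt_nonneg _) hD
    rw [Real.sq_sqrt (by linarith), show -(2 * lam) / 2 = -lam by ring] at h
    have h4 : (1 / 2 : ℝ) ^ n ≤ Real.exp (-lam) := by
      have h5 : (1 / 2 : ℝ) ≤ Real.exp (-(1 / 2)) := by
        have := Real.add_one_le_exp (-(1 / 2) : ℝ)
        linarith
      calc (1 / 2 : ℝ) ^ n ≤ Real.exp (-(1 / 2)) ^ n := by gcongr
        _ = Real.exp (-(n / 2)) := by rw [← Real.exp_nat_mul]; congr 1; ring
        _ ≤ _ := by rw [Real.exp_le_exp]; linarith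
    have h5 : Real.exp (-lam) ≤ Real.exp (-2) := by rw [Real.exp_le_exp]; linarith
    have h6 := exp_neg_two_le
    have h7 := le_heatKernel_two_zero
    have h8 := Real.exp_pos (-lam)
    rw [uIcc_comm]
    apply Icc_subset_uIcc
    constructor <;> linarith
  refine h3.trans ?_
  have h4 : Real.sqrt (2 * lam) ≤ 3 / 2 * Real.sqrt lam := by
    rw [Real.sqrt_mul (by norm_num)]
    gcongr
    rw [Real.sqrt_le_iff]
    norm_num
  have h5 : (-(n : ℝ)) ^ 2 ≤ 9 * lam ^ 2 := by nlinarith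
  calc 4 * Real.sqrt (2 * lam) * (-(n : ℝ)) ^ 2
      ≤ 4 * (3 / 2 * Real.sqrt lam) * (9 * lam ^ 2) := by gcongr
    _ = _ := by ring

/-- One fixed potential serves for each side of `p(2, 0)`. For targets below it, a negative box
potential brings `Z(2, 0)` under `exp (-2)`; for targets above it, a positive one brings `Z(2, 0)`
over `1`. -/
lemma exists_cost_le_of_lt_two : ∃ K : ℝ, 0 ≤ K ∧ ∀ lam : ℝ, 0 < lam → lam ≤ 2 →
    ∀ w, IsMinimizer lam w → 2 * cost w ≤ K := by
  have hb := sqBound_boxPotential 1 zero_le_one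
  -- `m` is the first-order term of the perturbation series at `(2, 0)` for the unit box. For the
  -- potential `1/m` on the box that term equals `1`, and positivity bounds the solution below by
  -- it.
  obtain ⟨m, hm0, hm⟩ : ∃ m : ℝ, 0 < m ∧ m = ∫ q in Ioi (0 : ℝ) ×ˢ univ,
      heatKernel (2 - q.1) (0 - q.2) * boxPotential 1 1 q * heatKernel q.1 q.2 := by
    refine ⟨_, ?_, rfl⟩
    have hbn : ∀ q, 0 ≤ boxPotential 1 1 q := by
      intro q
      simp only [boxPotential, indicator]
      split_ifs <;> simp
    rw [integral_pos_iff_support_of_nonneg]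
    · rw [Measure.restrict_apply' (measurableSet_Ioi.prod MeasurableSet.univ)]
      have hsub : Ioo (0 : ℝ) 2 ×ˢ Icc (-1 : ℝ) 1 ⊆ (Function.support fun q : ℝ × ℝ =>
          heatKernel (2 - q.1) (0 - q.2) * boxPotential 1 1 q * heatKernel q.1 q.2) ∩
          Ioi 0 ×ˢ univ := by
        rintro q ⟨h1, h2⟩
        refine ⟨?_, h1.1, trivial⟩
        rw [Function.mem_support]
        have e : boxPotential 1 1 q = 1 := indicator_of_mem (s := Icc (0 : ℝ) 2 ×ˢ Icc (-1 : ℝ) 1)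
          ⟨⟨h1.1.le, h1.2.le⟩, h2⟩ _
        rw [e]
        have := heatKernel_pos (sub_pos.2 h1.2) (0 - q.2)
        have := heatKernel_pos h1.1 q.2
        positivity
      refine lt_of_lt_of_le ?_ (measure_mono hsub)
      rw [Measure.volume_eq_prod, Measure.prod_prod]
      simp
    · intro q
      exact mul_nonneg (mul_nonneg (heatKernel_nonneg _ _) (hbn q)) (heatKernel_nonneg _ _)
    · exact integrableOn_duhamel hb (D := fun q => heatKernel q.1 q.2) measurable_heatKernel
        (C := 1) zero_le_one (fun r hr z => by
          rw [one_mul, abs_of_nonneg (heatKernel_nonneg _ _)]) 0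
  refine ⟨max (4 * Real.sqrt (2 * 2) * (-((4 : ℕ) : ℝ)) ^ 2) (4 * 1 * (1 / m) ^ 2), by positivity, ?_⟩
  intro lam hlam0 hlam2 w hw
  rcases le_total (Real.exp (-lam)) (heatKernel 2 0) with hc | hc
  · refine le_trans ?_ (le_max_left _ _)
    refine hw.cost_le (sqBound_boxPotential _ (Real.sqrt_nonneg _)) ?_
    intro D hD
    have h := boxPotential_decay (by norm_num) (Real.sqrt_nonneg _) hD
    rw [Real.sq_sqrt (by norm_num), show -(2 * 2 : ℝ) / 2 = -2 by norm_num] at h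
    have h4 : (1 / 2 : ℝ) ^ 4 ≤ Real.exp (-2) := by
      have h5 : (1 / 2 : ℝ) ≤ Real.exp (-(1 / 2)) := by
        have := Real.add_one_le_exp (-(1 / 2) : ℝ)
        linarith
      calc (1 / 2 : ℝ) ^ 4 ≤ Real.exp (-(1 / 2)) ^ 4 := by gcongr
        _ = _ := by rw [← Real.exp_nat_mul]; norm_num
    have h5 : Real.exp (-2) ≤ Real.exp (-lam) := by rw [Real.exp_le_exp]; linarith
    have h8 := Real.exp_pos (-2)
    rw [uIcc_comm]
    apply Icc_subset_uIcc
    constructor <;> linarith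
  · refine le_trans ?_ (le_max_right _ _)
    have hbm := sqBound_boxPotential (1 / m) zero_le_one
    refine hw.cost_le hbm ?_
    intro D hD
    apply Icc_subset_uIcc
    refine ⟨hc, ?_⟩
    have hlt : Real.exp (-lam) ≤ 1 := by rw [Real.exp_le_one_iff]; linarith
    refine hlt.trans ?_
    have hDm := hD.meas
    obtain ⟨C, hC, hbd⟩ := hD.bound
    have hbn : ∀ q, 0 ≤ boxPotential (1 / m) 1 q := by
      intro q
      simp only [boxPotential, indicator]
      split_ifs <;> positivity
    have hDi : ∀ t ∈ Ioc (0 : ℝ) 2, ∀ x, D (t, x) = heatKernel t x + ∫ q in Ioi (0 : ℝ) ×ˢ univ,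
        heatKernel (t - q.1) (x - q.2) * boxPotential (1 / m) 1 q * D q := by
      intro t ht x
      rw [hD.duhamel t ht x, heatSup_dirac, toReal_hk]
    have hpos : ∀ t ∈ Ioc (0 : ℝ) 2, ∀ x, heatKernel t x ≤ D (t, x) := by
      intro t ht x
      rw [hDi t ht x, le_add_iff_nonneg_right]
      apply setIntegral_nonneg (measurableSet_Ioi.prod MeasurableSet.univ)
      intro q hq
      rcases lt_or_ge q.1 t with h | h
      · exact mul_nonneg (mul_nonneg (heatKernel_nonneg _ _) (hbn q))
          (hD.nonneg hbm ⟨hq.1, h.le.trans ht.2⟩ q.2)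
      · simp [heatKernel_of_nonpos (sub_nonpos.2 h)]
    have hge : ∫ q in Ioi (0 : ℝ) ×ˢ univ,
        heatKernel (2 - q.1) (0 - q.2) * boxPotential (1 / m) 1 q * heatKernel q.1 q.2 ≤
        ∫ q in Ioi (0 : ℝ) ×ˢ univ,
        heatKernel (2 - q.1) (0 - q.2) * boxPotential (1 / m) 1 q * D q := by
      apply setIntegral_mono_on
      · exact integrableOn_duhamel hbm (D := fun q => heatKernel q.1 q.2) measurable_heatKernel
          (C := 1) zero_le_one (fun r hr z => by
          rw [one_mul, abs_of_nonneg (heatKernel_nonneg _ _)]) 0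
      · exact integrableOn_duhamel hbm hDm hC (fun r hr z => hbd r ⟨hr.1, hr.2.le⟩ z) 0
      · exact measurableSet_Ioi.prod MeasurableSet.univ
      · intro q hq
        rcases lt_or_ge q.1 2 with h | h
        · exact mul_le_mul_of_nonneg_left (hpos q.1 ⟨hq.1, h.le⟩ q.2)
            (mul_nonneg (heatKernel_nonneg _ _) (hbn q))
        · simp [heatKernel_of_nonpos (sub_nonpos.2 h)]
    have hscale : ∫ q in Ioi (0 : ℝ) ×ˢ univ,
        heatKernel (2 - q.1) (0 - q.2) * boxPotential (1 / m) 1 q * heatKernel q.1 q.2 = 1 := by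
      have e : ∀ q : ℝ × ℝ,
          heatKernel (2 - q.1) (0 - q.2) * boxPotential (1 / m) 1 q * heatKernel q.1 q.2 =
          1 / m * (heatKernel (2 - q.1) (0 - q.2) * boxPotential 1 1 q * heatKernel q.1 q.2) := by
        intro q
        simp only [boxPotential, indicator]
        split_ifs
        · ring
        · simp
      simp_rw [e]
      rw [integral_const_mul, ← hm]
      field_simp
    rw [hDi 2 ⟨by norm_num, le_rfl⟩ 0]
    linarith [heatKernel_nonneg 2 0]

/-! ### Jensen's inequality and a Harnack inequality for the heat semigroup -/

/-- Jensen's inequality for the exponential. -/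
lemma ofReal_exp_integral_le {α : Type*} [MeasurableSpace α] {μ : Measure α} [IsProbabilityMeasure μ]
    {g : α → ℝ} (hg : Integrable g μ) :
    ENNReal.ofReal (Real.exp (∫ a, g a ∂μ)) ≤ ∫⁻ a, ENNReal.ofReal (Real.exp (g a)) ∂μ := by
  set m := ∫ a, g a ∂μ with hm
  -- The tangent line at the mean suffices, so `exp g` need not be integrable.
  have hpt : ∀ a, Real.exp m * (1 + g a - m) ≤ Real.exp (g a) := by
    intro a
    have h1 := Real.add_one_le_exp (g a - m)
    have h2 : Real.exp (g a) = Real.exp m * Real.exp (g a - m) := by rw [← Real.exp_add]; ring_nf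
    rw [h2]
    gcongr
    linarith
  have hint : Integrable (fun a => Real.exp m * (1 + g a - m)) μ :=
    (((integrable_const 1).add hg).sub (integrable_const m)).const_mul _
  have hval : ∫ a, Real.exp m * (1 + g a - m) ∂μ = Real.exp m := by
    have h1 : Integrable (fun a => 1 + g a) μ := (integrable_const 1).add hg
    rw [integral_const_mul, integral_sub h1 (integrable_const m),
      integral_add (integrable_const 1) hg, ← hm]
    simp
  calc ENNReal.ofReal (Real.exp m) = ENNReal.ofReal (∫ a, Real.exp m * (1 + g a - m) ∂μ) := by
        rw [hval]
    _ ≤ ENNReal.ofReal (∫ a, max (Real.exp m * (1 + g a - m)) 0 ∂μ) := by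
        apply ENNReal.ofReal_le_ofReal
        exact integral_mono hint hint.pos_part fun a => le_max_left _ _
    _ = ∫⁻ a, ENNReal.ofReal (max (Real.exp m * (1 + g a - m)) 0) ∂μ :=
        ofReal_integral_eq_lintegral_ofReal hint.pos_part
          (Filter.Eventually.of_forall fun a => le_max_right _ _)
    _ ≤ _ := by
        apply lintegral_mono
        intro a
        apply ENNReal.ofReal_le_ofReal
        exact max_le (hpt a) (Real.exp_pos _).le

lemma lintegral_abs_mul_hk_lt_top {τ : ℝ} (hτ : 0 < τ) (x : ℝ) :
    ∫⁻ y, hk τ (x - y) * ENNReal.ofReal |x - y| < ∞ := by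
  have hi : Integrable (fun y : ℝ => y) (ProbabilityTheory.gaussianReal x ⟨τ, hτ.le⟩) := by
    have := ProbabilityTheory.memLp_id_gaussianReal (μ := x) (v := ⟨τ, hτ.le⟩) 1
    exact memLp_one_iff_integrable.1 this
  have hv : (⟨τ, hτ.le⟩ : ℝ≥0) ≠ 0 := fun h => hτ.ne' (congrArg Subtype.val h)
  have hp : IsProbabilityMeasure (ProbabilityTheory.gaussianReal x ⟨τ, hτ.le⟩) :=
    ProbabilityTheory.instIsProbabilityMeasureGaussianReal _ _
  have h2 := ((integrable_const x).sub hi).2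
  rw [HasFiniteIntegral, ProbabilityTheory.gaussianReal_of_var_ne_zero _ hv,
    lintegral_withDensity_eq_lintegral_mul _ (by fun_prop) (by fun_prop)] at h2
  refine lt_of_le_of_lt (le_of_eq ?_) h2
  apply lintegral_congr
  intro y
  simp only [Pi.mul_apply]
  rw [← hk_eq_gaussianPDF hτ.le, hk_sub_comm, ← ofReal_norm]
  rfl

/-- Exponential tilting of a Gaussian is a shift; this evaluates exponential moments and also moves
the base point `x` to `x'`. -/
lemma hk_mul_exp {τ : ℝ} (hτ : 0 < τ) (u s : ℝ) :
    hk τ u * ENNReal.ofReal (Real.exp (s * u)) =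
      ENNReal.ofReal (Real.exp (s ^ 2 * τ / 2)) * hk τ (u - s * τ) := by
  simp only [hk]
  rw [← ENNReal.ofReal_mul (heatKernel_nonneg _ _), ← ENNReal.ofReal_mul (Real.exp_pos _).le]
  congr 1
  simp only [heatKernel]
  rw [mul_assoc, mul_left_comm (Real.exp _), ← Real.exp_add, ← Real.exp_add]
  congr 2
  field_simp
  ring

/-- A dimension-free Harnack inequality for the heat semigroup on bounded functions. -/
lemma log_heat_sub_log_heat_le {τ : ℝ} (hτ : 0 < τ) {f : ℝ → ℝ≥0∞} (hf : Measurable f) {M : ℝ}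
    (hM : 0 < M) (hfM : ∀ y, f y ≤ ENNReal.ofReal M) {ε : ℝ} (hε : 0 < ε) (x x' : ℝ)
    (h0 : ∫⁻ y, hk τ (x - y) * f y ≠ 0) :
    Real.log (∫⁻ y, hk τ (x - y) * f y).toReal - Real.log (∫⁻ y, hk τ (x' - y) * f y).toReal ≤
      ε * (Real.log M - Real.log (∫⁻ y, hk τ (x - y) * f y).toReal) +
        ((x - x') ^ 2 / (2 * τ) + (x - x') ^ 2 / (2 * τ * ε)) := by
  have hPfin : ∀ x, ∫⁻ y, hk τ (x - y) * f y ≤ ENNReal.ofReal M := by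
    intro x
    calc _ ≤ ∫⁻ y, hk τ (y - x) * ENNReal.ofReal M := by
          apply lintegral_mono
          intro y
          dsimp only
          rw [hk_sub_comm]
          gcongr
          exact hfM y
      _ = _ := by
          rw [lintegral_mul_const' _ _ ENNReal.ofReal_ne_top, lintegral_hk hτ, one_mul]
  set P := ∫⁻ y, hk τ (x - y) * f y with hP
  have hPtop : P ≠ ∞ := ((hPfin x).trans_lt ENNReal.ofReal_lt_top).ne
  set P' := ∫⁻ y, hk τ (x' - y) * f y with hP'
  have hPtop' : P' ≠ ∞ := ((hPfin x').trans_lt ENNReal.ofReal_lt_top).ne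
  -- `q` is the law of the starting point given arrival at `x`; the mean displacement `m` under `q`
  -- plays the role of `-τ` times the logarithmic derivative of `P` at `x`.
  set q : Measure ℝ := volume.withDensity (fun y => P⁻¹ * (hk τ (x - y) * f y)) with hq
  have hqi : ∀ g : ℝ → ℝ≥0∞, Measurable g → ∫⁻ y, g y ∂q = P⁻¹ * ∫⁻ y, hk τ (x - y) * f y * g y := by
    intro g hg
    rw [hq, lintegral_withDensity_eq_lintegral_mul _ (by fun_prop) hg,
      ← lintegral_const_mul _ (by fun_prop)]
    simp [mul_assoc]
  have : IsProbabilityMeasure q := by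
    refine ⟨?_⟩
    have := hqi (fun _ => 1) measurable_const
    simp only [lintegral_const, one_mul, mul_one] at this
    rw [this, ← hP, ENNReal.inv_mul_cancel h0 hPtop]
  have hmom : Integrable (fun y => x - y) q := by
    refine ⟨by fun_prop, ?_⟩
    rw [HasFiniteIntegral, hqi _ (by fun_prop)]
    refine ENNReal.mul_lt_top (ENNReal.inv_lt_top.2 (pos_iff_ne_zero.2 h0)) ?_
    calc _ ≤ ∫⁻ y, ENNReal.ofReal M * (hk τ (x - y) * ENNReal.ofReal |x - y|) := by
          apply lintegral_mono
          intro y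
          dsimp only
          rw [← ofReal_norm, Real.norm_eq_abs, mul_right_comm, mul_comm]
          gcongr
          exact hfM y
      _ < ∞ := by
          rw [lintegral_const_mul' _ _ ENNReal.ofReal_ne_top]
          exact ENNReal.mul_lt_top ENNReal.ofReal_lt_top (lintegral_abs_mul_hk_lt_top hτ x)
  set m := ∫ y, (x - y) ∂q with hm
  have hexp : ∀ s : ℝ, ENNReal.ofReal (Real.exp (s * m)) ≤
      P⁻¹ * ∫⁻ y, hk τ (x - y) * f y * ENNReal.ofReal (Real.exp (s * (x - y))) := by
    intro s
    rw [← hqi _ (by fun_prop), hm, ← integral_const_mul]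
    exact ofReal_exp_integral_le (hmom.const_mul s)
  have hPr : 0 < P.toReal := ENNReal.toReal_pos h0 hPtop
  -- The bound `f ≤ M` controls the exponential moments of the displacement by Gaussian ones, and
  -- Jensen's inequality then bounds its mean.
  have hmgf : ∀ s : ℝ, s * m ≤ Real.log M - Real.log P.toReal + s ^ 2 * τ / 2 := by
    intro s
    have h1 : ENNReal.ofReal (Real.exp (s * m)) ≤
        P⁻¹ * (ENNReal.ofReal M * ENNReal.ofReal (Real.exp (s ^ 2 * τ / 2))) := by
      refine (hexp s).trans ?_
      gcongr
      calc _ ≤ ∫⁻ y, ENNReal.ofReal M * (ENNReal.ofReal (Real.exp (s ^ 2 * τ / 2)) *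
            hk τ (y - (x - s * τ))) := by
            apply lintegral_mono
            intro y
            dsimp only
            rw [hk_sub_comm τ y, show x - s * τ - y = x - y - s * τ by ring, ← hk_mul_exp hτ,
              mul_comm (hk τ (x - y)) (f y), mul_assoc]
            gcongr
            exact hfM y
        _ = _ := by
            rw [lintegral_const_mul' _ _ ENNReal.ofReal_ne_top,
              lintegral_const_mul' _ _ ENNReal.ofReal_ne_top, lintegral_hk hτ, mul_one]
    rw [← ENNReal.ofReal_toReal hPtop, ← ENNReal.ofReal_inv_of_pos hPr,
      ← ENNReal.ofReal_mul hM.le, ← ENNReal.ofReal_mul (by positivity)] at h1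
    have h2 := (ENNReal.ofReal_le_ofReal_iff (by positivity)).1 h1
    have h3 := Real.log_le_log (Real.exp_pos _) h2
    rw [Real.log_exp, Real.log_mul (by positivity) (by positivity),
      Real.log_mul (by positivity) (by positivity), Real.log_inv, Real.log_exp] at h3
    linarith
  -- `P'/P` is an exponential moment under `q` up to the factor `exp (-(x' - x)² / (2τ))`; Jensen's
  -- inequality bounds it below.
  have hlow : Real.log P.toReal - (x' - x) ^ 2 / (2 * τ) - (x' - x) / τ * m ≤
      Real.log P'.toReal := by
    have h1 : ENNReal.ofReal (Real.exp (-((x' - x) / τ) * m)) ≤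
        P⁻¹ * (ENNReal.ofReal (Real.exp ((x' - x) ^ 2 / (2 * τ))) * P') := by
      refine (hexp _).trans (le_of_eq ?_)
      congr 1
      rw [hP', ← lintegral_const_mul _ (by fun_prop)]
      apply lintegral_congr
      intro y
      rw [mul_right_comm, hk_mul_exp hτ]
      have e1 : x - y - -((x' - x) / τ) * τ = x' - y := by field_simp; ring
      have e2 : (-((x' - x) / τ)) ^ 2 * τ / 2 = (x' - x) ^ 2 / (2 * τ) := by field_simp
      rw [e1, e2, mul_assoc]
    rw [← ENNReal.ofReal_toReal hPtop, ← ENNReal.ofReal_inv_of_pos hPr,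
      ← ENNReal.ofReal_toReal hPtop',
      ← ENNReal.ofReal_mul (by positivity), ← ENNReal.ofReal_mul (by positivity)] at h1
    have h2 := (ENNReal.ofReal_le_ofReal_iff (by positivity)).1 h1
    have hP'r : 0 < P'.toReal := by
      rcases (ENNReal.toReal_nonneg (a := P')).eq_or_lt with h | h
      · rw [← h] at h2
        have := Real.exp_pos (-((x' - x) / τ) * m)
        simp only [mul_zero] at h2
        linarith
      · exact h
    have h3 := Real.log_le_log (Real.exp_pos _) h2
    rw [Real.log_exp, Real.log_mul (by positivity) (by positivity),
      Real.log_mul (by positivity) (by positivity), Real.log_inv, Real.log_exp] at h3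
    linarith
  -- The moment bound at this `s`, multiplied by `ε`, controls the linear term of `hlow` at the
  -- price of `ε (log M - log P)`.
  have h1 := hmgf ((x' - x) / (ε * τ))
  have h2 : (x' - x) / τ * m = ε * ((x' - x) / (ε * τ) * m) := by field_simp
  have h3 : ε * (((x' - x) / (ε * τ)) ^ 2 * τ / 2) = (x - x') ^ 2 / (2 * τ * ε) := by
    field_simp; ring
  have h4 : (x' - x) ^ 2 = (x - x') ^ 2 := by ring
  rw [h2, h4] at hlow
  have h5 := mul_le_mul_of_nonneg_left h1 hε.le
  rw [mul_add, h3] at h5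
  linarith

/-- A function that is close to a heat evolution in the logarithm inherits its modulus of
continuity. -/
lemma abs_log_sub_log_le {τ : ℝ} (hτ : 0 < τ) {f : ℝ → ℝ≥0∞} (hf : Measurable f) {M : ℝ}
    (hM : 0 < M) (hfM : ∀ y, f y ≤ ENNReal.ofReal M) {ε : ℝ} (hε : 0 < ε) {x x' E B u u' : ℝ}
    (h0 : ∫⁻ y, hk τ (x - y) * f y ≠ 0) (h0' : ∫⁻ y, hk τ (x' - y) * f y ≠ 0)
    (hu : |Real.log u - Real.log (∫⁻ y, hk τ (x - y) * f y).toReal| ≤ E)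
    (hu' : |Real.log u' - Real.log (∫⁻ y, hk τ (x' - y) * f y).toReal| ≤ E)
    (hB : Real.log M - Real.log (∫⁻ y, hk τ (x - y) * f y).toReal ≤ B)
    (hB' : Real.log M - Real.log (∫⁻ y, hk τ (x' - y) * f y).toReal ≤ B) :
    |Real.log u - Real.log u'| ≤
      2 * E + ε * B + ((x - x') ^ 2 / (2 * τ) + (x - x') ^ 2 / (2 * τ * ε)) := by
  have h1 := log_heat_sub_log_heat_le hτ hf hM hfM hε x x' h0
  have h2 := log_heat_sub_log_heat_le hτ hf hM hfM hε x' x h0'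
  rw [show (x' - x) ^ 2 = (x - x') ^ 2 by ring] at h2
  have h3 := mul_le_mul_of_nonneg_left hB hε.le
  have h4 := mul_le_mul_of_nonneg_left hB' hε.le
  rw [abs_le] at hu hu' ⊢
  constructor <;> linarith

/-! ### Perturbative comparison with the free evolution -/

lemma MildFrom.abs_sub_evol_le {w : ℝ × ℝ → ℝ} {D : ℝ × ℝ → ℝ}
    (hD : MildFrom 0 w (Measure.dirac (0, 0)) D) {S : ℝ} (hw : SqBound w S) {θ : ℝ} (hθ : 0 < θ)
    {s t : ℝ} (hs : 0 < s) (ht : t ∈ Ioc s 2) (hg : gain S θ (t - s) ≤ 1 / 4) (x : ℝ) :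
    |D (t, x) - (evol D s t x).toReal| ≤ 2 * gain S θ (t - s) * (evol D s t x).toReal := by
  have h1 : s ∈ Ioc (0 : ℝ) 2 := ⟨hs, ht.1.le.trans ht.2⟩
  have := (hD.restart hw le_rfl h1 (fun z => hD.nonneg hw h1 z)).enorm_sub_le hw hθ ht.2
    (by linarith) ⟨ht.1, le_rfl⟩ x
  rwa [heatSup_restartSource_dirac hD.meas hs] at this

lemma evol_ge {D : ℝ × ℝ → ℝ} {s c : ℝ} (hs : 0 < s) (hc : 0 ≤ c)
    (hD : ∀ z, c * heatKernel s z ≤ D (s, z)) {t : ℝ} (ht : s < t) (x : ℝ) :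
    ENNReal.ofReal (c * heatKernel t x) ≤ evol D s t x := by
  calc ENNReal.ofReal (c * heatKernel t x)
      = ∫⁻ z, ENNReal.ofReal c * (hk (t - s) (x - z) * hk s (z - 0)) := by
        rw [lintegral_const_mul' _ _ ENNReal.ofReal_ne_top, lintegral_hk_mul_hk (sub_pos.2 ht) hs,
          ENNReal.ofReal_mul hc]
        simp [hk]
    _ ≤ evol D s t x := by
        apply lintegral_mono
        intro z
        dsimp only
        rw [sub_zero, mul_left_comm]
        gcongr
        rw [hk, ← ENNReal.ofReal_mul hc]
        exact ENNReal.ofReal_le_ofReal (hD z)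

lemma evol_le {D : ℝ × ℝ → ℝ} {s c : ℝ} (hs : 0 < s) (hc : 0 ≤ c)
    (hD : ∀ z, D (s, z) ≤ c * heatKernel s z) {t : ℝ} (ht : s < t) (x : ℝ) :
    evol D s t x ≤ ENNReal.ofReal (c * heatKernel t x) := by
  calc evol D s t x ≤ ∫⁻ z, ENNReal.ofReal c * (hk (t - s) (x - z) * hk s (z - 0)) := by
        apply lintegral_mono
        intro z
        dsimp only
        rw [sub_zero, mul_left_comm (ENNReal.ofReal c)]
        gcongr
        rw [hk, ← ENNReal.ofReal_mul hc]
        exact ENNReal.ofReal_le_ofReal (hD z)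
    _ = _ := by
        rw [lintegral_const_mul' _ _ ENNReal.ofReal_ne_top, lintegral_hk_mul_hk (sub_pos.2 ht) hs,
          ENNReal.ofReal_mul hc]
        simp [hk]

/-- Two-sided heat kernel bounds, uniform over potentials of bounded norm. -/
lemma exists_two_sided_bound {S : ℝ} (hS : 0 ≤ S) : ∃ K : ℝ, 1 ≤ K ∧ ∀ w, SqBound w S →
    ∀ D, MildFrom 0 w (Measure.dirac (0, 0)) D → ∀ t ∈ Ioc (0 : ℝ) 2, ∀ x,
      K⁻¹ * heatKernel t x ≤ D (t, x) ∧ D (t, x) ≤ K * heatKernel t x := by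
  obtain ⟨θ, h, hθ, hh, hg⟩ := exists_gain_le (ε := 1 / 4) hS (by norm_num)
  obtain ⟨N, hN⟩ := exists_nat_ge (2 / h)
  rw [div_le_iff₀ hh] at hN
  -- Each time step of length `h` costs at most a factor `2` on either side, and `N + 1` steps cover
  -- `(0, 2]`.
  refine ⟨2 ^ (N + 1), one_le_pow₀ (by norm_num), ?_⟩
  intro w hw D hD
  have key : ∀ n : ℕ, ∀ t ∈ Ioc (0 : ℝ) 2, t ≤ (n + 1) * h → ∀ x,
      (2 ^ (n + 1))⁻¹ * heatKernel t x ≤ D (t, x) ∧ D (t, x) ≤ 2 ^ (n + 1) * heatKernel t x := by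
    intro n
    induction n with
    | zero =>
      intro t ht hth x
      have hg' : gain S θ (t - 0) ≤ 1 / 4 :=
        (gain_mono S hθ (by simpa using hth)).trans hg
      have h1 := hD.enorm_sub_le hw hθ ht.2 (by linarith) ⟨ht.1, le_rfl⟩ x
      rw [heatSup_dirac, toReal_hk] at h1
      have h3 := heatKernel_nonneg t x
      have h2 : 2 * gain S θ (t - 0) * heatKernel t x ≤ 1 / 2 * heatKernel t x := by
        gcongr
        linarith
      rw [abs_le] at h1
      norm_num
      constructor <;> linarith
    | succ n ih =>
      intro t ht hth x
      rcases le_or_gt t ((n + 1) * h) with hc | hc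
      · obtain ⟨h1, h2⟩ := ih t ht hc x
        have h3 := heatKernel_nonneg t x
        constructor
        · refine le_trans ?_ h1
          gcongr
          · norm_num
          · omega
        · refine h2.trans ?_
          gcongr
          · norm_num
          · omega
      · push_cast at hth
        have hnh : 0 ≤ (n : ℝ) * h := by positivity
        have hs : t - h ∈ Ioc (0 : ℝ) 2 := ⟨by linarith, by linarith [ht.2]⟩
        have ih' := ih (t - h) hs (by linarith)
        have hlt : t - h < t := by linarith
        have hg' : gain S θ (t - (t - h)) ≤ 1 / 4 := by rwa [sub_sub_cancel]
        have h1 := hD.abs_sub_evol_le hw hθ hs.1 ⟨hlt, ht.2⟩ hg' x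
        have hlow := evol_ge hs.1 (by positivity) (fun z => (ih' z).1) hlt x
        have hupp := evol_le hs.1 (by positivity) (fun z => (ih' z).2) hlt x
        have hk0 := heatKernel_nonneg t x
        have hfin : evol D (t - h) t x ≠ ∞ := (hupp.trans_lt ENNReal.ofReal_lt_top).ne
        have hlow' := (ENNReal.ofReal_le_iff_le_toReal hfin).1 hlow
        have hupp' := ENNReal.toReal_le_of_le_ofReal (by positivity) hupp
        set A := (evol D (t - h) t x).toReal
        have hA : 0 ≤ A := ENNReal.toReal_nonneg
        have h2 : 2 * gain S θ (t - (t - h)) * A ≤ 1 / 2 * A := by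
          gcongr
          linarith
        rw [abs_le] at h1
        rw [pow_succ 2 (n + 1), mul_inv]
        constructor <;> nlinarith
  intro t ht x
  exact key N t ht (by nlinarith [ht.2]) x

lemma MildFrom.abs_log_sub_log_evol_le {w : ℝ × ℝ → ℝ} {D : ℝ × ℝ → ℝ}
    (hD : MildFrom 0 w (Measure.dirac (0, 0)) D) {S : ℝ} (hw : SqBound w S) {θ : ℝ} (hθ : 0 < θ)
    {s t : ℝ} (hs : 0 < s) (ht : t ∈ Ioc s 2) (hg : gain S θ (t - s) ≤ 1 / 4) (x : ℝ)
    (h0 : 0 < (evol D s t x).toReal) :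
    |Real.log (D (t, x)) - Real.log (evol D s t x).toReal| ≤ 4 * gain S θ (t - s) := by
  have h1 := hD.abs_sub_evol_le hw hθ hs ht hg x
  have hg0 := gain_nonneg hw.nonneg hθ (t - s)
  set A := (evol D s t x).toReal
  set g := gain S θ (t - s)
  set u := D (t, x)
  rw [abs_le] at h1
  have hlow : A * (1 - 2 * g) ≤ u := by linarith
  have hupp : u ≤ A * (1 + 2 * g) := by linarith
  have hu : 0 < u := lt_of_lt_of_le (mul_pos h0 (by linarith)) hlow
  rw [← Real.log_div hu.ne' h0.ne', abs_le]
  constructor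
  · have h2 : 1 - 2 * g ≤ u / A := by rw [le_div_iff₀ h0]; linarith
    have h3 := Real.log_le_log (by linarith) h2
    have h4 := Real.one_sub_inv_le_log_of_pos (show 0 < 1 - 2 * g by linarith)
    -- This is where `g ≤ 1/4` is needed in full: `(1 + 4g)(1 - 2g) = 1 + 2g (1 - 4g)`.
    have h5 : (1 - 2 * g)⁻¹ ≤ 1 + 4 * g := by
      rw [inv_le_iff_one_le_mul₀ (by linarith)]
      nlinarith
    linarith
  · have h2 : u / A ≤ 1 + 2 * g := by rw [div_le_iff₀ h0]; linarith
    have h3 := Real.log_le_sub_one_of_pos (div_pos hu h0)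
    linarith

/-! ### Bridge averages and shifts along paths -/

/-- The average of `W` along the Brownian bridge from `(s, z)` to `(t, x)`. -/
def bridgeMean (W : ℝ × ℝ → ℝ≥0∞) (s z t x : ℝ) : ℝ≥0∞ :=
  duh W s (fun q => hk (q.1 - s) (q.2 - z)) t x / hk (t - s) (x - z)

lemma duh_eq_bridgeMean_mul (W : ℝ × ℝ → ℝ≥0∞) {s t : ℝ} (h : s < t) (z x : ℝ) :
    duh W s (fun q => hk (q.1 - s) (q.2 - z)) t x = hk (t - s) (x - z) * bridgeMean W s z t x := by
  rw [bridgeMean, ENNReal.mul_div_cancel (hk_ne_zero (sub_pos.2 h) _) (hk_ne_top _ _)]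

lemma bridgeMean_le {W : ℝ × ℝ → ℝ≥0∞} (hW : Measurable W) {S : ℝ} (hS : 0 ≤ S)
    (hWS : ∫⁻ q, W q ^ 2 ≤ ENNReal.ofReal S) {θ : ℝ} (hθ : 0 < θ) {s t : ℝ} (z x : ℝ) :
    bridgeMean W s z t x ≤ ENNReal.ofReal (gain S θ (t - s)) :=
  ENNReal.div_le_of_le_mul (duh_hk_le_gain hW hS hWS hθ s s t x z)

/-- The potential seen from a path that starts at `y` and follows `Ψ`. -/
def shear (W : ℝ × ℝ → ℝ≥0∞) (Ψ : ℝ → ℝ) (y : ℝ) : ℝ × ℝ → ℝ≥0∞ := fun q => W (q.1, y + q.2 + Ψ q.1)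

lemma measurable_shear {W : ℝ × ℝ → ℝ≥0∞} (hW : Measurable W) {Ψ : ℝ → ℝ} (hΨ : Measurable Ψ)
    (y : ℝ) : Measurable (shear W Ψ y) := by
  unfold shear; fun_prop

/-- Each time slice is only translated, so every bound in terms of the `L²` norm holds uniformly
over the shifts. -/
lemma lintegral_shear_sq {W : ℝ × ℝ → ℝ≥0∞} (hW : Measurable W) {Ψ : ℝ → ℝ} (hΨ : Measurable Ψ)
    (y : ℝ) : ∫⁻ q, shear W Ψ y q ^ 2 = ∫⁻ q, W q ^ 2 := by
  have := measurable_shear hW hΨ y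
  rw [Measure.volume_eq_prod, lintegral_prod _ (by fun_prop), lintegral_prod _ (by fun_prop)]
  apply lintegral_congr
  intro r
  have h : ∀ z, shear W Ψ y (r, z) ^ 2 = (fun z => W (r, z) ^ 2) (z + (y + Ψ r)) := by
    intro z
    simp only [shear]
    congr 3
    ring
  simp_rw [h]
  exact lintegral_add_right_eq_self (fun z => W (r, z) ^ 2) (y + Ψ r)

lemma measurable_bridgeMean_shear {W : ℝ × ℝ → ℝ≥0∞} (hW : Measurable W) {Ψ : ℝ → ℝ}
    (hΨ : Measurable Ψ) (s t : ℝ) {α : Type*} [MeasurableSpace α] {f g k : α → ℝ}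
    (hf : Measurable f) (hg : Measurable g) (hk : Measurable k) :
    Measurable (fun a => bridgeMean (shear W Ψ (f a)) s (g a) t (k a)) := by
  unfold bridgeMean duh shear
  refine Measurable.div ?_ (by fun_prop)
  have : Measurable (fun b : α × (ℝ × ℝ) => _root_.hk (t - b.2.1) (k b.1 - b.2.2) *
      W (b.2.1, f b.1 + b.2.2 + Ψ b.2.1) * _root_.hk (b.2.1 - s) (b.2.2 - g b.1)) := by fun_prop
  exact Measurable.lintegral_prod_right' this

lemma measurable_bridgeMean {W : ℝ × ℝ → ℝ≥0∞} (hW : Measurable W) (s t : ℝ) {α : Type*}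
    [MeasurableSpace α] {g k : α → ℝ} (hg : Measurable g) (hk : Measurable k) :
    Measurable (fun a => bridgeMean W s (g a) t (k a)) := by
  have h := measurable_bridgeMean_shear hW (measurable_const : Measurable fun _ : ℝ => (0 : ℝ)) s t
    (measurable_const : Measurable fun _ : α => (0 : ℝ)) hg hk
  have e : shear W (fun _ => 0) 0 = W := by ext q; simp [shear]
  rwa [e] at h

/-- The Cameron–Martin factor of a drift `α` over a time `a`; `α² a / 2` is its kinetic energy. -/
lemma hk_tilt {a : ℝ} (ha : 0 < a) (u α : ℝ) :
    hk a (u + α * a) = hk a u * ENNReal.ofReal (Real.exp (-(α * u) - α ^ 2 * a / 2)) := by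
  simp only [hk]
  rw [← ENNReal.ofReal_mul (heatKernel_nonneg _ _)]
  congr 1
  simp only [heatKernel]
  rw [mul_assoc (Real.sqrt _)⁻¹, ← Real.exp_add]
  congr 2
  field_simp
  ring

/-- Bridge averages are invariant under a shift along an affine path. -/
lemma bridgeMean_shear {W : ℝ × ℝ → ℝ≥0∞} (hW : Measurable W) {Ψ : ℝ → ℝ} (hΨ : Measurable Ψ)
    {s t : ℝ} (h : s < t) (c α : ℝ) (hlin : ∀ r ∈ Ioo s t, Ψ r = c + α * (r - s)) (y z x : ℝ) :
    bridgeMean (shear W Ψ y) s z t x =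
      bridgeMean W s (y + z + c) t (y + x + (c + α * (t - s))) := by
  have hts : 0 < t - s := sub_pos.2 h
  have hVm := measurable_shear hW hΨ y
  set X := y + x + (c + α * (t - s)) with hX
  set Y := y + z + c with hY
  -- The tilting factors before and after the meeting point multiply to that of the full kernel, so
  -- they cancel in the quotient defining the bridge average. The identity is cross-multiplied to
  -- avoid division.
  have key : hk (t - s) (X - Y) * duh (shear W Ψ y) s (fun q => hk (q.1 - s) (q.2 - z)) t x =
      hk (t - s) (x - z) * duh W s (fun q => hk (q.1 - s) (q.2 - Y)) t X := by
    unfold duh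
    rw [setLIntegral_Ioi_prod (t := t) _
        (fun q hq => by rw [hk_of_nonpos (sub_nonpos.2 hq)]; simp),
      setLIntegral_Ioi_prod (t := t) _
        (fun q hq => by rw [hk_of_nonpos (sub_nonpos.2 hq)]; simp),
      setLIntegral_prod_univ (by fun_prop), setLIntegral_prod_univ (by fun_prop),
      ← lintegral_const_mul' _ _ (hk_ne_top _ _), ← lintegral_const_mul' _ _ (hk_ne_top _ _)]
    apply setLIntegral_congr_fun measurableSet_Ioo
    intro r hr
    have h1 : 0 < t - r := sub_pos.2 hr.2
    have h2 : 0 < r - s := sub_pos.2 hr.1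
    beta_reduce
    rw [← lintegral_add_right_eq_self (fun ζ => hk (t - r) (X - ζ) * W (r, ζ) * hk (r - s) (ζ - Y))
      (y + Ψ r), ← lintegral_const_mul' _ _ (hk_ne_top _ _),
      ← lintegral_const_mul' _ _ (hk_ne_top _ _)]
    apply lintegral_congr
    intro ζ
    have e1 : X - (ζ + (y + Ψ r)) = x - ζ + α * (t - r) := by rw [hX, hlin r hr]; ring
    have e2 : ζ + (y + Ψ r) - Y = ζ - z + α * (r - s) := by rw [hY, hlin r hr]; ring
    have e3 : X - Y = x - z + α * (t - s) := by rw [hX, hY]; ring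
    have e4 : shear W Ψ y (r, ζ) = W (r, ζ + (y + Ψ r)) := by
      simp only [shear]; congr 2; ring
    rw [e1, e2, e3, e4, hk_tilt h1, hk_tilt h2, hk_tilt hts]
    have e5 : ENNReal.ofReal (Real.exp (-(α * (x - z)) - α ^ 2 * (t - s) / 2)) =
        ENNReal.ofReal (Real.exp (-(α * (x - ζ)) - α ^ 2 * (t - r) / 2)) *
        ENNReal.ofReal (Real.exp (-(α * (ζ - z)) - α ^ 2 * (r - s) / 2)) := by
      rw [← ENNReal.ofReal_mul (Real.exp_pos _).le, ← Real.exp_add]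
      congr 2
      ring
    rw [e5]
    ring
  rw [duh_eq_bridgeMean_mul _ h, duh_eq_bridgeMean_mul _ h, ← mul_assoc, ← mul_assoc,
    mul_comm (hk (t - s) (X - Y))] at key
  exact (ENNReal.mul_right_inj (mul_ne_zero (hk_ne_zero hts _) (hk_ne_zero hts _))
    (ENNReal.mul_ne_top (hk_ne_top _ _) (hk_ne_top _ _))).1 key

/-! ### Path lower bounds for the killed heat equation -/

/-- `E` solves the killed heat equation with killing rate `W`, started from `m` at time `t0`. -/
structure KilledFrom (W E : ℝ × ℝ → ℝ≥0∞) (t0 : ℝ) (m : Measure ℝ) : Prop where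
  eq : ∀ t ∈ Ioc t0 2, ∀ x, E (t, x) + duh W t0 E t x = ∫⁻ y, hk (t - t0) (x - y) ∂m
  fin : ∀ t ∈ Ioc t0 2, ∀ x, ∫⁻ y, hk (t - t0) (x - y) ∂m ≠ ∞

lemma exp_neg_two_mul_le {b : ℝ} (h0 : 0 ≤ b) (h1 : b ≤ 1 / 2) : Real.exp (-2 * b) ≤ 1 - b := by
  have h := Real.quadratic_le_exp_of_nonneg (show 0 ≤ 2 * b by linarith)
  rw [show -2 * b = -(2 * b) by ring, Real.exp_neg, inv_le_iff_one_le_mul₀ (Real.exp_pos _)]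
  nlinarith [mul_nonneg h0 h0, mul_nonneg (mul_nonneg h0 h0) h0]

/-- A one-step lower bound over a short time. -/
lemma KilledFrom.step {W E : ℝ × ℝ → ℝ≥0∞} (hW : Measurable W) {t0 : ℝ} {m : Measure ℝ} [SFinite m]
    (h : KilledFrom W E t0 m) {t : ℝ} (ht : t ∈ Ioc t0 2) (x : ℝ)
    (hb : ∀ y, bridgeMean W t0 y t x ≤ ENNReal.ofReal (1 / 2)) :
    ∫⁻ y, hk (t - t0) (x - y) * ENNReal.ofReal (Real.exp (-2 * (bridgeMean W t0 y t x).toReal)) ∂m ≤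
      E (t, x) := by
  have hbm : Measurable (fun y => bridgeMean W t0 y t x) :=
    measurable_bridgeMean hW t0 t measurable_id measurable_const
  have hle : ∀ r ∈ Ioo t0 t, ∀ z, E (r, z) ≤ ∫⁻ y, hk (r - t0) (z - y) ∂m := by
    intro r hr z
    rw [← h.eq r ⟨hr.1, hr.2.le.trans ht.2⟩ z]
    exact le_self_add
  -- Killing can only lower `E` below the free evolution. Inserting this in the Duhamel term bounds
  -- survival from `y` below by `1 - b`, with `b` the bridge average, and `1 - b ≥ exp (-2b)` for `b
  -- ≤ 1/2`.
  have h1 : duh W t0 E t x ≤ ∫⁻ y, hk (t - t0) (x - y) * bridgeMean W t0 y t x ∂m := by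
    calc duh W t0 E t x ≤ duh W t0 (fun q => ∫⁻ y, hk (q.1 - t0) (q.2 - y) ∂m) t x :=
          duh_mono fun r hr z => hle r hr z
      _ = ∫⁻ y, duh W t0 (fun q => hk (q.1 - t0) (q.2 - y)) t x ∂m := by
          unfold duh
          rw [lintegral_lintegral_swap (by fun_prop)]
          apply lintegral_congr
          intro q
          rw [lintegral_const_mul _ (by fun_prop)]
      _ = _ := by
          apply lintegral_congr
          intro y
          rw [duh_eq_bridgeMean_mul _ ht.1]
  have hfin : ∫⁻ y, hk (t - t0) (x - y) * bridgeMean W t0 y t x ∂m ≠ ∞ := by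
    refine (lt_of_le_of_lt ?_ (h.fin t ht x).lt_top).ne
    apply lintegral_mono
    intro y
    refine mul_le_of_le_one_right' ((hb y).trans ?_)
    rw [← ENNReal.ofReal_one]
    exact ENNReal.ofReal_le_ofReal (by norm_num)
  refine (ENNReal.add_le_add_iff_right hfin).1 ?_
  calc _ = ∫⁻ y, (hk (t - t0) (x - y) *
          ENNReal.ofReal (Real.exp (-2 * (bridgeMean W t0 y t x).toReal)) +
          hk (t - t0) (x - y) * bridgeMean W t0 y t x) ∂m := by
        rw [lintegral_add_right _ (by fun_prop)]
    _ ≤ ∫⁻ y, hk (t - t0) (x - y) ∂m := by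
        apply lintegral_mono
        intro y
        dsimp only
        rw [← mul_add]
        refine mul_le_of_le_one_right' ?_
        have hbf : bridgeMean W t0 y t x ≠ ∞ := ((hb y).trans_lt ENNReal.ofReal_lt_top).ne
        have h2 := ENNReal.toReal_le_of_le_ofReal (by norm_num) (hb y)
        have h3 := exp_neg_two_mul_le ENNReal.toReal_nonneg h2
        nth_rw 2 [← ENNReal.ofReal_toReal hbf]
        rw [← ENNReal.ofReal_add (Real.exp_pos _).le ENNReal.toReal_nonneg, ← ENNReal.ofReal_one]
        apply ENNReal.ofReal_le_ofReal
        linarith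
    _ = E (t, x) + duh W t0 E t x := (h.eq t ht x).symm
    _ ≤ _ := by gcongr

/-- Averages along a bridge split at an intermediate time. -/
lemma lintegral_bridgeMean_split {V : ℝ × ℝ → ℝ≥0∞} (hV : Measurable V) {t0 s t : ℝ} (h1 : t0 < s)
    (h2 : s < t) (x : ℝ) :
    ∫⁻ z, hk (t - s) (x - z) * hk (s - t0) (z - 0) *
      (bridgeMean V t0 0 s z + bridgeMean V s z t x) =
      hk (t - t0) (x - 0) * bridgeMean V t0 0 t x := by
  have hm1 : Measurable (fun z => bridgeMean V t0 0 s z) :=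
    measurable_bridgeMean hV t0 s measurable_const measurable_id
  have hm2 : Measurable (fun z => bridgeMean V s z t x) :=
    measurable_bridgeMean hV s t measurable_id measurable_const
  simp_rw [mul_add]
  rw [lintegral_add_left (by fun_prop)]
  have e1 : ∀ z, hk (t - s) (x - z) * hk (s - t0) (z - 0) * bridgeMean V t0 0 s z =
      hk (t - s) (x - z) * duh V t0 (fun q => hk (q.1 - t0) (q.2 - 0)) s z := by
    intro z
    rw [duh_eq_bridgeMean_mul _ h1, mul_assoc]
  have e2 : ∀ z, hk (t - s) (x - z) * hk (s - t0) (z - 0) * bridgeMean V s z t x =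
      hk (s - t0) (z - 0) * duh V s (fun q => hk (q.1 - s) (q.2 - z)) t x := by
    intro z
    rw [duh_eq_bridgeMean_mul _ h2]
    ring
  simp_rw [e1, e2]
  rw [← duh_eq_bridgeMean_mul _ (h1.trans h2)]
  unfold duh
  have hsplit : ∫⁻ q in Ioi t0 ×ˢ univ, hk (t - q.1) (x - q.2) * V q * hk (q.1 - t0) (q.2 - 0) =
      (∫⁻ q in Ioo t0 s ×ˢ univ, hk (t - q.1) (x - q.2) * V q * hk (q.1 - t0) (q.2 - 0)) +
      ∫⁻ q in Ioi s ×ˢ univ, hk (t - q.1) (x - q.2) * V q * hk (q.1 - t0) (q.2 - 0) := by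
    have hae : (Ioo t0 s ×ˢ (univ : Set ℝ)) =ᵐ[volume] (Ioc t0 s ×ˢ univ) := by
      rw [Measure.volume_eq_prod]
      exact Measure.set_prod_ae_eq Ioo_ae_eq_Ioc (Filter.EventuallyEq.refl _ _)
    rw [setLIntegral_congr hae, ← lintegral_union (measurableSet_Ioi.prod MeasurableSet.univ),
      ← union_prod, Ioc_union_Ioi_eq_Ioi h1.le]
    rw [Set.disjoint_left]
    rintro q ⟨h1, -⟩ ⟨h2, -⟩
    exact absurd h1.2 (not_le.2 h2)
  rw [hsplit]
  have hck : ∀ a b : ℝ, 0 < a → 0 < b → ∀ u v : ℝ,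
      ∫⁻ z, hk a (u - z) * hk b (z - v) = hk (a + b) (u - v) :=
    fun a b ha hb u v => lintegral_hk_mul_hk ha hb u v
  congr 1
  · have e3 : ∀ z, hk (t - s) (x - z) *
        ∫⁻ q in Ioi t0 ×ˢ univ, hk (s - q.1) (z - q.2) * V q * hk (q.1 - t0) (q.2 - 0) =
        ∫⁻ q in Ioo t0 s ×ˢ univ,
          hk (t - s) (x - z) * (hk (s - q.1) (z - q.2) * V q * hk (q.1 - t0) (q.2 - 0)) := by
      intro z
      rw [setLIntegral_Ioi_prod (t := s) _
        (fun q hq => by rw [hk_of_nonpos (sub_nonpos.2 hq)]; simp),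
        lintegral_const_mul _ (by fun_prop)]
    simp_rw [e3]
    rw [lintegral_lintegral_swap (by fun_prop)]
    apply setLIntegral_congr_fun (measurableSet_Ioo.prod MeasurableSet.univ)
    rintro q ⟨hq, -⟩
    beta_reduce
    have e4 : ∀ z, hk (t - s) (x - z) * (hk (s - q.1) (z - q.2) * V q * hk (q.1 - t0) (q.2 - 0)) =
        hk (t - s) (x - z) * hk (s - q.1) (z - q.2) * (V q * hk (q.1 - t0) (q.2 - 0)) := by
      intro z; ring
    simp_rw [e4]
    rw [lintegral_mul_const _ (by fun_prop), hck _ _ (sub_pos.2 h2) (sub_pos.2 hq.2), mul_assoc]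
    congr 2
    ring
  · have e3 : ∀ z, hk (s - t0) (z - 0) *
        ∫⁻ q in Ioi s ×ˢ univ, hk (t - q.1) (x - q.2) * V q * hk (q.1 - s) (q.2 - z) =
        ∫⁻ q in Ioi s ×ˢ univ,
          hk (s - t0) (z - 0) * (hk (t - q.1) (x - q.2) * V q * hk (q.1 - s) (q.2 - z)) := by
      intro z
      rw [lintegral_const_mul _ (by fun_prop)]
    simp_rw [e3]
    rw [lintegral_lintegral_swap (by fun_prop)]
    apply setLIntegral_congr_fun (measurableSet_Ioi.prod MeasurableSet.univ)
    rintro q ⟨hq, -⟩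
    beta_reduce
    have e4 : ∀ z, hk (s - t0) (z - 0) * (hk (t - q.1) (x - q.2) * V q * hk (q.1 - s) (q.2 - z)) =
        hk (t - q.1) (x - q.2) * V q * (hk (q.1 - s) (q.2 - z) * hk (s - t0) (z - 0)) := by
      intro z; ring
    simp_rw [e4]
    rw [lintegral_const_mul _ (by fun_prop), hck _ _ (sub_pos.2 hq) (sub_pos.2 h1)]
    congr 2
    ring

lemma nnreal_mk_ne_zero {v : ℝ} (hv : 0 < v) : (⟨v, hv.le⟩ : ℝ≥0) ≠ 0 :=
  fun h => hv.ne' (congrArg Subtype.val h)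

lemma lintegral_gaussianReal {v : ℝ} (hv : 0 < v) (c : ℝ) {g : ℝ → ℝ≥0∞} (hg : Measurable g) :
    ∫⁻ z, g z ∂(ProbabilityTheory.gaussianReal c ⟨v, hv.le⟩) = ∫⁻ z, hk v (z - c) * g z := by
  rw [ProbabilityTheory.gaussianReal_of_var_ne_zero _ (nnreal_mk_ne_zero hv),
    lintegral_withDensity_eq_lintegral_mul _ (by fun_prop) hg]
  simp_rw [hk_eq_gaussianPDF hv.le]
  rfl

/-- Jensen's inequality for one more step of a shifted Brownian bridge. -/
lemma bridge_step_jensen {V : ℝ × ℝ → ℝ≥0∞} (hV : Measurable V) {G : ℝ}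
    (hG : ∀ s z t x, s < t → t ≤ s + 2 → bridgeMean V s z t x ≤ ENNReal.ofReal G) {t0 s t : ℝ}
    (h1 : t0 < s) (h2 : s < t) (h3 : t ≤ t0 + 2) (x A c α : ℝ) :
    hk (t - t0) x * ENNReal.ofReal (Real.exp (-((A * (s - t0) + α * (t - s)) / (t - t0)) * x -
        (c + α ^ 2 * (t - s) / 2) - 2 * (bridgeMean V t0 0 t x).toReal)) ≤
    ∫⁻ z, hk (s - t0) z * ENNReal.ofReal (Real.exp (-A * z - c -
        2 * (bridgeMean V t0 0 s z).toReal)) * (hk (t - s) (x - z + α * (t - s)) *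
        ENNReal.ofReal (Real.exp (-2 * (bridgeMean V s z t x).toReal))) := by
  have hT : 0 < s - t0 := sub_pos.2 h1
  have hh : 0 < t - s := sub_pos.2 h2
  have hTh : 0 < t - t0 := by linarith
  have hsum : t - s + (s - t0) = t - t0 := by ring
  set v := (t - s) * (s - t0) / (t - t0) with hv
  have hv0 : 0 < v := by positivity
  set μ := (s - t0) / (t - t0) * x with hμ
  have hm1 : Measurable (fun z => bridgeMean V t0 0 s z) :=
    measurable_bridgeMean hV t0 s measurable_const measurable_id
  have hm2 : Measurable (fun z => bridgeMean V s z t x) :=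
    measurable_bridgeMean hV s t measurable_id measurable_const
  have hprod : ∀ z, hk (t - s) (x - z) * hk (s - t0) z = hk (t - t0) x * hk v (z - μ) := by
    intro z
    rw [hk_mul hh hT, hsum, sub_add_cancel]
  set q := ProbabilityTheory.gaussianReal μ ⟨v, hv0.le⟩ with hq
  have hqp : IsProbabilityMeasure q := ProbabilityTheory.instIsProbabilityMeasureGaussianReal _ _
  set B : ℝ → ℝ := fun z => (bridgeMean V t0 0 s z + bridgeMean V s z t x).toReal with hB
  have hf1 : ∀ z, bridgeMean V t0 0 s z ≠ ∞ := fun z =>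
    ((hG _ _ _ _ h1 (by linarith)).trans_lt ENNReal.ofReal_lt_top).ne
  have hf2 : ∀ z, bridgeMean V s z t x ≠ ∞ := fun z =>
    ((hG _ _ _ _ h2 (by linarith)).trans_lt ENNReal.ofReal_lt_top).ne
  have hBl : ∫⁻ z, bridgeMean V t0 0 s z + bridgeMean V s z t x ∂q = bridgeMean V t0 0 t x := by
    have := lintegral_bridgeMean_split hV h1 h2 x
    simp only [sub_zero] at this
    simp_rw [hprod, mul_assoc] at this
    rw [lintegral_const_mul _ (by fun_prop), ← lintegral_gaussianReal hv0 μ (by fun_prop)] at this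
    exact (ENNReal.mul_right_inj (hk_ne_zero hTh _) (hk_ne_top _ _)).1 this
  have hBfin : ∫⁻ z, bridgeMean V t0 0 s z + bridgeMean V s z t x ∂q ≠ ∞ := by
    rw [hBl]
    exact ((hG _ _ _ _ (h1.trans h2) h3).trans_lt ENNReal.ofReal_lt_top).ne
  have hBi : Integrable B q := integrable_toReal_of_lintegral_ne_top (by fun_prop) hBfin
  have hBv : ∫ z, B z ∂q = (bridgeMean V t0 0 t x).toReal := by
    rw [hB, integral_toReal (by fun_prop), hBl]
    exact Filter.Eventually.of_forall fun z => ENNReal.add_lt_top.2 ⟨(hf1 z).lt_top, (hf2 z).lt_top⟩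
  have hzi : Integrable (fun z : ℝ => z) q := by
    have := ProbabilityTheory.memLp_id_gaussianReal (μ := μ) (v := ⟨v, hv0.le⟩) 1
    exact memLp_one_iff_integrable.1 this
  have hzv : ∫ z, z ∂q = μ := ProbabilityTheory.integral_id_gaussianReal
  -- `g` collects the exponents of both pieces, as a function of the bridge position `z` at time
  -- `s`, whose law given the endpoints is `q`. Its mean has the same form for the longer bridge:
  -- the slopes average with weights given by the durations, and the killing averages add up.
  set g : ℝ → ℝ := fun z => (α - A) * z + (-c - α * x - α ^ 2 * (t - s) / 2) + (-2) * B z with hg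
  have hgi : Integrable g q :=
    ((hzi.const_mul _).add (integrable_const _)).add (hBi.const_mul _)
  have hgv : ∫ z, g z ∂q = -((A * (s - t0) + α * (t - s)) / (t - t0)) * x -
        (c + α ^ 2 * (t - s) / 2) - 2 * (bridgeMean V t0 0 t x).toReal := by
    have i1 : Integrable (fun z => (α - A) * z) q := hzi.const_mul _
    have i2 : Integrable (fun z => (α - A) * z + (-c - α * x - α ^ 2 * (t - s) / 2)) q :=
      i1.add (integrable_const _)
    simp only [hg]
    rw [integral_add i2 (hBi.const_mul _), integral_add i1 (integrable_const _),
      integral_const_mul, integral_const_mul, hzv, hBv, integral_const, hμ]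
    simp only [probReal_univ, one_smul]
    field_simp
    ring
  rw [← hgv]
  calc _ ≤ hk (t - t0) x * ∫⁻ z, ENNReal.ofReal (Real.exp (g z)) ∂q := by
        gcongr
        exact ofReal_exp_integral_le hgi
    _ = ∫⁻ z, hk (t - t0) x * (hk v (z - μ) * ENNReal.ofReal (Real.exp (g z))) := by
        rw [lintegral_gaussianReal hv0 μ (by fun_prop), lintegral_const_mul _ (by fun_prop)]
    _ ≤ _ := by
        apply lintegral_mono
        intro z
        dsimp only
        rw [← mul_assoc, ← hprod, hk_tilt hh]
        apply le_of_eq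
        have e : ENNReal.ofReal (Real.exp (g z)) =
            ENNReal.ofReal (Real.exp (-A * z - c - 2 * (bridgeMean V t0 0 s z).toReal)) *
            (ENNReal.ofReal (Real.exp (-(α * (x - z)) - α ^ 2 * (t - s) / 2)) *
            ENNReal.ofReal (Real.exp (-2 * (bridgeMean V s z t x).toReal))) := by
          rw [← ENNReal.ofReal_mul (Real.exp_pos _).le, ← ENNReal.ofReal_mul (Real.exp_pos _).le,
            ← Real.exp_add, ← Real.exp_add]
          congr 2
          simp only [hg, hB]
          rw [ENNReal.toReal_add (hf1 z) (hf2 z)]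
          ring
        rw [e]
        ring

/-- The lower bound on `E` at time `t` by paths from `y` that follow `Ψ`, up to the offset `ψ` at
time `t`, with kinetic cost `c`. -/
def PathBound (W E : ℝ × ℝ → ℝ≥0∞) (t0 : ℝ) (m : Measure ℝ) (Ψ : ℝ → ℝ) (t ψ c : ℝ) : Prop :=
  ∀ X, ∫⁻ y, hk (t - t0) (X - y - ψ) * ENNReal.ofReal (Real.exp (-(ψ / (t - t0)) * (X - y - ψ) - c -
    2 * (bridgeMean (shear W Ψ y) t0 0 t (X - y - ψ)).toReal)) ∂m ≤ E (t, X)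

/-- The one-step bound, rewritten by Cameron–Martin for a bridge following a straight path; the
bridge average is unchanged by an affine shift. -/
lemma KilledFrom.pathBound_first {W E : ℝ × ℝ → ℝ≥0∞} (hW : Measurable W) {t0 : ℝ} {m : Measure ℝ}
    [SFinite m] (h : KilledFrom W E t0 m) {t : ℝ} (ht : t ∈ Ioc t0 2)
    (hb : ∀ y x, bridgeMean W t0 y t x ≤ ENNReal.ofReal (1 / 2)) {Ψ : ℝ → ℝ} (hΨ : Measurable Ψ)
    (α : ℝ) (hlin : ∀ r ∈ Ioo t0 t, Ψ r = α * (r - t0)) :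
    PathBound W E t0 m Ψ t (α * (t - t0)) (α ^ 2 * (t - t0) / 2) := by
  have hT : 0 < t - t0 := sub_pos.2 ht.1
  intro X
  refine le_trans (le_of_eq ?_) (h.step hW ht X (fun y => hb y X))
  apply lintegral_congr
  intro y
  have h1 := bridgeMean_shear hW hΨ ht.1 0 α (fun r hr => by rw [hlin r hr, zero_add]) y 0
    (X - y - α * (t - t0))
  rw [show y + 0 + 0 = y by ring, show y + (X - y - α * (t - t0)) + (0 + α * (t - t0)) = X by ring]
    at h1
  rw [h1]
  set b := (bridgeMean W t0 y t X).toReal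
  have h2 := hk_tilt hT (X - y - α * (t - t0)) α
  rw [sub_add_cancel] at h2
  rw [h2, mul_assoc, ← ENNReal.ofReal_mul (Real.exp_pos _).le, ← Real.exp_add]
  congr 3
  field_simp
  ring

/-- The one-step bound from `s` is composed with the bound up to `s`, and Jensen's inequality merges
the two bridges into one. With slope `ψ / (s - t0)` before and `α` after, the averaged slope is the
new offset divided by the new duration, so the form of `PathBound` is preserved. -/
lemma PathBound.next {W E : ℝ × ℝ → ℝ≥0∞} (hW : Measurable W) (hE : Measurable E) {t0 : ℝ}
    {m : Measure ℝ} [SFinite m] {Ψ : ℝ → ℝ} (hΨ : Measurable Ψ) {s t ψ c : ℝ}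
    (hp : PathBound W E t0 m Ψ s ψ c) (h1 : t0 < s) (ht : t ∈ Ioc s 2) (h3 : t ≤ t0 + 2)
    (hK : KilledFrom W E s (volume.withDensity fun z => E (s, z)))
    (hb : ∀ y x, bridgeMean W s y t x ≤ ENNReal.ofReal (1 / 2)) {G : ℝ}
    (hG : ∀ y s z t x, s < t → t ≤ s + 2 → bridgeMean (shear W Ψ y) s z t x ≤ ENNReal.ofReal G)
    (α : ℝ) (hlin : ∀ r ∈ Ioo s t, Ψ r = ψ + α * (r - s)) :
    PathBound W E t0 m Ψ t (ψ + α * (t - s)) (c + α ^ 2 * (t - s) / 2) := by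
  intro X
  have hT : 0 < s - t0 := sub_pos.2 h1
  have hmW : ∀ k : ℝ → ℝ, Measurable k → Measurable (fun z => bridgeMean W s (k z) t X) :=
    fun k hk => measurable_bridgeMean hW s t hk measurable_const
  have hmV : ∀ {α : Type} [MeasurableSpace α] (f k : α → ℝ), Measurable f → Measurable k →
      Measurable (fun a => bridgeMean (shear W Ψ (f a)) t0 0 s (k a)) :=
    fun f k hf hk => measurable_bridgeMean_shear hW hΨ t0 s hf measurable_const hk
  set F : ℝ → ℝ → ℝ≥0∞ := fun y z => hk (s - t0) z * ENNReal.ofReal (Real.exp (-(ψ / (s - t0)) * z -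
    c - 2 * (bridgeMean (shear W Ψ y) t0 0 s z).toReal)) with hF
  have hFm : Measurable (fun a : ℝ × ℝ => F a.1 (a.2 - a.1 - ψ)) := by
    have := hmV (fun a : ℝ × ℝ => a.1) (fun a => a.2 - a.1 - ψ) (by fun_prop) (by fun_prop)
    simp only [hF]
    fun_prop
  set H : ℝ → ℝ≥0∞ := fun z => hk (t - s) (X - z) *
    ENNReal.ofReal (Real.exp (-2 * (bridgeMean W s z t X).toReal)) with hH
  have hHm : Measurable H := by
    have := hmW (fun z => z) measurable_id
    simp only [hH]
    fun_prop
  calc _ ≤ ∫⁻ y, (∫⁻ z, F y (z - y - ψ) * H z) ∂m := by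
        apply lintegral_mono
        intro y
        have h2 := bridge_step_jensen (measurable_shear hW hΨ y) (hG y) h1 ht.1 h3
          (X - y - (ψ + α * (t - s))) (ψ / (s - t0)) c α
        refine le_trans (le_of_eq ?_) (h2.trans (le_of_eq ?_))
        · rw [div_mul_cancel₀ _ hT.ne']
        · rw [← lintegral_sub_right_eq_self _ (y + ψ)]
          apply lintegral_congr
          intro z
          have h4 := bridgeMean_shear hW hΨ ht.1 ψ α hlin y (z - (y + ψ))
            (X - y - (ψ + α * (t - s)))
          rw [show y + (z - (y + ψ)) + ψ = z by ring,
            show y + (X - y - (ψ + α * (t - s))) + (ψ + α * (t - s)) = X by ring] at h4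
          rw [h4, show X - y - (ψ + α * (t - s)) - (z - (y + ψ)) + α * (t - s) = X - z by ring]
          simp only [hF, hH]
          rw [show z - (y + ψ) = z - y - ψ by ring]
    _ = ∫⁻ z, H z * ∫⁻ y, F y (z - y - ψ) ∂m := by
        rw [lintegral_lintegral_swap (by fun_prop)]
        apply lintegral_congr
        intro z
        rw [mul_comm, lintegral_mul_const _ (by fun_prop)]
    _ ≤ ∫⁻ z, H z * E (s, z) := by
        apply lintegral_mono
        intro z
        dsimp only
        gcongr
        exact hp z
    _ = ∫⁻ z, H z ∂(volume.withDensity fun z => E (s, z)) := by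
        rw [lintegral_withDensity_eq_lintegral_mul _ (by fun_prop) hHm]
        simp [mul_comm]
    _ ≤ E (t, X) := hK.step hW ht X (fun y => hb y X)

/-- The path bound along a piecewise affine path. -/
lemma KilledFrom.pathBound {W E : ℝ × ℝ → ℝ≥0∞} (hW : Measurable W) (hE : Measurable E) {t0 : ℝ}
    {m : Measure ℝ} [SFinite m] (h : KilledFrom W E t0 m) (ht0 : 0 ≤ t0)
    (hK : ∀ s ∈ Ioc t0 2, KilledFrom W E s (volume.withDensity fun z => E (s, z)))
    {Ψ : ℝ → ℝ} (hΨ : Measurable Ψ) {G : ℝ}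
    (hG : ∀ y s z t x, s < t → t ≤ s + 2 → bridgeMean (shear W Ψ y) s z t x ≤ ENNReal.ofReal G)
    {n : ℕ} {T ψ : ℕ → ℝ} (hT0 : T 0 = t0) (hT : ∀ i < n, T i < T (i + 1)) (hTn : ∀ i ≤ n, T i ≤ 2)
    (hψ0 : ψ 0 = 0)
    (hlin : ∀ i < n, ∀ r ∈ Ioo (T i) (T (i + 1)),
      Ψ r = ψ i + (ψ (i + 1) - ψ i) / (T (i + 1) - T i) * (r - T i))
    (hb : ∀ i < n, ∀ y x, bridgeMean W (T i) y (T (i + 1)) x ≤ ENNReal.ofReal (1 / 2)) :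
    ∀ i < n, PathBound W E t0 m Ψ (T (i + 1)) (ψ (i + 1))
      (∑ j ∈ Finset.range (i + 1), (ψ (j + 1) - ψ j) ^ 2 / (2 * (T (j + 1) - T j))) := by
  intro i
  induction i with
  | zero =>
    intro hi
    have hd : 0 < T 1 - T 0 := sub_pos.2 (hT 0 hi)
    have h1 := h.pathBound_first hW (t := T 1) ⟨hT0 ▸ hT 0 hi, hTn 1 hi⟩
      (by simpa [hT0] using hb 0 hi) hΨ ((ψ 1 - ψ 0) / (T 1 - T 0))
      (by
        intro r hr
        rw [← hT0] at hr ⊢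
        rw [hlin 0 hi r hr, hψ0]
        ring)
    rw [← hT0] at h1 ⊢
    convert h1 using 1
    · rw [hψ0]; field_simp; ring
    · simp; field_simp
  | succ i ih =>
    intro hi
    have ih' := ih (by omega)
    have hd : 0 < T (i + 1 + 1) - T (i + 1) := sub_pos.2 (hT _ hi)
    have hpos : ∀ k, k < n → t0 < T (k + 1) := by
      intro k
      induction k with
      | zero => intro hk; rw [← hT0]; exact hT 0 hk
      | succ k ihk => intro hk; exact (ihk (by omega)).trans (hT _ hk)
    have h1 := hpos i (by omega)
    have h2 := PathBound.next hW hE hΨ ih' h1 ⟨hT _ hi, hTn _ hi⟩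
      (by linarith [hTn (i + 1 + 1) hi]) (hK _ ⟨h1, hTn _ (by omega)⟩) (hb _ hi) hG
      ((ψ (i + 1 + 1) - ψ (i + 1)) / (T (i + 1 + 1) - T (i + 1))) (hlin _ hi)
    rw [Finset.sum_range_succ]
    convert h2 using 1
    · field_simp; ring
    · field_simp

/-! ### Averaging over the amplitude of the shift -/

lemma bridgeMean_eq_lintegral {V : ℝ × ℝ → ℝ≥0∞} (hV : Measurable V) {t0 t : ℝ} (h : t0 < t)
    (x : ℝ) : bridgeMean V t0 0 t x = ∫⁻ r in Ioo t0 t, ∫⁻ ζ,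
      hk ((t - r) * (r - t0) / (t - t0)) (ζ - (r - t0) / (t - t0) * x) * V (r, ζ) := by
  rw [← ENNReal.mul_right_inj (hk_ne_zero (sub_pos.2 h) (x - 0)) (hk_ne_top _ _),
    ← duh_eq_bridgeMean_mul _ h]
  unfold duh
  rw [setLIntegral_Ioi_prod (t := t) _
        (fun q hq => by rw [hk_of_nonpos (sub_nonpos.2 hq)]; simp),
    setLIntegral_prod_univ (by fun_prop), ← lintegral_const_mul' _ _ (hk_ne_top _ _)]
  apply setLIntegral_congr_fun measurableSet_Ioo
  intro r hr
  beta_reduce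
  rw [← lintegral_const_mul' _ _ (hk_ne_top _ _)]
  apply lintegral_congr
  intro ζ
  rw [mul_right_comm, hk_mul_bridge hr.1 hr.2, zero_add, mul_assoc, sub_zero]

lemma lintegral_comp_add_mul {f : ℝ → ℝ≥0∞} (hf : Measurable f) (a : ℝ) {b : ℝ} (hb : 0 < b) :
    ∫⁻ u, f (a + u * b) = ENNReal.ofReal b⁻¹ * ∫⁻ z, f z := by
  have h1 : ∫⁻ u, f (a + u * b) = ∫⁻ z, f (a + z) ∂(Measure.map (fun u => u * b) volume) := by
    rw [lintegral_map (by fun_prop) (by fun_prop)]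
  rw [h1, Real.map_volume_mul_right hb.ne', lintegral_smul_measure,
    lintegral_add_left_eq_self f a, abs_of_pos (by positivity), smul_eq_mul]

/-- The bridge average of a potential, averaged over the amplitude of the shift. -/
lemma lintegral_bridgeMean_shear_le {W : ℝ × ℝ → ℝ≥0∞} (hW : Measurable W) {S : ℝ}
    (hWS : ∫⁻ q, W q ^ 2 ≤ ENNReal.ofReal S) (hS : 0 ≤ S) {θ : ℝ} (hθ : 0 < θ) {Ψ : ℝ → ℝ}
    (hΨ : Measurable Ψ) {t0 t : ℝ} (h : t0 < t) {κ : ℝ → ℝ}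
    (hκ : ∀ᵐ r, r ∈ Ioo t0 t → bridgeSup t0 t r ≤ κ r ∨ (0 < Ψ r ∧ 1 / (2 * Ψ r) ≤ κ r)) {K : ℝ}
    (hK0 : 0 ≤ K) (hK : ∫⁻ r in Ioo t0 t, ENNReal.ofReal (κ r) ≤ ENNReal.ofReal K) (y x : ℝ) :
    ∫⁻ u in Icc (-1 : ℝ) 1, bridgeMean (shear W (fun r => u * Ψ r) y) t0 0 t x ≤
      ENNReal.ofReal (θ * S + K / θ) := by
  have e1 : ∀ u : ℝ, bridgeMean (shear W (fun r => u * Ψ r) y) t0 0 t x = ∫⁻ r in Ioo t0 t, ∫⁻ ζ,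
      hk ((t - r) * (r - t0) / (t - t0)) (ζ - (r - t0) / (t - t0) * x) *
        W (r, y + ζ + u * Ψ r) := by
    intro u
    rw [bridgeMean_eq_lintegral (measurable_shear hW (by fun_prop) y) h]
    rfl
  simp_rw [e1]
  have hm3 : Measurable (fun b : (ℝ × ℝ) × ℝ =>
      hk ((t - b.1.2) * (b.1.2 - t0) / (t - t0)) (b.2 - (b.1.2 - t0) / (t - t0) * x) *
        W (b.1.2, y + b.2 + b.1.1 * Ψ b.1.2)) := by fun_prop
  rw [lintegral_lintegral_swap (Measurable.lintegral_prod_right' hm3).aemeasurable]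
  have key : ∀ᵐ r, r ∈ Ioo t0 t → ∫⁻ u in Icc (-1 : ℝ) 1, ∫⁻ ζ,
      hk ((t - r) * (r - t0) / (t - t0)) (ζ - (r - t0) / (t - t0) * x) *
        W (r, y + ζ + u * Ψ r) ≤
      ENNReal.ofReal θ * (∫⁻ z, W (r, z) ^ 2) + ENNReal.ofReal (1 / θ) * ENNReal.ofReal (κ r) := by
    filter_upwards [hκ] with r hκr hr
    have hv : 0 < (t - r) * (r - t0) / (t - t0) := by
      have := hr.2
      have h1 : 0 < r - t0 := sub_pos.2 hr.1
      have h2 : 0 < t - r := sub_pos.2 hr.2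
      have h3 : 0 < t - t0 := by linarith
      positivity
    have hsup := inv_sqrt_bridge_le hr.1 hr.2
    have hθ1 : ENNReal.ofReal θ = ENNReal.ofReal (θ / 2) * ENNReal.ofReal 2 := by
      rw [← ENNReal.ofReal_mul (by positivity), div_mul_cancel₀ _ two_ne_zero]
    have hθ2 : ENNReal.ofReal (1 / θ) = ENNReal.ofReal (1 / (2 * θ)) * ENNReal.ofReal 2 := by
      rw [← ENNReal.ofReal_mul (by positivity)]
      congr 1
      field_simp
    set v := (t - r) * (r - t0) / (t - t0)
    set μ := (r - t0) / (t - t0) * x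
    -- Near the ends the bound is the density of the bridge itself. Elsewhere the spread of `u * Ψ
    -- r` is used, whose density is `1 / (2 * Ψ r)` when `u` is uniform.
    rcases hκr hr with hB | ⟨hΨ0, hA⟩
    · have hone : ∀ u : ℝ, ∫⁻ ζ, hk v (ζ - μ) * W (r, y + ζ + u * Ψ r) ≤
          ENNReal.ofReal (θ / 2) * (∫⁻ z, W (r, z) ^ 2) +
          ENNReal.ofReal (1 / (2 * θ)) * ENNReal.ofReal (κ r) := by
        intro u
        calc _ ≤ ∫⁻ ζ, (ENNReal.ofReal (θ / 2) * W (r, ζ + (y + u * Ψ r)) ^ 2 +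
              ENNReal.ofReal (1 / (2 * θ)) * hk v (ζ - μ) ^ 2) := by
              apply lintegral_mono
              intro ζ
              dsimp only
              rw [mul_comm, show y + ζ + u * Ψ r = ζ + (y + u * Ψ r) by ring]
              exact ENNReal.mul_le_half_sq hθ _ _
          _ ≤ _ := by
              rw [lintegral_add_left (by fun_prop), lintegral_const_mul' _ _ ENNReal.ofReal_ne_top,
                lintegral_const_mul' _ _ ENNReal.ofReal_ne_top,
                lintegral_add_right_eq_self (fun z => W (r, z) ^ 2)]
              gcongr
              exact (lintegral_hk_sq_le hv μ).trans (ENNReal.ofReal_le_ofReal (hsup.trans hB))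
      calc _ ≤ ∫⁻ u in Icc (-1 : ℝ) 1, (ENNReal.ofReal (θ / 2) * (∫⁻ z, W (r, z) ^ 2) +
          ENNReal.ofReal (1 / (2 * θ)) * ENNReal.ofReal (κ r)) := lintegral_mono fun u => hone u
        _ = _ := by
          rw [setLIntegral_const, Real.volume_Icc, show (1 : ℝ) - -1 = 2 by norm_num, hθ1, hθ2]
          ring
    · have hθ' : 0 < 2 * Ψ r * θ := by positivity
      -- Young's inequality with parameter `2 * Ψ r * θ` against the constant `1`; the factor `Ψ r`
      -- cancels the Jacobian of `u ↦ u * Ψ r` when the squares are integrated over `u`.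
      have hone : ∀ u : ℝ, ∫⁻ ζ, hk v (ζ - μ) * W (r, y + ζ + u * Ψ r) ≤
          ENNReal.ofReal (Ψ r * θ) * (∫⁻ ζ, hk v (ζ - μ) * W (r, y + ζ + u * Ψ r) ^ 2) +
          ENNReal.ofReal (1 / (2 * θ)) * ENNReal.ofReal (κ r) := by
        intro u
        calc _ ≤ ∫⁻ ζ, (ENNReal.ofReal (Ψ r * θ) * (hk v (ζ - μ) * W (r, y + ζ + u * Ψ r) ^ 2) +
              ENNReal.ofReal (1 / (2 * (2 * Ψ r * θ))) * hk v (ζ - μ)) := by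
              apply lintegral_mono
              intro ζ
              dsimp only
              have h1 := ENNReal.mul_le_half_sq hθ' (W (r, y + ζ + u * Ψ r)) 1
              rw [mul_one, one_pow, mul_one, show 2 * Ψ r * θ / 2 = Ψ r * θ by ring] at h1
              calc _ ≤ hk v (ζ - μ) * (ENNReal.ofReal (Ψ r * θ) * W (r, y + ζ + u * Ψ r) ^ 2 +
                  ENNReal.ofReal (1 / (2 * (2 * Ψ r * θ)))) := by gcongr
                _ = _ := by ring
          _ ≤ _ := by
              rw [lintegral_add_left (by fun_prop), lintegral_const_mul' _ _ ENNReal.ofReal_ne_top,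
                lintegral_const_mul' _ _ ENNReal.ofReal_ne_top, lintegral_hk hv, mul_one,
                ← ENNReal.ofReal_mul (by positivity)]
              gcongr
              calc 1 / (2 * (2 * Ψ r * θ)) = 1 / (2 * θ) * (1 / (2 * Ψ r)) := by field_simp
                _ ≤ _ := by gcongr
      have hm2 : Measurable (fun b : ℝ × ℝ => hk v (b.2 - μ) * W (r, y + b.2 + b.1 * Ψ r) ^ 2) := by
        fun_prop
      have hsq : ∫⁻ u in Icc (-1 : ℝ) 1, ∫⁻ ζ, hk v (ζ - μ) * W (r, y + ζ + u * Ψ r) ^ 2 ≤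
          ENNReal.ofReal (Ψ r)⁻¹ * ∫⁻ z, W (r, z) ^ 2 := by
        calc _ ≤ ∫⁻ u, ∫⁻ ζ, hk v (ζ - μ) * W (r, y + ζ + u * Ψ r) ^ 2 :=
              setLIntegral_le_lintegral _ _
          _ = ∫⁻ ζ, hk v (ζ - μ) * (ENNReal.ofReal (Ψ r)⁻¹ * ∫⁻ z, W (r, z) ^ 2) := by
              rw [lintegral_lintegral_swap hm2.aemeasurable]
              apply lintegral_congr
              intro ζ
              rw [lintegral_const_mul _ (by fun_prop),
                lintegral_comp_add_mul (f := fun z => W (r, z) ^ 2) (by fun_prop) _ hΨ0]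
          _ = _ := by
              rw [lintegral_mul_const _ (by fun_prop), lintegral_hk hv, one_mul]
      have hm1 : Measurable (fun u => ∫⁻ ζ, hk v (ζ - μ) * W (r, y + ζ + u * Ψ r) ^ 2) :=
        Measurable.lintegral_prod_right' hm2
      calc _ ≤ ∫⁻ u in Icc (-1 : ℝ) 1, (ENNReal.ofReal (Ψ r * θ) *
            (∫⁻ ζ, hk v (ζ - μ) * W (r, y + ζ + u * Ψ r) ^ 2) +
            ENNReal.ofReal (1 / (2 * θ)) * ENNReal.ofReal (κ r)) := lintegral_mono fun u => hone u
        _ ≤ ENNReal.ofReal (Ψ r * θ) * (ENNReal.ofReal (Ψ r)⁻¹ * ∫⁻ z, W (r, z) ^ 2) +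
            ENNReal.ofReal (1 / (2 * θ)) * ENNReal.ofReal (κ r) * ENNReal.ofReal 2 := by
          rw [lintegral_add_left (by fun_prop), lintegral_const_mul' _ _ ENNReal.ofReal_ne_top,
            setLIntegral_const, Real.volume_Icc, show (1 : ℝ) - -1 = 2 by norm_num]
          gcongr
        _ = _ := by
          rw [← mul_assoc, ← ENNReal.ofReal_mul (by positivity), hθ2,
            show Ψ r * θ * (Ψ r)⁻¹ = θ by field_simp]
          ring
  have hmsq : Measurable (fun r => ∫⁻ z, W (r, z) ^ 2) :=
    Measurable.lintegral_prod_right' (f := fun q : ℝ × ℝ => W q ^ 2) (by fun_prop)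
  calc _ ≤ ∫⁻ r in Ioo t0 t, (ENNReal.ofReal θ * (∫⁻ z, W (r, z) ^ 2) +
        ENNReal.ofReal (1 / θ) * ENNReal.ofReal (κ r)) := by
        apply lintegral_mono_ae
        rw [ae_restrict_iff' measurableSet_Ioo]
        exact key
    _ ≤ ENNReal.ofReal θ * ENNReal.ofReal S + ENNReal.ofReal (1 / θ) * ENNReal.ofReal K := by
        rw [lintegral_add_left (by fun_prop), lintegral_const_mul' _ _ ENNReal.ofReal_ne_top,
          lintegral_const_mul' _ _ ENNReal.ofReal_ne_top]
        gcongr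
        rw [← setLIntegral_prod_univ (f := fun q => W q ^ 2) (by fun_prop)]
        exact (setLIntegral_le_lintegral _ _).trans hWS
    _ = _ := by
        rw [← ENNReal.ofReal_mul (by positivity), ← ENNReal.ofReal_mul (by positivity),
          ← ENNReal.ofReal_add (by positivity) (by positivity)]
        congr 1
        ring

/-- Lower bound for the killed heat equation by a fan of paths of random amplitude. -/
lemma KilledFrom.fan {W E : ℝ × ℝ → ℝ≥0∞} (hW : Measurable W) (hE : Measurable E) {S : ℝ}
    (hWS : ∫⁻ q, W q ^ 2 ≤ ENNReal.ofReal S) (hS : 0 ≤ S) {t0 : ℝ} {m : Measure ℝ}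
    [SFinite m] (h : KilledFrom W E t0 m) (ht0 : 0 ≤ t0)
    (hK : ∀ s ∈ Ioc t0 2, KilledFrom W E s (volume.withDensity fun z => E (s, z)))
    {Ψ : ℝ → ℝ} (hΨ : Measurable Ψ) {n : ℕ} {T ψ : ℕ → ℝ} (hT0 : T 0 = t0)
    (hT : ∀ i < n + 1, T i < T (i + 1)) {t : ℝ} (hTt : T (n + 1) = t) (ht2 : t ≤ 2)
    (hψ0 : ψ 0 = 0) (hψn : ψ (n + 1) = 0)
    (hlin : ∀ i < n + 1, ∀ r ∈ Ioo (T i) (T (i + 1)),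
      Ψ r = ψ i + (ψ (i + 1) - ψ i) / (T (i + 1) - T i) * (r - T i))
    (hb : ∀ i < n + 1, ∀ y x, bridgeMean W (T i) y (T (i + 1)) x ≤ ENNReal.ofReal (1 / 2))
    {C : ℝ} (hC : ∑ j ∈ Finset.range (n + 1), (ψ (j + 1) - ψ j) ^ 2 / (2 * (T (j + 1) - T j)) ≤ C)
    {θ : ℝ} (hθ : 0 < θ) {κ : ℝ → ℝ}
    (hκ : ∀ᵐ r, r ∈ Ioo t0 t → bridgeSup t0 t r ≤ κ r ∨ (0 < Ψ r ∧ 1 / (2 * Ψ r) ≤ κ r)) {K : ℝ}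
    (hK0 : 0 ≤ K) (hKκ : ∫⁻ r in Ioo t0 t, ENNReal.ofReal (κ r) ≤ ENNReal.ofReal K) (X : ℝ) :
    (∫⁻ y, hk (t - t0) (X - y) ∂m) * ENNReal.ofReal (Real.exp (-(C + (θ * S + K / θ)))) ≤
      E (t, X) := by
  have hTle : ∀ k ≤ n, T (n + 1 - k) ≤ t := by
    intro k
    induction k with
    | zero => intro _; exact hTt.le
    | succ k ih =>
      intro hk
      have h1 := hT (n + 1 - (k + 1)) (by omega)
      rw [show n + 1 - (k + 1) + 1 = n + 1 - k by omega] at h1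
      exact h1.le.trans (ih (by omega))
  have h1t : T 1 ≤ t := by
    have := hTle n le_rfl
    rwa [show n + 1 - n = 1 by omega] at this
  have ht : t0 < t := by
    rw [← hT0]; exact (hT 0 (by omega)).trans_le h1t
  have hT2 : ∀ i ≤ n + 1, T i ≤ 2 := by
    intro i hi
    rcases Nat.eq_zero_or_pos i with h0 | h0
    · rw [h0, hT0]; linarith
    · have := hTle (n + 1 - i) (by omega)
      rw [show n + 1 - (n + 1 - i) = i by omega] at this
      linarith
  set L := θ * S + K / θ with hL
  have hL0 : 0 ≤ L := by positivity
  set P := ∫⁻ y, hk (t - t0) (X - y) ∂m with hP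
  have hPtop : P ≠ ∞ := h.fin t ⟨ht, ht2⟩ X
  by_cases hP0 : P = 0
  · rw [hP0, zero_mul]; exact zero_le
  set π : Measure ℝ := m.withDensity (fun y => P⁻¹ * hk (t - t0) (X - y)) with hπ
  have hπi : ∀ g : ℝ → ℝ≥0∞, Measurable g → ∫⁻ y, g y ∂π = P⁻¹ * ∫⁻ y, hk (t - t0) (X - y) * g y ∂m := by
    intro g hg
    rw [hπ, lintegral_withDensity_eq_lintegral_mul _ (by fun_prop) hg,
      ← lintegral_const_mul _ (by fun_prop)]
    simp [mul_assoc]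
  have hπp : IsProbabilityMeasure π := by
    refine ⟨?_⟩
    have := hπi (fun _ => 1) measurable_const
    simp only [lintegral_const, one_mul, mul_one] at this
    rw [this, ← hP, ENNReal.inv_mul_cancel hP0 hPtop]
  set b : ℝ → ℝ → ℝ≥0∞ := fun u y => bridgeMean (shear W (fun r => u * Ψ r) y) t0 0 t (X - y) with hbdef
  have hbm : Measurable (fun a : ℝ × ℝ => b a.1 a.2) := by
    simp only [hbdef, bridgeMean, duh, shear]
    refine Measurable.div ?_ (by fun_prop)
    have : Measurable (fun c : (ℝ × ℝ) × (ℝ × ℝ) => hk (t - c.2.1) (X - c.1.2 - c.2.2) *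
      W (c.2.1, c.1.2 + c.2.2 + c.1.1 * Ψ c.2.1) * hk (c.2.1 - t0) (c.2.2 - 0)) := by fun_prop
    exact Measurable.lintegral_prod_right' this
  -- A crude bound whose value is irrelevant: it only provides finiteness of the bridge averages.
  have hG : ∀ u y s z t x, s < t → t ≤ s + 2 →
      bridgeMean (shear W (fun r => u * Ψ r) y) s z t x ≤ ENNReal.ofReal (gain S 1 2) := by
    intro u y s z t x hst hts
    refine (bridgeMean_le (measurable_shear hW (by fun_prop) y) hS
      (by rw [lintegral_shear_sq hW (by fun_prop)]; exact hWS) one_pos z x).trans ?_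
    exact ENNReal.ofReal_le_ofReal (gain_mono S one_pos (by linarith))
  have hbu : ∀ u, Measurable (b u) := fun u => Measurable.of_uncurry_left (f := b) hbm
  -- The integral over an interval of length `2` is at most `L`, so some amplitude does no worse
  -- than the mean `L / 2`. The factor `2` in the path bound then restores `L`.
  obtain ⟨u, hu, hul⟩ : ∃ u ∈ Icc (-1 : ℝ) 1, ∫⁻ y, b u y ∂π ≤ ENNReal.ofReal (L / 2) := by
    by_contra hcon
    push Not at hcon
    have hbm' : Measurable (fun u => ∫⁻ y, b u y ∂π) := Measurable.lintegral_prod_right' hbm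
    have hint : ∫⁻ u in Icc (-1 : ℝ) 1, ∫⁻ y, b u y ∂π ≤ ENNReal.ofReal L := by
      rw [lintegral_lintegral_swap hbm.aemeasurable]
      calc _ ≤ ∫⁻ y, ENNReal.ofReal L ∂π := by
            apply lintegral_mono
            intro y
            exact lintegral_bridgeMean_shear_le hW hWS hS hθ hΨ ht hκ hK0 hKκ y (X - y)
        _ = _ := by simp
    have hvol : volume (Icc (-1 : ℝ) 1) = 2 := by
      rw [Real.volume_Icc, show (1 : ℝ) - -1 = 2 by norm_num]; simp
    have hlt : ∫⁻ u in Icc (-1 : ℝ) 1, ENNReal.ofReal (L / 2) <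
        ∫⁻ u in Icc (-1 : ℝ) 1, ∫⁻ y, b u y ∂π := by
      apply setLIntegral_strict_mono measurableSet_Icc
      · rw [hvol]; norm_num
      · exact hbm'
      · rw [setLIntegral_const]
        exact ENNReal.mul_ne_top ENNReal.ofReal_ne_top (by rw [hvol]; norm_num)
      · exact Filter.Eventually.of_forall fun u hu => hcon u hu
    rw [setLIntegral_const, hvol, show (2 : ℝ≥0∞) = ENNReal.ofReal 2 by simp,
      ← ENNReal.ofReal_mul (by positivity), div_mul_cancel₀ _ (by norm_num)] at hlt
    exact absurd hint (not_le.2 hlt)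
  have hpath := h.pathBound hW hE ht0 hK (Ψ := fun r => u * Ψ r) (by fun_prop) (hG u) (n := n + 1)
    (T := T) (ψ := fun i => u * ψ i) hT0 hT hT2 (by simp [hψ0])
    (fun i hi r hr => by rw [hlin i hi r hr]; ring) hb n (by omega) X
  rw [hTt, hψn, mul_zero] at hpath
  simp only [sub_zero, zero_div, neg_zero, zero_mul] at hpath
  set c := ∑ j ∈ Finset.range (n + 1), (u * ψ (j + 1) - u * ψ j) ^ 2 / (2 * (T (j + 1) - T j)) with hc
  have hcC : c ≤ C := by
    refine le_trans (Finset.sum_le_sum fun j hj => ?_) hC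
    rw [← mul_sub, mul_pow]
    have h1 := hT j (by simpa using hj)
    have h2 : u ^ 2 ≤ 1 := by rw [sq_le_one_iff_abs_le_one, abs_le]; exact hu
    have h3 : 0 < 2 * (T (j + 1) - T j) := by linarith
    gcongr
    exact mul_le_of_le_one_left (sq_nonneg _) h2
  have hbfin : ∫⁻ y, b u y ∂π ≠ ∞ := (hul.trans_lt ENNReal.ofReal_lt_top).ne
  have hbi : Integrable (fun y => (b u y).toReal) π :=
    integrable_toReal_of_lintegral_ne_top (hbu u).aemeasurable hbfin
  have hbv : ∫ y, (b u y).toReal ∂π ≤ L / 2 := by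
    rw [integral_toReal (hbu u).aemeasurable]
    · exact ENNReal.toReal_le_of_le_ofReal (by positivity) hul
    · exact Filter.Eventually.of_forall fun y =>
        (hG u y t0 0 t (X - y) ht (by linarith)).trans_lt ENNReal.ofReal_lt_top
  have hint : Integrable (fun y => -c + -2 * (b u y).toReal) π :=
    (integrable_const (-c)).add (hbi.const_mul (-2))
  have hj := ofReal_exp_integral_le hint
  have hjv : -(C + L) ≤ ∫ y, (-c + -2 * (b u y).toReal) ∂π := by
    rw [integral_add (integrable_const _) (hbi.const_mul _), integral_const, integral_const_mul]
    simp only [probReal_univ, one_smul]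
    linarith
  have hbu' := hbu u
  calc P * ENNReal.ofReal (Real.exp (-(C + L)))
      ≤ P * ∫⁻ y, ENNReal.ofReal (Real.exp (-c + -2 * (b u y).toReal)) ∂π := by
        gcongr
        refine le_trans ?_ hj
        exact ENNReal.ofReal_le_ofReal (Real.exp_le_exp.2 hjv)
    _ = ∫⁻ y, hk (t - t0) (X - y) *
          ENNReal.ofReal (Real.exp (-c + -2 * (b u y).toReal)) ∂m := by
        rw [hπi _ (by fun_prop), ← mul_assoc,
          ENNReal.mul_inv_cancel hP0 hPtop, one_mul]
    _ ≤ _ := by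
        refine le_trans (le_of_eq ?_) hpath
        apply lintegral_congr
        intro y
        simp only [hbdef]
        congr 3
        ring

/-! ### An explicit fan of paths -/

/-- The function equal to `f i` on the `i`-th interval of the subdivision `T`. -/
def stripFun (T : ℕ → ℝ) (n : ℕ) (f : ℕ → ℝ → ℝ) (r : ℝ) : ℝ :=
  ∑ i ∈ Finset.range n, (Ioo (T i) (T (i + 1))).indicator (f i) r

lemma measurable_stripFun (T : ℕ → ℝ) (n : ℕ) {f : ℕ → ℝ → ℝ} (hf : ∀ i, Measurable (f i)) :
    Measurable (stripFun T n f) :=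
  Finset.measurable_sum _ fun i _ => (hf i).indicator measurableSet_Ioo

lemma subdivision_le {T : ℕ → ℝ} {n : ℕ} (hT : ∀ i < n, T i < T (i + 1)) {i j : ℕ} (hij : i ≤ j)
    (hj : j ≤ n) : T i ≤ T j := by
  induction j, hij using Nat.le_induction with
  | base => exact le_rfl
  | succ j _ ih => exact (ih (by omega)).trans (hT j (by omega)).le

lemma stripFun_apply {T : ℕ → ℝ} {n : ℕ} (hT : ∀ i < n, T i < T (i + 1)) (f : ℕ → ℝ → ℝ) {i : ℕ}
    (hi : i < n) {r : ℝ} (hr : r ∈ Ioo (T i) (T (i + 1))) : stripFun T n f r = f i r := by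
  unfold stripFun
  rw [Finset.sum_eq_single i]
  · exact indicator_of_mem hr _
  · intro j hj hji
    have hj := Finset.mem_range.1 hj
    refine indicator_of_notMem (fun h => ?_) _
    rcases lt_or_gt_of_ne hji with h1 | h1
    · have := subdivision_le hT (show j + 1 ≤ i from h1) hi.le
      linarith [h.2, hr.1]
    · have := subdivision_le hT (show i + 1 ≤ j from h1) hj.le
      linarith [h.1, hr.2]
  · intro h
    exact absurd (Finset.mem_range.2 hi) h

lemma exists_strip {T : ℕ → ℝ} {n : ℕ} {r : ℝ} (hr : r ∈ Ioo (T 0) (T n)) (hne : ∀ i, r ≠ T i) :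
    ∃ i < n, r ∈ Ioo (T i) (T (i + 1)) := by
  induction n with
  | zero => exact absurd (hr.1.trans hr.2) (lt_irrefl _)
  | succ n ih =>
    rcases lt_or_gt_of_ne (hne n) with h | h
    · obtain ⟨i, hi, hi'⟩ := ih ⟨hr.1, h⟩
      exact ⟨i, by omega, hi'⟩
    · exact ⟨n, by omega, h, hr.2⟩

lemma ae_ne_subdivision (T : ℕ → ℝ) : ∀ᵐ r : ℝ, ∀ i, r ≠ T i :=
  ae_all_iff.2 fun i => Measure.ae_ne volume (T i)

lemma lintegral_subdivision_le (T : ℕ → ℝ) (n : ℕ) (g : ℝ → ℝ≥0∞) :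
    ∫⁻ r in Ioo (T 0) (T n), g r ≤
      ∑ i ∈ Finset.range n, ∫⁻ r in Ioo (T i) (T (i + 1)), g r := by
  induction n with
  | zero => simp
  | succ n ih =>
    rw [Finset.sum_range_succ]
    refine le_trans ?_ (add_le_add_left ih _)
    calc _ ≤ ∫⁻ r in Ioo (T 0) (T n) ∪ Ico (T n) (T (n + 1)), g r := by
          refine lintegral_mono_set fun r hr => ?_
          rcases lt_or_ge r (T n) with h | h
          · exact Or.inl ⟨hr.1, h⟩
          · exact Or.inr ⟨h, hr.2⟩
      _ ≤ _ := lintegral_union_le g _ _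
      _ = _ := by rw [setLIntegral_congr Ioo_ae_eq_Ico.symm]

/-- The times of the fan: fourth powers at both ends of the interval. -/
def fanTime (t0 t : ℝ) (m i : ℕ) : ℝ :=
  if i ≤ m then t0 + (t - t0) * (1 / 2 * (i / m : ℝ) ^ 4)
  else t - (t - t0) * (1 / 2 * (((2 * m - i : ℕ) : ℝ) / m) ^ 4)

/-- The heights of the fan: cubes at both ends of the interval. -/
def fanHeight (R : ℝ) (m i : ℕ) : ℝ := R * (((min i (2 * m - i) : ℕ) : ℝ) / m) ^ 3

/-- The fan is symmetric in time; `k` numbers the strips from the nearer end, so that `k = 0`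
singles out the first and last strips. -/
lemma fan_cases {t0 t : ℝ} (R : ℝ) {m i : ℕ} (hm : 0 < m) (hi : i < 2 * m) :
    ∃ k < m, (k = 0 ↔ i = 0 ∨ i = 2 * m - 1) ∧
      ((fanTime t0 t m i = t0 + (t - t0) * (1 / 2 * (k / m : ℝ) ^ 4) ∧
        fanTime t0 t m (i + 1) = t0 + (t - t0) * (1 / 2 * ((k + 1) / m : ℝ) ^ 4) ∧
        fanHeight R m i = R * (k / m : ℝ) ^ 3 ∧ fanHeight R m (i + 1) = R * ((k + 1) / m : ℝ) ^ 3) ∨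
      (fanTime t0 t m (i + 1) = t - (t - t0) * (1 / 2 * (k / m : ℝ) ^ 4) ∧
        fanTime t0 t m i = t - (t - t0) * (1 / 2 * ((k + 1) / m : ℝ) ^ 4) ∧
        fanHeight R m (i + 1) = R * (k / m : ℝ) ^ 3 ∧ fanHeight R m i = R * ((k + 1) / m : ℝ) ^ 3)) := by
  have hm' : (m : ℝ) ≠ 0 := by positivity
  rcases lt_or_ge i m with h | h
  · refine ⟨i, h, by omega, Or.inl ⟨?_, ?_, ?_, ?_⟩⟩
    · rw [fanTime, if_pos h.le]
    · rw [fanTime, if_pos (by omega)]; push_cast; rfl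
    · rw [fanHeight, min_eq_left (by omega)]
    · rw [fanHeight, min_eq_left (by omega)]; push_cast; rfl
  · refine ⟨2 * m - 1 - i, by omega, by omega, Or.inr ⟨?_, ?_, ?_, ?_⟩⟩
    · rw [fanTime, if_neg (by omega), show 2 * m - (i + 1) = 2 * m - 1 - i by omega]
    · rw [← Nat.cast_add_one, show 2 * m - 1 - i + 1 = 2 * m - i by omega]
      rcases eq_or_lt_of_le h with h1 | h1
      · rw [fanTime, if_pos h1.ge, ← h1, show 2 * m - m = m by omega, div_self hm']
        ring
      · rw [fanTime, if_neg (by omega)]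
    · rw [fanHeight, min_eq_right (by omega), show 2 * m - (i + 1) = 2 * m - 1 - i by omega]
    · rw [fanHeight, ← Nat.cast_add_one, min_eq_right (by omega),
        show 2 * m - 1 - i + 1 = 2 * m - i by omega]

/-- Cubes over fourth powers approximate a profile growing like the power `3/4` of the distance to
the nearer end. An exponent strictly between `1/2` and `1` makes both `∫ Ψ'²` and `∫ 1/Ψ` finite,
and `3/4` distributes both evenly: every strip costs `O(1/m)` of the total. -/
lemma fan_step {t0 t R : ℝ} (h : t0 < t) (hR : 0 < R) {m i : ℕ} (hm : 0 < m) (hi : i < 2 * m) :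
    fanTime t0 t m i < fanTime t0 t m (i + 1) ∧
    fanTime t0 t m (i + 1) - fanTime t0 t m i ≤ 2 * (t - t0) / m ∧
    (fanHeight R m (i + 1) - fanHeight R m i) ^ 2 /
      (2 * (fanTime t0 t m (i + 1) - fanTime t0 t m i)) ≤ 9 / 4 * R ^ 2 / ((t - t0) * m) ∧
    (i = 0 ∨ i = 2 * m - 1 → fanTime t0 t m (i + 1) - fanTime t0 t m i = (t - t0) / (2 * m ^ 4)) ∧
    (i ≠ 0 → i ≠ 2 * m - 1 →
      0 < min (fanHeight R m i) (fanHeight R m (i + 1)) ∧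
      (fanTime t0 t m (i + 1) - fanTime t0 t m i) * (1 / (2 * min (fanHeight R m i)
        (fanHeight R m (i + 1)))) ≤ 15 / 4 * (t - t0) / (R * m)) := by
  obtain ⟨k, hkm, hk0, hk⟩ := fan_cases (t0 := t0) (t := t) R hm hi
  have hm' : (0 : ℝ) < m := by positivity
  have hkr : (0 : ℝ) ≤ k := by positivity
  have hkm' : (k : ℝ) + 1 ≤ m := by exact_mod_cast hkm
  have hτ : 0 < t - t0 := sub_pos.2 h
  have hle : R * (k / m : ℝ) ^ 3 ≤ R * ((k + 1) / m : ℝ) ^ 3 := by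
    gcongr
    linarith
  have hΔ : fanTime t0 t m (i + 1) - fanTime t0 t m i =
      (t - t0) * (4 * k ^ 3 + 6 * k ^ 2 + 4 * k + 1) / (2 * m ^ 4) := by
    rcases hk with ⟨h1, h2, -, -⟩ | ⟨h1, h2, -, -⟩ <;> rw [h1, h2] <;> field_simp <;> ring
  have hψ : (fanHeight R m (i + 1) - fanHeight R m i) ^ 2 =
      (R * (3 * k ^ 2 + 3 * k + 1) / m ^ 3) ^ 2 := by
    rcases hk with ⟨-, -, h1, h2⟩ | ⟨-, -, h1, h2⟩ <;> rw [h1, h2] <;> field_simp <;> ring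
  have hmin : min (fanHeight R m i) (fanHeight R m (i + 1)) = R * (k / m : ℝ) ^ 3 := by
    rcases hk with ⟨-, -, h1, h2⟩ | ⟨-, -, h1, h2⟩
    · rw [h1, h2, min_eq_left hle]
    · rw [h1, h2, min_eq_right hle]
  refine ⟨?_, ?_, ?_, ?_, ?_⟩
  · rw [← sub_pos, hΔ]
    positivity
  · rw [hΔ, div_le_div_iff₀ (by positivity) hm']
    have h3 : ((k : ℝ) + 1) ^ 3 ≤ m ^ 3 := by gcongr
    calc (t - t0) * (4 * k ^ 3 + 6 * k ^ 2 + 4 * k + 1) * m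
        ≤ (t - t0) * (4 * ((k : ℝ) + 1) ^ 3) * m := by
          gcongr
          nlinarith
      _ ≤ (t - t0) * (4 * m ^ 3) * m := by gcongr
      _ = _ := by ring
  · rw [hΔ, hψ, div_le_div_iff₀ (by positivity) (by positivity)]
    have h3 : (3 * (k : ℝ) ^ 2 + 3 * k + 1) ^ 2 ≤
        9 / 4 * (4 * k ^ 3 + 6 * k ^ 2 + 4 * k + 1) * m := by
      calc (3 * (k : ℝ) ^ 2 + 3 * k + 1) ^ 2
          ≤ 9 / 4 * (4 * k ^ 3 + 6 * k ^ 2 + 4 * k + 1) * (k + 1) := by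
            have : (0 : ℝ) ≤ k ^ 3 := by positivity
            nlinarith [sq_nonneg (k : ℝ)]
        _ ≤ _ := by gcongr
    calc _ = (3 * (k : ℝ) ^ 2 + 3 * k + 1) ^ 2 * (R ^ 2 * (t - t0) * m / m ^ 6) := by
            field_simp
      _ ≤ 9 / 4 * (4 * k ^ 3 + 6 * k ^ 2 + 4 * k + 1) * m * (R ^ 2 * (t - t0) * m / m ^ 6) := by
            gcongr
      _ = _ := by field_simp
  · intro h0
    rw [hΔ, hk0.2 h0]
    simp
  · intro h0 h1
    have hk1 : (1 : ℝ) ≤ k := by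
      have : k ≠ 0 := fun hk' => (hk0.1 hk').elim h0 h1
      exact_mod_cast Nat.one_le_iff_ne_zero.2 this
    have hkp : (0 : ℝ) < k := by linarith
    rw [hmin, hΔ]
    refine ⟨by positivity, ?_⟩
    have h3 : 4 * (k : ℝ) ^ 3 + 6 * k ^ 2 + 4 * k + 1 ≤ 15 * k ^ 3 := by
      have h4 : (k : ℝ) ^ 2 ≤ k ^ 3 := pow_le_pow_right₀ hk1 (by norm_num)
      have h5 : (k : ℝ) ≤ k ^ 3 := by simpa using pow_le_pow_right₀ hk1 (show 1 ≤ 3 by norm_num)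
      have h6 : (1 : ℝ) ≤ k ^ 3 := one_le_pow₀ hk1
      linarith
    calc _ ≤ (t - t0) * (15 * k ^ 3) / (2 * m ^ 4) * (1 / (2 * (R * (k / m : ℝ) ^ 3))) := by gcongr
      _ = _ := by
        field_simp
        norm_num

lemma lintegral_bridgeSup_le_left {s t0 t : ℝ} (h : s ≤ t0) (ht : t0 ≤ t) :
    ∫⁻ r in Ioo s t0, ENNReal.ofReal (bridgeSup s t r) ≤ ENNReal.ofReal (2 * √(t0 - s)) := by
  refine le_trans ?_ (lintegral_bridgeSup_le (le_refl s) h)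
  apply setLIntegral_mono' measurableSet_Ioo
  intro r hr
  apply ENNReal.ofReal_le_ofReal
  unfold bridgeSup
  have : 0 < √(t0 - r) := Real.sqrt_pos.2 (sub_pos.2 hr.2)
  gcongr

lemma affine_ge_min {a b p q r : ℝ} (hr : r ∈ Ioo a b) :
    min p q ≤ p + (q - p) / (b - a) * (r - a) := by
  have h1 : 0 < b - a := by linarith [hr.1, hr.2]
  have h2 : 0 ≤ (r - a) / (b - a) := div_nonneg (by linarith [hr.1]) h1.le
  have h3 : (r - a) / (b - a) ≤ 1 := by rw [div_le_one h1]; linarith [hr.2]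
  rw [show p + (q - p) / (b - a) * (r - a) = (1 - (r - a) / (b - a)) * p + (r - a) / (b - a) * q by
    field_simp; ring]
  nlinarith [min_le_left p q, min_le_right p q]

/-- Lower bound for the killed heat equation, optimised over fans of height `R`. -/
lemma KilledFrom.lower_bound {W E : ℝ × ℝ → ℝ≥0∞} (hW : Measurable W) (hE : Measurable E) {S : ℝ}
    (hWS : ∫⁻ q, W q ^ 2 ≤ ENNReal.ofReal S) (hS : 0 ≤ S) {t0 : ℝ} {m : Measure ℝ}
    [SFinite m] (h : KilledFrom W E t0 m) (ht0 : 0 ≤ t0)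
    (hK : ∀ s ∈ Ioc t0 2, KilledFrom W E s (volume.withDensity fun z => E (s, z)))
    {t : ℝ} (ht : t0 < t) (ht2 : t ≤ 2) {R θ : ℝ} (hR : 0 < R) (hθ : 0 < θ) (X : ℝ) :
    (∫⁻ y, hk (t - t0) (X - y) ∂m) * ENNReal.ofReal (Real.exp
      (-(9 / 2 * R ^ 2 / (t - t0) + (θ * S + 15 / 2 * (t - t0) / R / θ)))) ≤ E (t, X) := by
  have hτ : 0 < t - t0 := sub_pos.2 ht
  obtain ⟨θ', h', hθ', hh', hg⟩ := exists_gain_le hS (show (0 : ℝ) < 1 / 2 by norm_num)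
  -- `N` is taken large for three reasons: to be positive, to make every strip short enough for the
  -- one-step bound, and to make the two end strips, where only the bridge density is available, as
  -- cheap as the others.
  obtain ⟨N, hN⟩ := exists_nat_ge (max (max 1 (2 * (t - t0) / h'))
    (√(2 * (t - t0)) * R * 4 / (15 * (t - t0))))
  have hN1 : (1 : ℝ) ≤ N := (le_max_left _ _).trans ((le_max_left _ _).trans hN)
  have hN2 : 2 * (t - t0) / h' ≤ N := (le_max_right _ _).trans ((le_max_left _ _).trans hN)
  have hN3 := (le_max_right _ _).trans hN
  have hN0 : 0 < N := by exact_mod_cast (zero_lt_one.trans_le hN1)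
  have hNr : (0 : ℝ) < N := by positivity
  have hn : 2 * N - 1 + 1 = 2 * N := by omega
  set T := fanTime t0 t N with hTdef
  set ψ := fanHeight R N with hψdef
  have hstep : ∀ i < 2 * N, _ := fun i hi => fan_step (i := i) ht hR hN0 hi
  have hT : ∀ i < 2 * N, T i < T (i + 1) := fun i hi => (hstep i hi).1
  have hT0 : T 0 = t0 := by simp [hTdef, fanTime]
  have hTn : T (2 * N) = t := by
    rw [hTdef, fanTime, if_neg (by omega)]; simp
  set lin : ℕ → ℝ → ℝ := fun i r => ψ i + (ψ (i + 1) - ψ i) / (T (i + 1) - T i) * (r - T i)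
  set κ : ℕ → ℝ → ℝ := fun i r => if i = 0 ∨ i = 2 * N - 1 then bridgeSup t0 t r
    else 1 / (2 * min (ψ i) (ψ (i + 1))) with hκdef
  have hκint : ∀ i < 2 * N, ∫⁻ r in Ioo (T i) (T (i + 1)), ENNReal.ofReal (κ i r) ≤
      ENNReal.ofReal (15 / 4 * (t - t0) / (R * N)) := by
    intro i hi
    obtain ⟨h1, -, -, h4, h5⟩ := hstep i hi
    by_cases he : i = 0 ∨ i = 2 * N - 1
    · have hsq : 2 * √(T (i + 1) - T i) ≤ 15 / 4 * (t - t0) / (R * N) := by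
        rw [h4 he, show (t - t0) / (2 * (N : ℝ) ^ 4) = 2 * (t - t0) / (2 * N ^ 2) ^ 2 by
          field_simp, Real.sqrt_div (by positivity), Real.sqrt_sq (by positivity)]
        rw [div_le_iff₀ (by positivity)] at hN3
        rw [le_div_iff₀ (by positivity)]
        calc 2 * (√(2 * (t - t0)) / (2 * (N : ℝ) ^ 2)) * (R * N) =
            (√(2 * (t - t0)) * R * 4) / (4 * N) := by field_simp
          _ ≤ (N * (15 * (t - t0))) / (4 * N) := by gcongr
          _ = _ := by field_simp
      have hκe : ∀ r, κ i r = bridgeSup t0 t r := fun r => if_pos he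
      simp_rw [hκe]
      refine le_trans ?_ (ENNReal.ofReal_le_ofReal hsq)
      rcases he with rfl | rfl
      · have h1 : T 0 < T (0 + 1) := h1
        rw [hT0] at h1 ⊢
        refine lintegral_bridgeSup_le_left h1.le ?_
        rw [← hTn]; exact subdivision_le hT (by omega) le_rfl
      · rw [hn, hTn]
        refine lintegral_bridgeSup_le ?_ ?_
        · rw [← hT0]; exact subdivision_le hT (by omega) (by omega)
        · rw [← hTn]; exact subdivision_le hT (by omega) le_rfl
    · have hκe : ∀ r, κ i r = 1 / (2 * min (ψ i) (ψ (i + 1))) := fun r => if_neg he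
      simp_rw [hκe]
      obtain ⟨h6, h7⟩ := h5 (fun h => he (Or.inl h)) (fun h => he (Or.inr h))
      rw [setLIntegral_const, Real.volume_Ioo, ← ENNReal.ofReal_mul (by positivity), mul_comm]
      exact ENNReal.ofReal_le_ofReal h7
  have hκsum : ∫⁻ r in Ioo t0 t, ENNReal.ofReal (stripFun T (2 * N) κ r) ≤
      ENNReal.ofReal (15 / 2 * (t - t0) / R) := by
    conv_lhs => rw [← hT0, ← hTn]
    refine (lintegral_subdivision_le T (2 * N) _).trans ?_
    calc _ ≤ ∑ i ∈ Finset.range (2 * N), ENNReal.ofReal (15 / 4 * (t - t0) / (R * N)) := by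
          refine Finset.sum_le_sum fun i hi => ?_
          have hi := Finset.mem_range.1 hi
          refine le_trans (le_of_eq ?_) (hκint i hi)
          exact setLIntegral_congr_fun measurableSet_Ioo fun r hr => by
            simp only [stripFun_apply hT κ hi hr]
      _ = _ := by
          rw [← ENNReal.ofReal_sum_of_nonneg (fun _ _ => by positivity)]
          congr 1
          rw [Finset.sum_const, Finset.card_range, nsmul_eq_mul]
          push_cast
          field_simp
          norm_num
  refine h.fan hW hE hWS hS ht0 hK (n := 2 * N - 1) (T := T) (ψ := ψ) (Ψ := stripFun T (2 * N) lin)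
    (measurable_stripFun T _ fun i => by fun_prop) hT0 (by rw [hn]; exact hT) (by rw [hn]; exact hTn)
    ht2 (by simp [hψdef, fanHeight]) (by rw [hn]; simp [hψdef, fanHeight]) ?_ ?_ ?_ hθ
    (κ := stripFun T (2 * N) κ) ?_ (K := 15 / 2 * (t - t0) / R) (by positivity) hκsum X
  · rw [hn]
    intro i hi r hr
    exact stripFun_apply hT lin hi hr
  · rw [hn]
    intro i hi y x
    refine (bridgeMean_le hW hS hWS hθ' y x).trans (ENNReal.ofReal_le_ofReal ?_)
    refine (gain_mono S hθ' ?_).trans hg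
    refine (hstep i hi).2.1.trans ?_
    rw [div_le_iff₀ hNr, mul_comm h']
    rwa [div_le_iff₀ hh'] at hN2
  · rw [hn]
    calc _ ≤ ∑ i ∈ Finset.range (2 * N), 9 / 4 * R ^ 2 / ((t - t0) * N) :=
          Finset.sum_le_sum fun i hi => (hstep i (Finset.mem_range.1 hi)).2.2.1
      _ = _ := by
          rw [Finset.sum_const, Finset.card_range, nsmul_eq_mul]
          push_cast
          field_simp
          norm_num
  · filter_upwards [ae_ne_subdivision T] with r hr hr'
    rw [← hT0, ← hTn] at hr'
    obtain ⟨i, hi, hri⟩ := exists_strip hr' hr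
    rw [stripFun_apply hT κ hi hri, stripFun_apply hT lin hi hri]
    by_cases he : i = 0 ∨ i = 2 * N - 1
    · left
      simp only [hκdef, if_pos he, le_refl]
    · right
      obtain ⟨h6, -⟩ := (hstep i hi).2.2.2.2 (fun h => he (Or.inl h)) (fun h => he (Or.inr h))
      have h7 : min (ψ i) (ψ (i + 1)) ≤ lin i r := affine_ge_min hri
      refine ⟨h6.trans_le h7, ?_⟩
      simp only [hκdef, if_neg he]
      gcongr

/-! ### The cost of killing for potentials of squared norm `54 lam^(5/2)` -/

lemma evol_eq_lintegral_withDensity {D : ℝ × ℝ → ℝ} (hD : Measurable D) (s t x : ℝ) :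
    ∫⁻ y, hk (t - s) (x - y) ∂(volume.withDensity fun z => ENNReal.ofReal (D (s, z))) =
      evol D s t x := by
  rw [lintegral_withDensity_eq_lintegral_mul _ (by fun_prop) (by fun_prop)]
  unfold evol
  apply lintegral_congr
  intro z
  simp [mul_comm]

lemma MildFrom.killedFrom_evol {w : ℝ × ℝ → ℝ} {D : ℝ × ℝ → ℝ}
    (hD : MildFrom 0 w (Measure.dirac (0, 0)) D) {S : ℝ} (hw : SqBound w S) (hneg : ∀ q, w q ≤ 0)
    {s : ℝ} (hs : 0 < s) (hs2 : s ≤ 2) :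
    KilledFrom (fun q => ‖w q‖ₑ) (fun q => ENNReal.ofReal (D q)) s
      (volume.withDensity fun z => ENNReal.ofReal (D (s, z))) where
  eq t ht x := by
    rw [hD.ofReal_add_duh_evol hw hneg hs ht x, evol_eq_lintegral_withDensity hD.meas]
  fin t ht x := by
    rw [evol_eq_lintegral_withDensity hD.meas]
    refine ((evol_le_hk hs (fun z => ?_) ht.1 x).trans_lt (hk_lt_top _ _)).ne
    exact hD.ofReal_le_hk hw hneg ⟨hs, hs2⟩ z

lemma MildFrom.killedFrom_dirac {w : ℝ × ℝ → ℝ} {D : ℝ × ℝ → ℝ}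
    (hD : MildFrom 0 w (Measure.dirac (0, 0)) D) {S : ℝ} (hw : SqBound w S)
    (hneg : ∀ q, w q ≤ 0) :
    KilledFrom (fun q => ‖w q‖ₑ) (fun q => ENNReal.ofReal (D q)) 0 (Measure.dirac 0) where
  eq t ht x := by
    rw [hD.ofReal_add_duh hw hneg (fun t ht x => hD.nonneg hw ht x) ht, heatSup_dirac,
      lintegral_dirac' _ (by fun_prop)]
    simp
  fin t ht x := by
    rw [lintegral_dirac' _ (by fun_prop)]
    exact hk_ne_top _ _

/-- The choices of `R` and `θ` make kinetic energy, `θ S` and the density term all proportional to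
`lam * σ`, with coefficients `9/2`, `54` and `15/2`. -/
lemma fan_cost_eq {lam σ : ℝ} (hlam : 0 < lam) (hσ : 0 < σ) :
    9 / 2 * (√lam * σ ^ 3) ^ 2 / σ ^ 5 + (σ / (lam * √lam) * (54 * lam ^ 2 * √lam) +
      15 / 2 * σ ^ 5 / (√lam * σ ^ 3) / (σ / (lam * √lam))) = 66 * lam * σ := by
  have h1 : 0 < √lam := Real.sqrt_pos.2 hlam
  rw [mul_pow, Real.sq_sqrt hlam.le]
  field_simp
  ring

/-- Over a time `σ ^ 5` the killing costs at most a factor `exp (-66 lam σ)`. -/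
lemma MildFrom.evol_mul_exp_le {w : ℝ × ℝ → ℝ} {D : ℝ × ℝ → ℝ}
    (hD : MildFrom 0 w (Measure.dirac (0, 0)) D) {lam : ℝ} (hlam : 0 < lam)
    (hw : SqBound w (54 * lam ^ 2 * √lam)) (hneg : ∀ q, w q ≤ 0) {s t σ : ℝ} (hs : 0 < s)
    (ht : t ∈ Ioc s 2) (hσ : 0 < σ) (hσt : t - s = σ ^ 5) (x : ℝ) :
    evol D s t x * ENNReal.ofReal (Real.exp (-(66 * lam * σ))) ≤ ENNReal.ofReal (D (t, x)) := by
  have h1 : 0 < √lam := Real.sqrt_pos.2 hlam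
  have h := (hD.killedFrom_evol hw hneg hs (ht.1.le.trans ht.2)).lower_bound hw.meas.enorm
    hD.meas.ennreal_ofReal hw.le hw.nonneg hs.le
    (fun r hr => hD.killedFrom_evol hw hneg (hs.trans hr.1) hr.2) ht.1 ht.2
    (R := √lam * σ ^ 3) (θ := σ / (lam * √lam)) (by positivity) (by positivity) x
  rwa [evol_eq_lintegral_withDensity hD.meas, hσt, fan_cost_eq hlam hσ] at h

lemma MildFrom.hk_mul_exp_le {w : ℝ × ℝ → ℝ} {D : ℝ × ℝ → ℝ}
    (hD : MildFrom 0 w (Measure.dirac (0, 0)) D) {lam : ℝ} (hlam : 0 < lam)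
    (hw : SqBound w (54 * lam ^ 2 * √lam)) (hneg : ∀ q, w q ≤ 0) {t σ : ℝ}
    (ht : t ∈ Ioc 0 2) (hσ : 0 < σ) (hσt : t = σ ^ 5) (x : ℝ) :
    hk t x * ENNReal.ofReal (Real.exp (-(66 * lam * σ))) ≤ ENNReal.ofReal (D (t, x)) := by
  have h1 : 0 < √lam := Real.sqrt_pos.2 hlam
  have h := (hD.killedFrom_dirac hw hneg).lower_bound hw.meas.enorm
    hD.meas.ennreal_ofReal hw.le hw.nonneg le_rfl
    (fun r hr => hD.killedFrom_evol hw hneg hr.1 hr.2) ht.1 ht.2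
    (R := √lam * σ ^ 3) (θ := σ / (lam * √lam)) (by positivity) (by positivity) x
  rw [lintegral_dirac' _ (by fun_prop)] at h
  simp only [sub_zero] at h
  have h2 := fan_cost_eq hlam hσ
  rw [← hσt] at h2
  rwa [h2] at h

/-! ### Hölder estimates for the logarithm in the two regimes -/

lemma exp_le_heatKernel {δ t x Q : ℝ} (hδ : 0 < δ) (ht : t ∈ Icc δ 2) (hQ : x ^ 2 ≤ Q) :
    Real.exp (-(Real.log (4 * Real.pi) / 2 + Q / (2 * δ))) ≤ heatKernel t x := by
  have hπ := Real.pi_pos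
  have ht0 : 0 < t := hδ.trans_le ht.1
  have hQ0 : 0 ≤ Q := (sq_nonneg x).trans hQ
  have h4 : 0 < 4 * Real.pi := by positivity
  rw [neg_add, Real.exp_add]
  unfold heatKernel
  apply mul_le_mul _ _ (Real.exp_pos _).le (by positivity)
  · rw [Real.exp_neg, Real.exp_half, Real.exp_log h4]
    have : 2 * Real.pi * t ≤ 4 * Real.pi := by nlinarith [ht.2]
    gcongr
  · apply Real.exp_le_exp.2
    rw [neg_div]
    apply neg_le_neg
    calc x ^ 2 / (2 * t) ≤ Q / (2 * t) := by gcongr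
      _ ≤ _ := by
        have := ht.1
        gcongr

/-- The common final step of both regimes. `E` is the logarithmic error of the free evolution, and
`log M + L` is the range of the logarithm entering the Harnack inequality. -/
lemma abs_log_sub_log_le_of_evol {D : ℝ × ℝ → ℝ} (hDm : Measurable D) {s t : ℝ} (hst : s < t)
    {M E L ε x x' : ℝ} (hM0 : 0 < M) (hM : ∀ z, D (s, z) ≤ M) (hε : 0 < ε)
    (hE : |Real.log (D (t, x)) - Real.log (evol D s t x).toReal| ≤ E)
    (hE' : |Real.log (D (t, x')) - Real.log (evol D s t x').toReal| ≤ E)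
    (hL : ENNReal.ofReal (Real.exp (-L)) ≤ evol D s t x)
    (hL' : ENNReal.ofReal (Real.exp (-L)) ≤ evol D s t x') :
    |Real.log (D (t, x)) - Real.log (D (t, x'))| ≤ 2 * E + ε * (Real.log M + L) +
      ((x - x') ^ 2 / (2 * (t - s)) + (x - x') ^ 2 / (2 * (t - s) * ε)) := by
  have hτ := sub_pos.2 hst
  have hf : ∀ z, ENNReal.ofReal (D (s, z)) ≤ ENNReal.ofReal M :=
    fun z => ENNReal.ofReal_le_ofReal (hM z)
  have hpos : ∀ y, ENNReal.ofReal (Real.exp (-L)) ≤ evol D s t y → evol D s t y ≠ 0 ∧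
      Real.log M - Real.log (evol D s t y).toReal ≤ Real.log M + L := by
    intro y hy
    have h0 : evol D s t y ≠ 0 := by
      refine (lt_of_lt_of_le ?_ hy).ne'
      exact ENNReal.ofReal_pos.2 (Real.exp_pos _)
    have htop : evol D s t y ≠ ∞ := by
      refine ne_top_of_le_ne_top (b := ENNReal.ofReal M) ENNReal.ofReal_ne_top ?_
      calc evol D s t y ≤ ∫⁻ z, hk (t - s) (y - z) * ENNReal.ofReal M := by
            unfold evol
            gcongr with z
            exact hM z
        _ = ENNReal.ofReal M := by
            rw [lintegral_mul_const _ (by fun_prop), lintegral_congr fun z => hk_sub_comm (t - s) y z, lintegral_hk hτ, one_mul]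
    refine ⟨h0, ?_⟩
    have h1 : Real.exp (-L) ≤ (evol D s t y).toReal := by
      rwa [← ENNReal.ofReal_le_iff_le_toReal htop]
    have h2 := Real.log_le_log (Real.exp_pos _) h1
    rw [Real.log_exp] at h2
    linarith
  exact abs_log_sub_log_le hτ (f := fun z => ENNReal.ofReal (D (s, z))) (by fun_prop) hM0 hf hε
    (hpos x hL).1 (hpos x' hL').1 hE hE' (hpos x hL).2 (hpos x' hL').2

lemma rpow_le_const_mul_rpow {x L a b : ℝ} (hx : 0 < x) (hL : x ≤ L) (hab : b ≤ a) :
    x ^ a ≤ L ^ (a - b) * x ^ b := by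
  calc x ^ a = x ^ (a - b) * x ^ b := by rw [← Real.rpow_add hx, sub_add_cancel]
    _ ≤ _ := by
      have : 0 ≤ a - b := sub_nonneg.2 hab
      gcongr

lemma abs_log_sub_log_toReal_le {a : ℝ≥0∞} (h0 : a ≠ 0) (htop : a ≠ ∞) {d E : ℝ} (hd : 0 < d)
    (h1 : a * ENNReal.ofReal (Real.exp (-E)) ≤ ENNReal.ofReal d) (h2 : ENNReal.ofReal d ≤ a) :
    |Real.log d - Real.log a.toReal| ≤ E := by
  have ha : 0 < a.toReal := ENNReal.toReal_pos h0 htop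
  have h3 : d ≤ a.toReal := by rwa [← ENNReal.ofReal_le_iff_le_toReal htop]
  have h4 : a.toReal * Real.exp (-E) ≤ d := by
    have h5 := ENNReal.toReal_mono ENNReal.ofReal_ne_top h1
    rwa [ENNReal.toReal_mul, ENNReal.toReal_ofReal (Real.exp_pos _).le,
      ENNReal.toReal_ofReal hd.le] at h5
  have h6 := Real.log_le_log hd h3
  have h7 := Real.log_le_log (by positivity) h4
  rw [Real.log_mul ha.ne' (Real.exp_pos _).ne', Real.log_exp] at h7
  have hE : 0 ≤ E := by linarith
  rw [abs_le]
  constructor <;> linarith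

lemma heatKernel_le_inv_sqrt {δ s : ℝ} (hδ : 0 < δ) (hs : δ / 2 ≤ s) (z : ℝ) :
    heatKernel s z ≤ (√(Real.pi * δ))⁻¹ := by
  refine (heatKernel_le s z).trans ?_
  have hπ := Real.pi_pos
  have : Real.pi * δ ≤ 2 * Real.pi * s := by nlinarith
  gcongr

lemma rpow_inv_pow {x : ℝ} (hx : 0 ≤ x) {n : ℕ} (hn : n ≠ 0) : (x ^ (1 / n : ℝ)) ^ n = x := by
  rw [one_div, Real.rpow_inv_natCast_pow hx hn]

/-- Spatial regularity of the logarithm for large `lam`. -/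
lemma exists_abs_log_sub_log_le_large {δ : ℝ} (hδ : 0 < δ) {b : ℝ} (hb : b ≤ 1 / 5) :
    ∃ C : ℝ, 0 < C ∧ ∀ lam : ℝ, 1 ≤ lam → ∀ w, SqBound w (54 * lam ^ 2 * √lam) →
      (∀ q, w q ≤ 0) → ∀ D, MildFrom 0 w (Measure.dirac (0, 0)) D →
      (∀ t ∈ Ioc (0 : ℝ) 2, ∀ x, 0 < D (t, x)) → ∀ t ∈ Icc δ 2, ∀ x x' Δ : ℝ,
      x ^ 2 ≤ lam / δ ^ 2 → x' ^ 2 ≤ lam / δ ^ 2 → 0 < Δ → Δ ≤ 2 / δ →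
      (x - x') ^ 2 = lam * Δ ^ 2 →
      |Real.log (D (t, x)) - Real.log (D (t, x'))| ≤ C * lam * Δ ^ b := by
  have hπ := Real.pi_pos
  set κ : ℝ := δ ^ 2 / 4 with hκ
  set M : ℝ := (√(Real.pi * δ))⁻¹ with hM
  set B : ℝ := |Real.log M| + Real.log (4 * Real.pi) / 2 + 1 / (2 * δ ^ 3) + 132 with hB
  have hlog : 0 ≤ Real.log (4 * Real.pi) := Real.log_nonneg (by linarith [Real.pi_gt_three])
  have hB0 : 0 ≤ B := by positivity
  refine ⟨132 * κ ^ (1 / 5 : ℝ) * (2 / δ) ^ (1 / 5 - b) + (B + 1 / (2 * κ)) * (2 / δ) ^ (1 / 2 - b) +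
    1 / (2 * κ) * (2 / δ) ^ (1 - b), by positivity, ?_⟩
  intro lam hlam w hw hneg D hD hpos t ht x x' Δ hx hx' hΔ hΔ' hxx
  have hlam0 : 0 < lam := by linarith
  have ht0 : 0 < t := hδ.trans_le ht.1
  -- The comparison time `σ ^ 5 = κ * Δ` is linear in `Δ`, so the killing error `lam * σ` is of
  -- order `lam * Δ ^ (1/5)`. The factor `κ = δ² / 4` and `Δ ≤ 2 / δ` keep `s ≥ δ / 2`.
  set σ : ℝ := (κ * Δ) ^ (1 / 5 : ℝ) with hσ
  have hσ0 : 0 < σ := by positivity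
  have hσ5 : σ ^ 5 = κ * Δ := rpow_inv_pow (n := 5) (by positivity) (by norm_num)
  have hκΔ : κ * Δ ≤ δ / 2 := by
    calc κ * Δ ≤ κ * (2 / δ) := by gcongr
      _ = _ := by rw [hκ]; field_simp; norm_num
  set s : ℝ := t - σ ^ 5 with hs
  have hsδ : δ / 2 ≤ s := by linarith [ht.1]
  have hs0 : 0 < s := by linarith
  have hst : s < t := by
    have : 0 < σ ^ 5 := by positivity
    linarith
  have hts : t - s = σ ^ 5 := by ring
  have hs2 : s ≤ 2 := hst.le.trans ht.2
  have hDs : ∀ z, ENNReal.ofReal (D (s, z)) ≤ hk s z := hD.ofReal_le_hk hw hneg ⟨hs0, hs2⟩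
  have hDM : ∀ z, D (s, z) ≤ M := fun z =>
    ((ENNReal.ofReal_le_ofReal_iff (heatKernel_nonneg s z)).1 (hDs z)).trans
      (heatKernel_le_inv_sqrt hδ hsδ z)
  have hup : ∀ y, ENNReal.ofReal (D (t, y)) ≤ evol D s t y := fun y =>
    le_self_add.trans_eq (hD.ofReal_add_duh_evol hw hneg hs0 ⟨hst, ht.2⟩ y)
  -- The killing bound is applied a second time, over the whole interval `(0, t]`, for the crude
  -- lower bound `log D ≥ -O(lam)` needed in the Harnack inequality.
  set σ' : ℝ := t ^ (1 / 5 : ℝ) with hσ'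
  have hσ'5 : t = σ' ^ 5 := (rpow_inv_pow (n := 5) ht0.le (by norm_num)).symm
  have hσ'2 : σ' ≤ 2 := by
    by_contra! hcon
    have : (2 : ℝ) ^ 5 ≤ σ' ^ 5 := by gcongr
    rw [← hσ'5] at this
    linarith [ht.2]
  have hE : ∀ y, |Real.log (D (t, y)) - Real.log (evol D s t y).toReal| ≤ 66 * lam * σ := by
    intro y
    have hp := hpos t ⟨ht0, ht.2⟩ y
    refine abs_log_sub_log_toReal_le ?_ ?_ hp
      (hD.evol_mul_exp_le hlam0 hw hneg hs0 ⟨hst, ht.2⟩ hσ0 hts y) (hup y)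
    · exact ((ENNReal.ofReal_pos.2 hp).trans_le (hup y)).ne'
    · exact ((evol_le_hk hs0 hDs hst y).trans_lt (hk_lt_top _ _)).ne
  have hL : ∀ y, y ^ 2 ≤ lam / δ ^ 2 → ENNReal.ofReal (Real.exp
      (-(Real.log (4 * Real.pi) / 2 + lam / δ ^ 2 / (2 * δ) + 66 * lam * σ'))) ≤ evol D s t y := by
    intro y hy
    refine le_trans ?_ ((hD.hk_mul_exp_le hlam0 hw hneg ⟨ht0, ht.2⟩ (by positivity) hσ'5 y).trans
      (hup y))
    rw [neg_add _ (66 * lam * σ'), Real.exp_add, ENNReal.ofReal_mul (Real.exp_pos _).le]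
    gcongr
    exact ENNReal.ofReal_le_ofReal (exp_le_heatKernel hδ ht hy)
  -- The choice `ε = √Δ` balances `ε * lam` against `lam * Δ² / (Δ * ε)`.
  have h := abs_log_sub_log_le_of_evol hD.meas hst (by positivity) hDM (Real.sqrt_pos.2 hΔ) (hE x)
    (hE x') (hL x hx) (hL x' hx')
  have hBle : Real.log M + (Real.log (4 * Real.pi) / 2 + lam / δ ^ 2 / (2 * δ) + 66 * lam * σ') ≤
      B * lam := by
    have h1 : Real.log M ≤ |Real.log M| * lam :=
      (le_abs_self _).trans (le_mul_of_one_le_right (abs_nonneg _) hlam)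
    have h2 : Real.log (4 * Real.pi) / 2 ≤ Real.log (4 * Real.pi) / 2 * lam :=
      le_mul_of_one_le_right (by positivity) hlam
    have h3 : lam / δ ^ 2 / (2 * δ) = 1 / (2 * δ ^ 3) * lam := by field_simp
    have h4 : 66 * lam * σ' ≤ 132 * lam := by nlinarith
    rw [hB]
    linarith
  have hsq : √Δ = Δ ^ (1 / 2 : ℝ) := Real.sqrt_eq_rpow Δ
  have e1 : (x - x') ^ 2 / (2 * (t - s)) = 1 / (2 * κ) * lam * Δ ^ (1 : ℝ) := by
    rw [hxx, hts, hσ5, Real.rpow_one]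
    field_simp
  have e2 : (x - x') ^ 2 / (2 * (t - s) * √Δ) = 1 / (2 * κ) * lam * Δ ^ (1 / 2 : ℝ) := by
    rw [hxx, hts, hσ5, ← hsq]
    have h5 : 0 < √Δ := Real.sqrt_pos.2 hΔ
    field_simp
    rw [Real.sq_sqrt hΔ.le]
  have e3 : σ = κ ^ (1 / 5 : ℝ) * Δ ^ (1 / 5 : ℝ) := Real.mul_rpow (by positivity) hΔ.le
  rw [e1, e2, e3] at h
  have f1 := rpow_le_const_mul_rpow hΔ hΔ' hb
  have f2 := rpow_le_const_mul_rpow hΔ hΔ' (show b ≤ 1 / 2 by linarith)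
  have f3 := rpow_le_const_mul_rpow hΔ hΔ' (show b ≤ 1 by linarith)
  calc _ ≤ _ := h
    _ ≤ 2 * (66 * lam * (κ ^ (1 / 5 : ℝ) * Δ ^ (1 / 5 : ℝ))) + Δ ^ (1 / 2 : ℝ) * (B * lam) +
        (1 / (2 * κ) * lam * Δ ^ (1 : ℝ) + 1 / (2 * κ) * lam * Δ ^ (1 / 2 : ℝ)) := by
      rw [← hsq]
      gcongr
    _ ≤ 2 * (66 * lam * (κ ^ (1 / 5 : ℝ) * ((2 / δ) ^ (1 / 5 - b) * Δ ^ b))) +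
        (2 / δ) ^ (1 / 2 - b) * Δ ^ b * (B * lam) +
        (1 / (2 * κ) * lam * ((2 / δ) ^ (1 - b) * Δ ^ b) +
          1 / (2 * κ) * lam * ((2 / δ) ^ (1 / 2 - b) * Δ ^ b)) := by
      gcongr
    _ = _ := by ring

/-- Spatial regularity of the logarithm for potentials of bounded cost. -/
lemma exists_abs_log_sub_log_le_small {δ : ℝ} (hδ : 0 < δ) {S : ℝ} (hS : 0 ≤ S) :
    ∃ C : ℝ, 0 < C ∧ ∀ w, SqBound w S → ∀ D, MildFrom 0 w (Measure.dirac (0, 0)) D →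
      ∀ t ∈ Icc δ 2, ∀ x x' : ℝ, x ^ 2 ≤ 2 / δ ^ 2 → x' ^ 2 ≤ 2 / δ ^ 2 → x ≠ x' →
      |x - x'| ≤ 4 / δ →
      |Real.log (D (t, x)) - Real.log (D (t, x'))| ≤ C * |x - x'| ^ (1 / 4 : ℝ) := by
  have hπ := Real.pi_pos
  obtain ⟨K, hK1, hK⟩ := exists_two_sided_bound hS
  have hK0 : 0 < K := by linarith
  set g : ℝ := 1 / (4 * (S / 2 + 1)) with hg
  have hg0 : 0 < g := by positivity
  -- The first bound keeps `s ≥ δ / 2`; the second keeps `θ ≤ g`, hence the gain at most `1/4`.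
  set κ : ℝ := min (δ ^ 2 / 8) (g ^ 4 * (δ / 4)) with hκ
  have hκ0 : 0 < κ := by positivity
  set M : ℝ := K * (√(Real.pi * δ))⁻¹ with hM
  set L : ℝ := Real.log K + (Real.log (4 * Real.pi) / 2 + 2 / δ ^ 2 / (2 * δ)) with hL
  set B : ℝ := |Real.log M + L| with hB
  refine ⟨8 * (S / 2 + 1) * κ ^ (1 / 4 : ℝ) + (B + 1 / (2 * κ)) * (4 / δ) ^ (1 / 2 - 1 / 4 : ℝ) +
    1 / (2 * κ) * (4 / δ) ^ (1 - 1 / 4 : ℝ), by positivity, ?_⟩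
  intro w hw D hD t ht x x' hx hx' hne hd
  have hd0 : 0 < |x - x'| := abs_pos.2 (sub_ne_zero.2 hne)
  set d : ℝ := |x - x'| with hddef
  have hdsq : (x - x') ^ 2 = d ^ 2 := (sq_abs _).symm
  have ht0 : 0 < t := hδ.trans_le ht.1
  -- With comparison time `θ ^ 4` both terms of the gain are linear in `θ`, which gives the exponent
  -- `1/4`.
  set θ : ℝ := (κ * d) ^ (1 / 4 : ℝ) with hθ
  have hθ0 : 0 < θ := by positivity
  have hθ4 : θ ^ 4 = κ * d := rpow_inv_pow (n := 4) (by positivity) (by norm_num)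
  have hκd : κ * d ≤ δ / 2 := by
    calc κ * d ≤ δ ^ 2 / 8 * (4 / δ) := by
          gcongr
          exact min_le_left _ _
      _ = _ := by field_simp; norm_num
  have hκd' : θ ^ 4 ≤ g ^ 4 := by
    rw [hθ4]
    calc κ * d ≤ g ^ 4 * (δ / 4) * (4 / δ) := by
          gcongr
          exact min_le_right _ _
      _ = _ := by field_simp
  have hθg : θ ≤ g := le_of_pow_le_pow_left₀ (by norm_num) hg0.le hκd'
  set s : ℝ := t - θ ^ 4 with hs
  have hsδ : δ / 2 ≤ s := by linarith [ht.1]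
  have hs0 : 0 < s := by linarith
  have hst : s < t := by
    have : 0 < θ ^ 4 := by positivity
    linarith
  have hts : t - s = θ ^ 4 := by ring
  have hs2 : s ≤ 2 := hst.le.trans ht.2
  have hgain : gain S θ (t - s) = (S / 2 + 1) * θ := by
    unfold gain
    rw [hts, show θ ^ 4 = (θ ^ 2) ^ 2 by ring, Real.sqrt_sq (by positivity)]
    field_simp
  have hgain' : gain S θ (t - s) ≤ 1 / 4 := by
    rw [hgain]
    calc (S / 2 + 1) * θ ≤ (S / 2 + 1) * g := by gcongr
      _ = _ := by rw [hg]; field_simp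
  have hDM : ∀ z, D (s, z) ≤ M := fun z =>
    (hK w hw D hD s ⟨hs0, hs2⟩ z).2.trans
    (mul_le_mul_of_nonneg_left (heatKernel_le_inv_sqrt hδ hsδ z) hK0.le)
  have hev : ∀ y, ENNReal.ofReal (K⁻¹ * heatKernel t y) ≤ evol D s t y := evol_ge hs0
    (by positivity) (fun z => (hK w hw D hD s ⟨hs0, hs2⟩ z).1) hst
  have hev' : ∀ y, evol D s t y ≤ ENNReal.ofReal (K * heatKernel t y) := evol_le hs0
    (by positivity) (fun z => (hK w hw D hD s ⟨hs0, hs2⟩ z).2) hst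
  have hE : ∀ y, |Real.log (D (t, y)) - Real.log (evol D s t y).toReal| ≤
      4 * ((S / 2 + 1) * θ) := by
    intro y
    rw [← hgain]
    refine hD.abs_log_sub_log_evol_le hw hθ0 hs0 ⟨hst, ht.2⟩ hgain' y ?_
    refine ENNReal.toReal_pos ?_ ((hev' y).trans_lt ENNReal.ofReal_lt_top).ne
    have := heatKernel_pos ht0 y
    exact ((ENNReal.ofReal_pos.2 (by positivity)).trans_le (hev y)).ne'
  have hLe : ∀ y, y ^ 2 ≤ 2 / δ ^ 2 → ENNReal.ofReal (Real.exp (-L)) ≤ evol D s t y := by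
    intro y hy
    refine le_trans (ENNReal.ofReal_le_ofReal ?_) (hev y)
    rw [hL, neg_add, Real.exp_add, Real.exp_neg (Real.log K), Real.exp_log hK0]
    have := exp_le_heatKernel hδ ht hy
    gcongr
  have h := abs_log_sub_log_le_of_evol hD.meas hst (by positivity) hDM (Real.sqrt_pos.2 hd0) (hE x)
    (hE x') (hLe x hx) (hLe x' hx')
  have hBle : Real.log M + L ≤ B := le_abs_self _
  have hsq : √d = d ^ (1 / 2 : ℝ) := Real.sqrt_eq_rpow d
  have e1 : (x - x') ^ 2 / (2 * (t - s)) = 1 / (2 * κ) * d ^ (1 : ℝ) := by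
    rw [hdsq, hts, hθ4, Real.rpow_one]
    field_simp
  have e2 : (x - x') ^ 2 / (2 * (t - s) * √d) = 1 / (2 * κ) * d ^ (1 / 2 : ℝ) := by
    rw [hdsq, hts, hθ4, ← hsq]
    have h5 : 0 < √d := Real.sqrt_pos.2 hd0
    field_simp
    rw [Real.sq_sqrt hd0.le]
  have e3 : θ = κ ^ (1 / 4 : ℝ) * d ^ (1 / 4 : ℝ) := Real.mul_rpow (by positivity) hd0.le
  rw [e1, e2, e3] at h
  have f2 := rpow_le_const_mul_rpow hd0 hd (show (1 / 4 : ℝ) ≤ 1 / 2 by norm_num)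
  have f3 := rpow_le_const_mul_rpow hd0 hd (show (1 / 4 : ℝ) ≤ 1 by norm_num)
  calc _ ≤ _ := h
    _ ≤ 2 * (4 * ((S / 2 + 1) * (κ ^ (1 / 4 : ℝ) * d ^ (1 / 4 : ℝ)))) + d ^ (1 / 2 : ℝ) * B +
        (1 / (2 * κ) * d ^ (1 : ℝ) + 1 / (2 * κ) * d ^ (1 / 2 : ℝ)) := by
      rw [← hsq]
      gcongr
    _ ≤ 2 * (4 * ((S / 2 + 1) * (κ ^ (1 / 4 : ℝ) * d ^ (1 / 4 : ℝ)))) +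
        (4 / δ) ^ (1 / 2 - 1 / 4 : ℝ) * d ^ (1 / 4 : ℝ) * B +
        (1 / (2 * κ) * ((4 / δ) ^ (1 - 1 / 4 : ℝ) * d ^ (1 / 4 : ℝ)) +
          1 / (2 * κ) * ((4 / δ) ^ (1 / 2 - 1 / 4 : ℝ) * d ^ (1 / 4 : ℝ))) := by
      gcongr
    _ = _ := by ring

/-! ### Undoing the scaling, and the conclusion -/

lemma SqBound.weaken {v : ℝ × ℝ → ℝ} {S S' : ℝ} (hv : SqBound v S) (h : S ≤ S') : SqBound v S' :=
  ⟨hv.meas, hv.nonneg.trans h, hv.le.trans (ENNReal.ofReal_le_ofReal h)⟩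

lemma mul_scaledPotential {lam : ℝ} (hlam : 0 < lam) (w : ℝ × ℝ → ℝ) :
    (fun q : ℝ × ℝ => lam * scaledPotential lam w (q.1, (√lam)⁻¹ * q.2)) = w := by
  funext q
  have h1 : 0 < √lam := Real.sqrt_pos.2 hlam
  simp only [scaledPotential]
  rw [mul_inv_cancel_left₀ hlam.ne', mul_inv_cancel_left₀ h1.ne']

lemma exists_mildFrom_of_isScaledSolution {lam : ℝ} (hlam : 0 < lam) {w v : ℝ × ℝ → ℝ}
    {Z : ℝ → ℝ → ℝ} (hZ : IsScaledSolution lam (scaledPotential lam w) Z) (hvm : Measurable v)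
    (hv : v =ᵐ[slabMeasure 2] w) : ∃ D, MildFrom 0 v (Measure.dirac (0, 0)) D ∧
      ∀ t ∈ Ioc (0 : ℝ) 2, ∀ x, Z t x = D (t, √lam * x) := by
  obtain ⟨U, hU, hZU⟩ := hZ
  rw [mul_scaledPotential hlam] at hU
  obtain ⟨D, hD, hUD⟩ := hU.exists_mildFrom hvm hv
  exact ⟨D, hD, fun t ht x => by rw [hZU, hUD t ht]⟩

lemma sq_sqrt_mul_le {lam δ x : ℝ} (hlam : 0 < lam) (hx : x ∈ Icc (-δ⁻¹) δ⁻¹) :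
    (√lam * x) ^ 2 ≤ lam / δ ^ 2 := by
  rw [mul_pow, Real.sq_sqrt hlam.le, div_eq_mul_inv, ← inv_pow]
  have : x ^ 2 ≤ δ⁻¹ ^ 2 := sq_le_sq' hx.1 hx.2
  gcongr

end

/-- Spatial Hölder estimate, uniform in `lam`, for `h_lam = lam⁻¹ log Z_lam[w_lam]`, where `w_lam` is
the scaled minimizer.  Positivity of the solution, which makes the logarithm meaningful, is part of
the claim. -/
theorem proposition4p1 :
    ∀ δ : ℝ, 0 < δ → ∃ c : ℝ, 0 < c ∧
      ∀ lam : ℝ, 1 / c ≤ lam →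
      ∀ w : ℝ × ℝ → ℝ, IsMinimizer lam w →
      ∀ Z : ℝ → ℝ → ℝ, IsScaledSolution lam (scaledPotential lam w) Z →
      ∀ t ∈ Set.Icc δ 2, ∀ x ∈ Set.Icc (-δ⁻¹) δ⁻¹, ∀ x' ∈ Set.Icc (-δ⁻¹) δ⁻¹,
        0 < Z t x ∧ 0 < Z t x' ∧
          |logProfile lam Z t x - logProfile lam Z t x'| ≤ c * |x - x'| ^ ((2 : ℝ) / 13 - δ) := by
  intro δ hδ
  set b : ℝ := 2 / 13 - δ with hb
  have hb5 : b ≤ 1 / 5 := by rw [hb]; linarith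
  obtain ⟨K, hK0, hK⟩ := exists_cost_le_of_lt_two
  obtain ⟨C₁, hC₁, h₁⟩ := exists_abs_log_sub_log_le_large hδ hb5
  obtain ⟨C₂, hC₂, h₂⟩ := exists_abs_log_sub_log_le_small hδ hK0
  set C₃ : ℝ := C₂ * (2 / δ) ^ (1 / 4 - b) with hC₃
  have hC₃0 : 0 < C₃ := by positivity
  -- For `lam < 2` the estimate carries a factor `C₃ * lam ^ (1/8)`, the exponent being `1/4` of
  -- that of `√lam`, and `c * lam` is available. Since `c * lam ≥ 1`, the inequality `C₃ ≤ c ^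
  -- (1/8)` suffices.
  refine ⟨max C₁ (C₃ ^ 8), by positivity, ?_⟩
  set c := max C₁ (C₃ ^ 8) with hc
  have hc0 : 0 < c := by positivity
  intro lam hlam w hw Z hZ t ht x hx x' hx'
  have hlam0 : 0 < lam := lt_of_lt_of_le (by positivity) hlam
  have hsl : 0 < √lam := Real.sqrt_pos.2 hlam0
  have ht02 : t ∈ Ioc (0 : ℝ) 2 := ⟨hδ.trans_le ht.1, ht.2⟩
  -- Strict positivity comes from the perturbative two-sided bound; its constant depends on the norm
  -- of the potential and does not enter the estimate.
  have hpos : ∀ {v S D}, SqBound v S → MildFrom 0 v (Measure.dirac (0, 0)) D →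
      ∀ t ∈ Ioc (0 : ℝ) 2, ∀ x, 0 < D (t, x) := by
    intro v S D hv hD t ht x
    obtain ⟨A, hA, hAb⟩ := exists_two_sided_bound hv.nonneg
    have := heatKernel_pos ht.1 x
    exact lt_of_lt_of_le (by positivity) (hAb v hv D hD t ht x).1
  obtain ⟨v, hvw, hv, -⟩ := exists_sqBound hw.1.1
  have hΔ2 : |x - x'| ≤ 2 / δ := by
    rw [abs_le, show 2 / δ = 2 * δ⁻¹ by ring]
    constructor <;> linarith [hx.1, hx.2, hx'.1, hx'.2]
  have hxs := sq_sqrt_mul_le hlam0 hx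
  have hxs' := sq_sqrt_mul_le hlam0 hx'
  have hdiff : ∀ y y', logProfile lam Z t y - logProfile lam Z t y' =
      (Real.log (Z t y) - Real.log (Z t y')) / lam := by
    intro y y'
    unfold logProfile
    ring
  rcases le_or_gt 2 lam with h2 | h2
  · have hneg : ∀ᵐ q ∂(slabMeasure 2), w q ≤ 0 := by
      refine hw.nonpos ?_
      calc Real.exp (-lam) ≤ Real.exp (-2) := by gcongr
        _ ≤ _ := exp_neg_two_le.trans le_heatKernel_two_zero
    have hvm := hv.meas
    have hv' : SqBound (fun q => min (v q) 0) (54 * lam ^ 2 * √lam) := by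
      refine (hv.mono (by fun_prop) fun q => ?_).weaken (hw.cost_le_of_two_le h2)
      rcases le_total (v q) 0 with h | h <;> simp [h]
    have hvw' : (fun q => min (v q) 0) =ᵐ[slabMeasure 2] w := by
      filter_upwards [hvw, hneg] with q h1 h3
      rw [h1, min_eq_left h3]
    obtain ⟨D, hD, hZD⟩ := exists_mildFrom_of_isScaledSolution hlam0 hZ hv'.meas hvw'
    have hDp := hpos hv' hD
    refine ⟨by rw [hZD t ht02]; exact hDp t ht02 _, by rw [hZD t ht02]; exact hDp t ht02 _, ?_⟩
    rcases eq_or_ne x x' with rfl | hne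
    · rw [sub_self, abs_zero]
      positivity
    have hΔ : 0 < |x - x'| := abs_pos.2 (sub_ne_zero.2 hne)
    rw [hdiff, abs_div, abs_of_pos hlam0, hZD t ht02, hZD t ht02, div_le_iff₀ hlam0]
    refine (h₁ lam (by linarith) _ hv' (fun q => min_le_right _ _) D hD hDp t ht _ _ |x - x'|
      hxs hxs' hΔ hΔ2 ?_).trans ?_
    · rw [← mul_sub, mul_pow, Real.sq_sqrt hlam0.le, sq_abs]
    · rw [mul_right_comm]
      gcongr
      exact le_max_left _ _
  · obtain ⟨D, hD, hZD⟩ := exists_mildFrom_of_isScaledSolution hlam0 hZ hv.meas hvw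
    have hDp := hpos hv hD
    refine ⟨by rw [hZD t ht02]; exact hDp t ht02 _, by rw [hZD t ht02]; exact hDp t ht02 _, ?_⟩
    rcases eq_or_ne x x' with rfl | hne
    · rw [sub_self, abs_zero]
      positivity
    have hΔ : 0 < |x - x'| := abs_pos.2 (sub_ne_zero.2 hne)
    have hsl2 : √lam ≤ 2 := by
      rw [Real.sqrt_le_left (by norm_num)]
      linarith
    have hd : |√lam * x - √lam * x'| = √lam * |x - x'| := by
      rw [← mul_sub, abs_mul, abs_of_pos hsl]
    have hlamδ : lam / δ ^ 2 ≤ 2 / δ ^ 2 := by gcongr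
    have h := h₂ v (hv.weaken (hK lam hlam0 h2.le w hw)) D hD t ht _ _ (hxs.trans hlamδ)
      (hxs'.trans hlamδ) (fun h => hne (mul_left_cancel₀ hsl.ne' h)) (by
        rw [hd]
        calc √lam * |x - x'| ≤ 2 * (2 / δ) := by gcongr
          _ = _ := by ring)
    rw [hd, Real.mul_rpow hsl.le hΔ.le, Real.sqrt_eq_rpow, ← Real.rpow_mul hlam0.le] at h
    rw [hdiff, abs_div, abs_of_pos hlam0, hZD t ht02, hZD t ht02, div_le_iff₀ hlam0,
      Real.sqrt_eq_rpow]
    have f := rpow_le_const_mul_rpow hΔ hΔ2 (show b ≤ 1 / 4 by linarith)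
    have hC₃c : C₃ * lam ^ (1 / 8 : ℝ) ≤ c * lam := by
      have h5 : 1 ≤ c * lam := by
        rw [div_le_iff₀ hc0] at hlam
        linarith
      have h6 : C₃ ≤ c ^ (1 / 8 : ℝ) := by
        rw [one_div, Real.le_rpow_inv_iff_of_pos hC₃0.le hc0.le (by norm_num)]
        exact_mod_cast le_max_right _ _
      calc C₃ * lam ^ (1 / 8 : ℝ) ≤ c ^ (1 / 8 : ℝ) * lam ^ (1 / 8 : ℝ) := by gcongr
        _ = (c * lam) ^ (1 / 8 : ℝ) := (Real.mul_rpow hc0.le hlam0.le).symm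
        _ ≤ (c * lam) ^ (1 : ℝ) := Real.rpow_le_rpow_of_exponent_le h5 (by norm_num)
        _ = _ := Real.rpow_one _
    calc _ ≤ C₂ * (lam ^ (1 / 2 * (1 / 4) : ℝ) * |x - x'| ^ (1 / 4 : ℝ)) := h
      _ ≤ C₂ * (lam ^ (1 / 2 * (1 / 4) : ℝ) * ((2 / δ) ^ (1 / 4 - b) * |x - x'| ^ b)) := by gcongr
      _ = C₃ * lam ^ (1 / 8 : ℝ) * |x - x'| ^ b := by
        rw [hC₃, show (1 / 2 * (1 / 4) : ℝ) = 1 / 8 by norm_num]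
        ring
      _ ≤ c * lam * |x - x'| ^ b := by gcongr
      _ = _ := by ring
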